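/- **Setting.** Let $\mathfrak A_0,\mathfrak A_1$ be complex Hilbert spaces with $\dim\mathfrak A_1<\infty$, let $A_0$ (possibly unbounded) and $A_1$ be self-adjoint operators in $\mathfrak A_0$ and $\mathfrak A_1$, let $B:\mathfrak A_1\to\mathfrak A_0$ be bounded, and let $$L=\begin{pmatrix}A_0&B\\-B^*&A_1\end{pmatrix},\qquad \mathrm{Dom}(L)=\mathrm{Dom}(A_0)\oplus\mathfrak A_1 .$$ For $z\notin\sigma(A_0)$ put $M_1(z)=A_1-z+B^*(A_0-z)^{-1}B$. Let $\Delta_0=(a,b)$, $-\infty\le a<b\le\infty$. Assume that the spectrum of $A_0$ is absolutely continuous and equals $\overline{\Delta_0}$, and that $\sigma_1:=\sigma(A_1)\subset\Delta_0$. Let $E$ be the spectral measure of $A_0$ and $K_B(\mu)=B^*E((-\infty,\mu))B$. Assume that $K_B$ is differentiable on $\Delta_0$ in operator norm and that $K_B'$ admits an analytic continuation, again denoted $K_B'$, from $\Delta_0$ to a simply connected domain $D^-\subset\mathbb C^-$ with $\Delta_0\subset\partial D^-$ and to the mirror image $D^+$ of $D^-$ in the real axis. If an end point $r\in\{a,b\}$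 is finite, assume $\|K_B'(\mu)\|\le C|\mu-r|^{p}$ for $\mu\in D^\pm$ near $r$, for some $C>0$ and $p\in(-1,0]$. **Contours.** For $l=\pm1$ write $D^l$ for $D^\pm$. An *admissible contour* $\Gamma^l\subset D^l$ is a Jordan arc, rectifiable (locally rectifiable towards infinite end points), such that $\mathcal V_0(\Gamma^l)=\int_{\Gamma^l}|d\mu|\,\|K_B'(\mu)\|<\infty$ and such that $\Gamma^l$ is obtained from $\Delta_0$ by a continuous deformation $h(s,t)$, $s\in[0,1]$, $t\in\Delta_0$, with $h(0,t)=t$, $h(1,\cdot)$ a parametrization of $\Gamma^l$, and $h(s,t)\in D^l$ for $s>0$; finite end points are kept fixed ($h(s,t)\to r$ uniformly in $s$ as $t\to r$), and at an infinite end point $|h(s,t)|\to\infty$ uniformly in $s$ and $\|K_B'(h(s,t))\|\le C(1+|h(s,t)|)^m$ near that end for some $C,m$. Put $d(\Gamma^l)=\mathrm{dist}(\sigma_1,\Gamma^l)$, $$r_{\min}(\Gamma^l)=\tfrac12 d(\Gamma^l)-\sqrt{\tfrac14d(\Gamma^l)^2-\mathcal V_0(\Gamma^l)},\qquad r_{\max}(\Gamma^l)=d(\Gamma^l)-\sqrt{\mathcal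 V_0(\Gamma^l)},$$ and let $r_0$ be the infimum of $r_{\min}(\Gamma^l)$ over all admissible contours $\Gamma^l\subset D^l$ with $d(\Gamma^l)^2-4\mathcal V_0(\Gamma^l)>0$. **Hypothesis.** Let $l=\pm1$, let $\Gamma^l\subset D^l$ be an admissible contour with $\mathcal V_0(\Gamma^l)<\frac14 d(\Gamma^l)^2$, and suppose there is $c_0>0$ with $$\langle K_B'(\mu)x,x\rangle\ge c_0\|x\|^2\quad\text{for all }x\in\mathfrak A_1\text{ and all }\mu\in\Delta_0\text{ with }\mathrm{dist}(\mu,\sigma_1)\le r_0 .$$ **Lemma.** The equation $$X=-\int_{\Gamma^l}d\mu\,K_B'(\mu)\,(A_1+X-\mu)^{-1}$$ has a solution $X^{(l)}$ with $\|X^{(l)}\|\le r_{\min}(\Gamma^l)$, and it is the only solution with $\|X\|<r_{\max}(\Gamma^l)$. The operator $Z^{(l)}=A_1+X^{(l)}$ has no spectrum in $D^l$. Every eigenvalue $z$ of $Z^{(l)}$ is non-real (so $z\notin\sigma(A_0)$), is an eigenvalue of the non-continued Schur complement, i.e. $\ker M_1(z)\neq\{0\}$, and is an eigenvalue of $L$.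 -/

import Mathlib

open Set Filter Topology MeasureTheory
open scoped ComplexConjugate NNReal ENNReal

noncomputable section

namespace BlockOp

/-! ### Projection-valued measures and unbounded self-adjoint operators -/

section Hilbert

variable {H : Type*} [NormedAddCommGroup H] [InnerProductSpace ℂ H] [CompleteSpace H]

/-- A projection-valued measure on the Borel sets of `ℝ` (values on non-Borel sets are irrelevant):
orthogonal projections, total mass the identity, strongly countably additive. -/
structure ProjMeasure (H : Type*) [NormedAddCommGroup H] [InnerProductSpace ℂ H]
    [CompleteSpace H] where
  /-- The projection attached to a set. -/
  proj : Set ℝ → H →L[ℂ] H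
  isStarProjection : ∀ S, MeasurableSet S → IsStarProjection (proj S)
  proj_univ : proj univ = 1
  hasSum_iUnion : ∀ f : ℕ → Set ℝ, (∀ n, MeasurableSet (f n)) → Pairwise (Function.onFun Disjoint f) →
    ∀ x, HasSum (fun n => proj (f n) x) (proj (⋃ n, f n) x)

theorem ProjMeasure.norm_sq (E : ProjMeasure H) {S : Set ℝ} (hS : MeasurableSet S) (x : H) :
    ‖E.proj S x‖ ^ 2 = (inner ℂ x (E.proj S x)).re := by
  have h := E.isStarProjection S hS
  have h1 : E.proj S (E.proj S x) = E.proj S x := by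
    have := congrArg (fun T : H →L[ℂ] H => T x) h.isIdempotentElem.eq
    simpa using this
  have h2 : inner ℂ (E.proj S x) (E.proj S x) = inner ℂ x (E.proj S (E.proj S x)) := by
    have h3 : ContinuousLinearMap.adjoint (E.proj S) = E.proj S := h.isSelfAdjoint
    conv_lhs => rw [← ContinuousLinearMap.adjoint_inner_right, h3]
  rw [h1] at h2
  rw [← h2, inner_self_eq_norm_sq_to_K]
  norm_cast

/-- The scalar measure `S ↦ ⟨E(S)x, x⟩ = ‖E(S)x‖²`. -/
def ProjMeasure.measure (E : ProjMeasure H) (x : H) : Measure ℝ :=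
  Measure.ofMeasurable (fun S _ => ENNReal.ofReal (‖E.proj S x‖ ^ 2))
    (by
      have h := E.hasSum_iUnion (fun _ => ∅) (fun _ => MeasurableSet.empty)
        (fun _ _ _ => by simp [Function.onFun]) x
      have h0 : E.proj ∅ x = 0 := by
        have h2 := h.summable.tendsto_atTop_zero
        exact tendsto_nhds_unique tendsto_const_nhds h2
      simp [h0])
    (by
      intro f hf hd
      have h := (E.hasSum_iUnion f hf hd x).mapL (innerSL ℂ x)
      have h' := h.mapL Complex.reCLM
      simp only [innerSL_apply_apply, Complex.reCLM_apply] at h'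
      have e : (fun n => ‖E.proj (f n) x‖ ^ 2) = fun n => (inner ℂ x (E.proj (f n) x)).re := by
        funext n
        exact E.norm_sq (hf n) x
      rw [← E.norm_sq (MeasurableSet.iUnion hf) x, ← e] at h'
      rw [← h'.tsum_eq, ENNReal.ofReal_tsum_of_nonneg (fun n => by positivity) h'.summable])

/-- `E` is the spectral measure of the operator `A`, i.e. `A = ∫ t dE(t)`:
`Dom A = {x | ∫ t² d⟨E(t)x,x⟩ < ∞}` and `⟨x, A x⟩ = ∫ t d⟨E(t)x,x⟩` on `Dom A`. -/
def ProjMeasure.IsSpectralMeasureOf (E : ProjMeasure H) (A : H →ₗ.[ℂ] H) : Prop :=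
  (∀ x : H, x ∈ A.domain ↔ Integrable (fun t : ℝ => t ^ 2) (E.measure x)) ∧
  ∀ x : A.domain, inner ℂ (x : H) (A x) = ((∫ t, t ∂(E.measure (x : H)) : ℝ) : ℂ)

/-- The bounded operator `R` is a two-sided inverse of `A - z`. -/
def IsResolventAt (A : H →ₗ.[ℂ] H) (z : ℂ) (R : H →L[ℂ] H) : Prop :=
  (∀ x : H, ∃ h : R x ∈ A.domain, A ⟨R x, h⟩ - z • R x = x) ∧
  ∀ x : A.domain, R (A x - z • (x : H)) = x

/-- The spectrum of a possibly unbounded operator. -/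
def unboundedSpectrum (A : H →ₗ.[ℂ] H) : Set ℂ := {z | ¬ ∃ R, IsResolventAt A z R}

open Classical in
/-- The resolvent `(A - z)⁻¹` (zero if `z` lies in the spectrum). -/
def unboundedResolvent (A : H →ₗ.[ℂ] H) (z : ℂ) : H →L[ℂ] H :=
  if h : ∃ R, IsResolventAt A z R then h.choose else 0

/-- `z` is an eigenvalue of the possibly unbounded operator `A`. -/
def IsEigenvalue (A : H →ₗ.[ℂ] H) (z : ℂ) : Prop :=
  ∃ x : A.domain, x ≠ 0 ∧ A x = z • (x : H)

end Hilbert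

section Block

variable {H₀ H₁ : Type*} [NormedAddCommGroup H₀] [InnerProductSpace ℂ H₀] [CompleteSpace H₀]
  [NormedAddCommGroup H₁] [InnerProductSpace ℂ H₁] [CompleteSpace H₁]

/-- The block operator matrix `L = [A₀, B; -B*, A₁]` in the Hilbert space sum `H₀ ⊕ H₁`,
with `Dom L = Dom A₀ ⊕ H₁`. -/
def blockOperator (A₀ : H₀ →ₗ.[ℂ] H₀) (A₁ : H₁ →L[ℂ] H₁) (B : H₁ →L[ℂ] H₀) :
    WithLp 2 (H₀ × H₁) →ₗ.[ℂ] WithLp 2 (H₀ × H₁) where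
  domain := A₀.domain.comap (WithLp.fstₗ 2 ℂ H₀ H₁)
  toFun :=
    { toFun := fun x => WithLp.toLp 2
        (A₀ ⟨(x : WithLp 2 (H₀ × H₁)).fst, x.2⟩ + B (x : WithLp 2 (H₀ × H₁)).snd,
          -(ContinuousLinearMap.adjoint B (x : WithLp 2 (H₀ × H₁)).fst)
            + A₁ (x : WithLp 2 (H₀ × H₁)).snd)
      map_add' := by
        intro x y
        have h : A₀ ⟨((x + y : A₀.domain.comap (WithLp.fstₗ 2 ℂ H₀ H₁)) :
            WithLp 2 (H₀ × H₁)).fst, (x + y).2⟩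
            = A₀ ⟨(x : WithLp 2 (H₀ × H₁)).fst, x.2⟩
              + A₀ ⟨(y : WithLp 2 (H₀ × H₁)).fst, y.2⟩ := by
          rw [← LinearPMap.map_add]; rfl
        rw [h, ← WithLp.toLp_add]
        congr 1
        ext <;> simp <;> abel
      map_smul' := by
        intro c x
        have h : A₀ ⟨((c • x : A₀.domain.comap (WithLp.fstₗ 2 ℂ H₀ H₁)) :
            WithLp 2 (H₀ × H₁)).fst, (c • x).2⟩
            = c • A₀ ⟨(x : WithLp 2 (H₀ × H₁)).fst, x.2⟩ := by
          rw [← LinearPMap.map_smul]; rfl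
        rw [h, RingHom.id_apply, ← WithLp.toLp_smul]
        congr 1
        ext <;> simp }

/-- The (non-continued) Schur complement `M₁(z) = A₁ - z + B* (A₀ - z)⁻¹ B`. -/
def schurComplement (A₀ : H₀ →ₗ.[ℂ] H₀) (A₁ : H₁ →L[ℂ] H₁) (B : H₁ →L[ℂ] H₀) (z : ℂ) :
    H₁ →L[ℂ] H₁ :=
  A₁ - z • (1 : H₁ →L[ℂ] H₁)
    + (ContinuousLinearMap.adjoint B).comp ((unboundedResolvent A₀ z).comp B)

/-- `K_B(μ) = B* E((-∞, μ)) B`. -/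
def spectralFunctionB (E : ProjMeasure H₀) (B : H₁ →L[ℂ] H₀) (μ : ℝ) : H₁ →L[ℂ] H₁ :=
  (ContinuousLinearMap.adjoint B).comp ((E.proj (Iio μ)).comp B)

end Block

/-! ### Intervals, continuation domains, contours -/

/-- The open interval `(a, b) ⊆ ℝ` with extended real end points. -/
def interval (a b : EReal) : Set ℝ := {x : ℝ | a < (x : EReal) ∧ (x : EReal) < b}

/-- `x ↓ a` inside `ℝ`. -/
def lowerEnd (a : EReal) : Filter ℝ := comap (fun x : ℝ => (x : EReal)) (𝓝[>] a)

/-- `x ↑ b` inside `ℝ`. -/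
def upperEnd (b : EReal) : Filter ℝ := comap (fun x : ℝ => (x : EReal)) (𝓝[<] b)

/-- For `D = D⁻`: the domain `D^l`, that is `D` for `l = -1` and its mirror image for `l = 1`. -/
def sheet (D : Set ℂ) (l : ℤˣ) : Set ℂ := if l = 1 then {z | conj z ∈ D} else D

section Contours

variable {V : Type*} [NormedAddCommGroup V] [NormedSpace ℂ V]

/-- Behaviour of a deformation `h(s, t)`, `0 ≤ s ≤ 1`, when `t` tends (along the filter `F`) to the
end point `e` of the interval. A finite end point is kept fixed. At an infinite end point the
deformation goes to infinity, and stays in a region where `K` grows at most polynomially. -/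
def DeformationEnd (K : ℂ → V) (h : ℝ × ℝ → ℂ) (e : EReal) (F : Filter ℝ) : Prop :=
  (∀ r : ℝ, e = (r : EReal) → Tendsto h (𝓟 (Icc 0 1) ×ˢ F) (𝓝 (r : ℂ))) ∧
  ((e = ⊥ ∨ e = ⊤) →
    Tendsto (fun p => ‖h p‖) (𝓟 (Icc 0 1) ×ˢ F) atTop ∧
    ∃ (C : ℝ) (m : ℕ), ∀ᶠ p in 𝓟 (Icc (0 : ℝ) 1) ×ˢ F, ‖K (h p)‖ ≤ C * (1 + ‖h p‖) ^ m)

/-- The variation `∫_Γ |dμ| ‖K(μ)‖` along the contour `Γ = γ((a,b))`. -/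
def variation (K : ℂ → V) (a b : EReal) (γ : ℝ → ℂ) : ℝ :=
  ∫ t in interval a b, ‖K (γ t)‖ * ‖deriv γ t‖

/-- `γ` parametrizes, over the interval `(a, b)`, an admissible contour in the domain `D'`: a
rectifiable Jordan arc (a rectifiable arc with finite end points fixed can always be given a
Lipschitz parametrization over the interval itself) which arises from `(a, b)` by a continuous
deformation in `D'`, and along which the variation of `K` is finite. -/
structure IsAdmissibleContour (K : ℂ → V) (a b : EReal) (D' : Set ℂ) (γ : ℝ → ℂ) : Prop where
  lipschitz : ∃ C : ℝ≥0, LipschitzOnWith C γ (interval a b)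
  injOn : InjOn γ (interval a b)
  deformation : ∃ h : ℝ × ℝ → ℂ, ContinuousOn h (Icc 0 1 ×ˢ interval a b) ∧
    (∀ t ∈ interval a b, h (0, t) = (t : ℂ)) ∧
    (∀ t ∈ interval a b, h (1, t) = γ t) ∧
    (∀ s ∈ Ioc (0 : ℝ) 1, ∀ t ∈ interval a b, h (s, t) ∈ D') ∧
    DeformationEnd K h a (lowerEnd a) ∧ DeformationEnd K h b (upperEnd b)
  finite_variation : IntegrableOn (fun t => ‖K (γ t)‖ * ‖deriv γ t‖) (interval a b)

/-- `d(Γ) = dist(σ, Γ)`. -/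
def contourDist (a b : EReal) (γ : ℝ → ℂ) (σ : Set ℂ) : ℝ :=
  ⨅ t : interval a b, Metric.infDist (γ t) σ

/-- `r_min(Γ) = d(Γ)/2 - √(d(Γ)²/4 - V₀(Γ))`. -/
def rMin (K : ℂ → V) (a b : EReal) (σ : Set ℂ) (γ : ℝ → ℂ) : ℝ :=
  contourDist a b γ σ / 2 - √(contourDist a b γ σ ^ 2 / 4 - variation K a b γ)

/-- `r_max(Γ) = d(Γ) - √V₀(Γ)`. -/
def rMax (K : ℂ → V) (a b : EReal) (σ : Set ℂ) (γ : ℝ → ℂ) : ℝ :=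
  contourDist a b γ σ - √(variation K a b γ)

/-- `r₀`: the infimum of `r_min(Γ)` over the admissible contours `Γ` in `D'` with
`d(Γ)² - 4 V₀(Γ) > 0`. -/
def rZero (K : ℂ → V) (a b : EReal) (D' : Set ℂ) (σ : Set ℂ) : ℝ :=
  sInf {r | ∃ γ, IsAdmissibleContour K a b D' γ ∧
    0 < contourDist a b γ σ ^ 2 - 4 * variation K a b γ ∧ r = rMin K a b σ γ}

end Contours

/-- The transformator `W₁(Z, Γ) = - ∫_Γ dμ K(μ) (Z - μ)⁻¹`. -/
def transformator {H₁ : Type*} [NormedAddCommGroup H₁] [InnerProductSpace ℂ H₁]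
    (K : ℂ → H₁ →L[ℂ] H₁) (a b : EReal) (γ : ℝ → ℂ) (Z : H₁ →L[ℂ] H₁) : H₁ →L[ℂ] H₁ :=
  -∫ t in interval a b, deriv γ t • (K (γ t) * Ring.inverse (Z - γ t • (1 : H₁ →L[ℂ] H₁)))

/-- The standing assumptions: `A₀` is self-adjoint with spectral measure `E`, its spectrum is
absolutely continuous and equal to the closure of `Δ₀ = (a, b)`; `A₁` is self-adjoint (and bounded)
with spectrum in `Δ₀`; `D = D⁻` is a simply connected domain in the lower half-plane having `Δ₀` in
its boundary; `K_B` is differentiable on `Δ₀` in operator norm, and `K` is the analytic continuation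
of its derivative from `Δ₀` to `D⁻` and `D⁺`, with an integrable power bound near finite end
points. -/
structure Setting {H₀ H₁ : Type*}
    [NormedAddCommGroup H₀] [InnerProductSpace ℂ H₀] [CompleteSpace H₀]
    [NormedAddCommGroup H₁] [InnerProductSpace ℂ H₁] [CompleteSpace H₁]
    (A₀ : H₀ →ₗ.[ℂ] H₀) (A₁ : H₁ →L[ℂ] H₁) (B : H₁ →L[ℂ] H₀) (E : ProjMeasure H₀)
    (a b : EReal) (D : Set ℂ) (K : ℂ → H₁ →L[ℂ] H₁) : Prop where
  selfAdjoint₀ : IsSelfAdjoint A₀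
  spectralMeasure : E.IsSpectralMeasureOf A₀
  selfAdjoint₁ : IsSelfAdjoint A₁
  lt : a < b
  absolutelyContinuous : ∀ x, E.measure x ≪ volume
  spectrum₀ : unboundedSpectrum A₀ = (fun x : ℝ => (x : ℂ)) '' closure (interval a b)
  spectrum₁ : spectrum ℂ A₁ ⊆ (fun x : ℝ => (x : ℂ)) '' interval a b
  isOpen : IsOpen D
  simplyConnected : IsSimplyConnected D
  lowerHalfPlane : ∀ z ∈ D, z.im < 0
  boundary : (fun x : ℝ => (x : ℂ)) '' interval a b ⊆ frontier D
  hasDerivAt : ∀ μ ∈ interval a b, HasDerivAt (spectralFunctionB E B) (K (μ : ℂ)) μ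
  analytic : AnalyticOnNhd ℂ K
    (sheet D (-1) ∪ (fun x : ℝ => (x : ℂ)) '' interval a b ∪ sheet D 1)
  endBound : ∀ r : ℝ, (a = (r : EReal) ∨ b = (r : EReal)) → ∃ C > 0, ∃ p : ℝ, -1 < p ∧ p ≤ 0 ∧
    ∃ ε > 0, ∀ l : ℤˣ, ∀ μ ∈ sheet D l, ‖μ - (r : ℂ)‖ < ε → ‖K μ‖ ≤ C * ‖μ - (r : ℂ)‖ ^ p

end BlockOp

end

namespace BlockOp

/-! ### Crossing a rectangle inside a level set -/

/-! Write V for the variation of `K` along Γ, d for the distance from σ(A₁) to Γ, W for the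
transformator and C(z) for the Cauchy transform of `K` along Γ.

Existence and uniqueness are a contraction argument. Since A₁ is self-adjoint, A₁ + X - μ has an
inverse of norm at most 1/(d - ‖X‖) for μ on Γ. Hence X ↦ W(A₁ + X) maps the ball of radius r_min,
the smaller root of r(d - r) = V, into itself with Lipschitz constant r/(d - r) < 1. The same
estimate separates solutions up to r_max (`exists_fixedPoint`, `eq_of_fixedPoint`).

If Zu = zu for Z = A₁ + X, then (Z - μ)⁻¹u = (z - μ)⁻¹u, so Xu = C(z)u
(`transformator_apply_eigenvector`). If z lies in the half plane opposite to Γ, the contour can be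
deformed to Δ₀ without meeting the pole. There C(z) is the Cauchy integral of the density of B*EB,
that is B*(A₀ - z)⁻¹B (`adjoint_comp_resolvent_comp`). So M₁(z)u = 0, and (-(A₀ - z)⁻¹Bu, u) is an
eigenvector of L.

It remains to see that σ(Z) lies in the open half plane opposite to Γ. Let X_s solve X = s W(A₁ + X)
for 0 ≤ s ≤ 1; it is Lipschitz in s and X_0 = 0 gives real spectrum. For a unit eigenvector u of A₁
+ X_s one has Im z = s Im ⟨u, C(z)u⟩. Approaching the real axis from the side opposite to Γ, the
Poisson kernel shows that l Im ⟨u, C(x)u⟩ < 0 wherever the density is positive. By compactness this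
persists in a strip (`exists_strip`), so no eigenvalue can lie in the part of the strip with l Im z
≥ 0, and the spectrum never gets across (`spectrum_im_neg_of_path`).

Positivity is given only within r₀ of σ(A₁), whereas this argument needs it within r_min of the
contour. By compactness it holds slightly beyond r₀, hence within r_min of some other contour γ'
(`exists_contour`). The solution for γ' has spectrum in the opposite half plane, so its
transformator takes the same value on γ', on Δ₀ and on Γ (`transformator_eq`). It therefore solves
the original equation too.

The analytic labour is deforming Γ to Δ₀ through a merely continuous h(s, t). Primitives of the
integrand are pulled back along h to parameter rectangles. Near an end, a circle |w - r| = ρ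
separates two vertical lines of the rectangle, and Poincaré–Miranda gives a connected piece of its
preimage joining s = 0 to s = 1. Its image lies on a half circle, along which the primitive varies
by at most πρ sup|G|. This tends to zero at a finite end because p > -1, and at infinity after
multiplication by a convergence factor that is removed at the end. -/

theorem abs_sub_lt_pi_of_cos_pos {θ : ℝ → ℝ} {x y φ : ℝ} (hxy : x ≤ y)
    (hθ : ContinuousOn θ (Icc x y)) (hc : ∀ t ∈ Icc x y, 0 < Real.cos (θ t + φ)) :
    |θ y - θ x| < Real.pi := by
  have hx := hc x (left_mem_Icc.2 hxy)
  rw [abs_lt]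
  constructor
  · by_contra! h
    obtain ⟨t, ht, e⟩ := intermediate_value_Icc' hxy hθ
      (show θ x - Real.pi ∈ Icc (θ y) (θ x) from ⟨by linarith, by linarith [Real.pi_pos]⟩)
    have := hc t ht
    rw [e, show θ x - Real.pi + φ = (θ x + φ) - Real.pi by ring, Real.cos_sub_pi] at this
    linarith
  · by_contra! h
    obtain ⟨t, ht, e⟩ := intermediate_value_Icc hxy hθ
      (show θ x + Real.pi ∈ Icc (θ x) (θ y) from ⟨by linarith [Real.pi_pos], by linarith⟩)
    have := hc t ht
    rw [e, show θ x + Real.pi + φ = (θ x + φ) + Real.pi by ring, Real.cos_add_pi] at this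
    linarith

theorem pos_of_abs_lt_pi_of_sin_pos {x : ℝ} (hx : |x| < Real.pi) (hs : 0 < Real.sin x) : 0 < x := by
  by_contra! h
  have := Real.sin_nonpos_of_nonpos_of_neg_pi_le h (abs_lt.1 hx).1.le
  linarith

/-- Two dimensional Poincaré–Miranda theorem. -/
theorem exists_zero_of_rectangle {t₁ t₂ : ℝ} (ht : t₁ ≤ t₂) {u v : ℝ × ℝ → ℝ}
    (hu : ContinuousOn u (Icc 0 1 ×ˢ Icc t₁ t₂)) (hv : ContinuousOn v (Icc 0 1 ×ˢ Icc t₁ t₂))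
    (hl : ∀ s ∈ Icc (0 : ℝ) 1, u (s, t₁) < 0) (hr : ∀ s ∈ Icc (0 : ℝ) 1, 0 < u (s, t₂))
    (hb : ∀ t ∈ Icc t₁ t₂, v (0, t) < 0) (htop : ∀ t ∈ Icc t₁ t₂, 0 < v (1, t)) :
    ∃ p ∈ Icc (0 : ℝ) 1 ×ˢ Icc t₁ t₂, u p = 0 ∧ v p = 0 := by
  by_contra! hne
  -- Composing with the retraction onto the rectangle makes the zero-free map continuous on the
  -- whole plane, where a logarithm exists.
  let ret : ℝ × ℝ → ℝ × ℝ := fun p => (projIcc 0 1 zero_le_one p.1, projIcc t₁ t₂ ht p.2)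
  have hret : Continuous ret := by fun_prop
  have hretm : ∀ p, ret p ∈ Icc (0 : ℝ) 1 ×ˢ Icc t₁ t₂ := fun p =>
    ⟨(projIcc 0 1 zero_le_one p.1).2, (projIcc t₁ t₂ ht p.2).2⟩
  have hrete : ∀ p ∈ Icc (0 : ℝ) 1 ×ˢ Icc t₁ t₂, ret p = p := by
    rintro ⟨p, q⟩ ⟨h1, h2⟩
    simp only [ret]
    rw [projIcc_of_mem _ h1, projIcc_of_mem _ h2]
  let g : ℝ × ℝ → ℂ := fun p => (u (ret p) : ℂ) + (v (ret p) : ℂ) * Complex.I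
  have hu' : Continuous fun p => u (ret p) := hu.comp_continuous hret hretm
  have hv' : Continuous fun p => v (ret p) := hv.comp_continuous hret hretm
  have hg : Continuous g := (Complex.continuous_ofReal.comp hu').add
    ((Complex.continuous_ofReal.comp hv').mul continuous_const)
  have hg0 : (0 : ℂ) ∉ g '' univ := by
    rintro ⟨p, -, hp⟩
    have h1 := congrArg Complex.re hp
    have h2 := congrArg Complex.im hp
    simp [g] at h1 h2
    exact hne _ (hretm p) h1 h2
  -- With no common zero, u + iv has a continuous logarithm; its imaginary part θ is a single-valued
  -- argument.
  obtain ⟨F, hF, hFe⟩ := Complex.exists_continuousOn_eqOn_exp_comp (X := ℝ × ℝ) (U := univ)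
    (by
      have : ContractibleSpace (univ : Set (ℝ × ℝ)) :=
        (convex_univ (𝕜 := ℝ) (E := ℝ × ℝ)).contractibleSpace univ_nonempty
      exact SimplyConnectedSpace.ofContractible _) isOpen_univ hg.continuousOn hg0
  rw [continuousOn_univ] at hF
  let θ : ℝ × ℝ → ℝ := fun p => (F p).im
  have hθ : Continuous θ := Complex.continuous_im.comp hF
  have hre : ∀ p ∈ Icc (0 : ℝ) 1 ×ˢ Icc t₁ t₂, u p = Real.exp (F p).re * Real.cos (θ p) := by
    intro p hp
    have := congrArg Complex.re (hFe (mem_univ p))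
    simp only [Function.comp_apply, Complex.exp_re, g, hrete p hp] at this
    simpa using this.symm
  have him : ∀ p ∈ Icc (0 : ℝ) 1 ×ˢ Icc t₁ t₂, v p = Real.exp (F p).re * Real.sin (θ p) := by
    intro p hp
    have := congrArg Complex.im (hFe (mem_univ p))
    simp only [Function.comp_apply, Complex.exp_im, g, hrete p hp] at this
    simpa using this.symm
  have cr : ∀ s ∈ Icc (0 : ℝ) 1, 0 < Real.cos (θ (s, t₂)) := fun s hs => by
    have := hr s hs
    rw [hre _ ⟨hs, right_mem_Icc.2 ht⟩] at this
    exact pos_of_mul_pos_right this (Real.exp_pos _).le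
  have cl : ∀ s ∈ Icc (0 : ℝ) 1, Real.cos (θ (s, t₁)) < 0 := fun s hs => by
    have := hl s hs
    rw [hre _ ⟨hs, left_mem_Icc.2 ht⟩] at this
    exact neg_of_mul_neg_right this (Real.exp_pos _).le
  have cb : ∀ t ∈ Icc t₁ t₂, Real.sin (θ (0, t)) < 0 := fun s hs => by
    have := hb s hs
    rw [him _ ⟨by simp, hs⟩] at this
    exact neg_of_mul_neg_right this (Real.exp_pos _).le
  have ct : ∀ t ∈ Icc t₁ t₂, 0 < Real.sin (θ (1, t)) := fun s hs => by
    have := htop s hs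
    rw [him _ ⟨by simp, hs⟩] at this
    exact pos_of_mul_pos_right this (Real.exp_pos _).le
  have h0 : (0 : ℝ) ∈ Icc (0 : ℝ) 1 := by simp
  have h1 : (1 : ℝ) ∈ Icc (0 : ℝ) 1 := by simp
  have e1 := left_mem_Icc.2 ht
  have e2 := right_mem_Icc.2 ht
  -- On each edge u + iv stays in an open half plane, so θ changes by less than π there. The signs
  -- at the corners then make all four increments around the boundary positive, although they sum to
  -- zero.
  have dR : |θ (1, t₂) - θ (0, t₂)| < Real.pi :=
    abs_sub_lt_pi_of_cos_pos (θ := fun s => θ (s, t₂)) (φ := 0) zero_le_one (by fun_prop)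
      (fun s hs => by simpa using cr s hs)
  have dL : |θ (1, t₁) - θ (0, t₁)| < Real.pi :=
    abs_sub_lt_pi_of_cos_pos (θ := fun s => θ (s, t₁)) (φ := Real.pi) zero_le_one (by fun_prop)
      (fun s hs => by simpa [Real.cos_add_pi] using cl s hs)
  have dT : |θ (1, t₂) - θ (1, t₁)| < Real.pi :=
    abs_sub_lt_pi_of_cos_pos (θ := fun s => θ (1, s)) (φ := -(Real.pi / 2)) ht (by fun_prop)
      (fun s hs => by simpa [← sub_eq_add_neg, Real.cos_sub_pi_div_two] using ct s hs)
  have dB : |θ (0, t₂) - θ (0, t₁)| < Real.pi :=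
    abs_sub_lt_pi_of_cos_pos (θ := fun s => θ (0, s)) (φ := Real.pi / 2) ht (by fun_prop)
      (fun s hs => by simpa [Real.cos_add_pi_div_two] using cb s hs)
  have pR : 0 < θ (1, t₂) - θ (0, t₂) := by
    refine pos_of_abs_lt_pi_of_sin_pos dR ?_
    rw [Real.sin_sub]
    nlinarith [mul_pos (ct t₂ e2) (cr 0 h0), mul_pos (cr 1 h1) (neg_pos.2 (cb t₂ e2))]
  have pT : 0 < θ (1, t₁) - θ (1, t₂) := by
    refine pos_of_abs_lt_pi_of_sin_pos (by rwa [abs_sub_comm]) ?_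
    rw [Real.sin_sub]
    nlinarith [mul_pos (ct t₁ e1) (cr 1 h1), mul_pos (neg_pos.2 (cl 1 h1)) (ct t₂ e2)]
  have pL : 0 < θ (0, t₁) - θ (1, t₁) := by
    refine pos_of_abs_lt_pi_of_sin_pos (by rwa [abs_sub_comm]) ?_
    rw [Real.sin_sub]
    nlinarith [mul_pos (neg_pos.2 (cb t₁ e1)) (neg_pos.2 (cl 1 h1)),
      mul_pos (neg_pos.2 (cl 0 h0)) (ct t₁ e1)]
  have pB : 0 < θ (0, t₂) - θ (0, t₁) := by
    refine pos_of_abs_lt_pi_of_sin_pos dB ?_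
    rw [Real.sin_sub]
    nlinarith [mul_pos (neg_pos.2 (cb t₂ e2)) (neg_pos.2 (cl 0 h0)),
      mul_pos (cr 0 h0) (neg_pos.2 (cb t₁ e1))]
  linarith

/-- In a compact Hausdorff space a component is the intersection of the clopen sets containing its
point. Compactness of `B` and then of `A` reduces the separation to finitely many clopen sets. -/
theorem exists_isClopen_of_connectedComponent_disjoint {X : Type*} [TopologicalSpace X]
    [CompactSpace X] [T2Space X] {A B : Set X} (hA : IsClosed A) (hB : IsClosed B)
    (h : ∀ x ∈ A, ∀ y ∈ B, y ∉ connectedComponent x) :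
    ∃ Z : Set X, IsClopen Z ∧ A ⊆ Z ∧ Disjoint Z B := by
  have key : ∀ x ∈ A, ∃ Z : Set X, IsClopen Z ∧ x ∈ Z ∧ Disjoint Z B := by
    intro x hx
    have hcov : B ⊆ ⋃ Z : {Z : Set X // IsClopen Z ∧ x ∈ Z}, (Z.1)ᶜ := by
      intro y hy
      have := h x hx y hy
      rw [connectedComponent_eq_iInter_isClopen] at this
      simpa [and_assoc] using this
    obtain ⟨s, hs⟩ := hB.isCompact.elim_finite_subcover _
      (fun Z : {Z : Set X // IsClopen Z ∧ x ∈ Z} => Z.2.1.compl.isOpen) hcov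
    refine ⟨⋂ Z ∈ s, Z.1, isClopen_biInter_finset fun Z _ => Z.2.1, ?_, ?_⟩
    · simp only [mem_iInter]
      exact fun Z _ => Z.2.2
    · rw [Set.disjoint_right]
      intro y hy hy'
      obtain ⟨Z, hZ, hyZ⟩ := mem_iUnion₂.1 (hs hy)
      exact hyZ (mem_iInter₂.1 hy' Z hZ)
  choose! Z hZ hxZ hd using key
  obtain ⟨s, hs⟩ := hA.isCompact.elim_nhds_subcover' (fun x _ => Z x)
    (fun x hx => (hZ x hx).isOpen.mem_nhds (hxZ x hx))
  refine ⟨⋃ x ∈ s, Z x, isClopen_biUnion_finset fun x _ => hZ x x.2, hs, ?_⟩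
  simp only [Set.disjoint_iUnion_left]
  exact fun x _ => hd x x.2

/-- A level set which separates the left edge of a rectangle from its right edge contains a
connected set joining the bottom edge to the top edge. -/
theorem exists_isPreconnected_level {t₁ t₂ ρ : ℝ} (ht : t₁ ≤ t₂) {u : ℝ × ℝ → ℝ}
    (hu : ContinuousOn u (Icc 0 1 ×ˢ Icc t₁ t₂))
    (hl : ∀ s ∈ Icc (0 : ℝ) 1, u (s, t₁) < ρ) (hr : ∀ s ∈ Icc (0 : ℝ) 1, ρ < u (s, t₂)) :
    ∃ C ⊆ Icc (0 : ℝ) 1 ×ˢ Icc t₁ t₂, IsPreconnected C ∧ IsCompact C ∧ (∀ p ∈ C, u p = ρ) ∧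
      (∃ τ, ((0 : ℝ), τ) ∈ C) ∧ ∃ τ, ((1 : ℝ), τ) ∈ C := by
  set Q : Set (ℝ × ℝ) := Icc (0 : ℝ) 1 ×ˢ Icc t₁ t₂ with hQ
  have hQc : IsCompact Q := isCompact_Icc.prod isCompact_Icc
  set L : Set (ℝ × ℝ) := Q ∩ u ⁻¹' {ρ} with hLdef
  have hL : IsClosed L := hu.preimage_isClosed_of_isClosed hQc.isClosed isClosed_singleton
  have hLc : IsCompact L := hQc.of_isClosed_subset hL inter_subset_left
  have : CompactSpace L := isCompact_iff_compactSpace.1 hLc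
  by_contra! hno
  let A : Set L := {x | x.1.1 = 0}
  let B : Set L := {x | x.1.1 = 1}
  have hfst : Continuous fun x : L => x.1.1 := continuous_fst.comp continuous_subtype_val
  obtain ⟨Z, hZ, hAZ, hZB⟩ := exists_isClopen_of_connectedComponent_disjoint
    (A := A) (B := B) (isClosed_eq hfst continuous_const) (isClosed_eq hfst continuous_const) (by
      rintro ⟨⟨x₁, x₂⟩, hx⟩ (rfl : x₁ = 0) ⟨⟨y₁, y₂⟩, hy⟩ (rfl : y₁ = 1) hxy
      refine hno (Subtype.val '' connectedComponent (⟨(0, x₂), hx⟩ : L)) ?_ ?_ ?_ ?_ ⟨x₂, ?_⟩ y₂ ?_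
      · rintro _ ⟨p, -, rfl⟩
        exact p.2.1
      · exact isPreconnected_connectedComponent.image _ continuous_subtype_val.continuousOn
      · exact isClosed_connectedComponent.isCompact.image continuous_subtype_val
      · rintro _ ⟨p, -, rfl⟩
        exact p.2.2
      · exact ⟨_, mem_connectedComponent, rfl⟩
      · exact ⟨_, hxy, rfl⟩)
  -- The two halves of the level set, enlarged by the edges s = 0 and s = 1, are disjoint closed
  -- sets. A Urysohn function f for them equals 0 or 1 on the level set, so u - ρ and f - 1/2 would
  -- contradict Poincaré–Miranda.
  let F0 : Set (ℝ × ℝ) := Subtype.val '' Z ∪ (fun p : ℝ × ℝ => p.1) ⁻¹' {0}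
  let F1 : Set (ℝ × ℝ) := Subtype.val '' Zᶜ ∪ (fun p : ℝ × ℝ => p.1) ⁻¹' {1}
  have hF0 : IsClosed F0 := (hL.isClosedMap_subtype_val _ hZ.isClosed).union
    (isClosed_singleton.preimage continuous_fst)
  have hF1 : IsClosed F1 := (hL.isClosedMap_subtype_val _ hZ.compl.isClosed).union
    (isClosed_singleton.preimage continuous_fst)
  have hdis : Disjoint F0 F1 := by
    rw [Set.disjoint_left]
    rintro p (⟨x, hx, rfl⟩ | hp) (⟨y, hy, hxy⟩ | hq)
    · exact hy (Subtype.ext hxy ▸ hx)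
    · exact Set.disjoint_left.1 hZB hx hq
    · subst hxy
      exact hy (hAZ hp)
    · simp only [mem_preimage, mem_singleton_iff] at hp hq
      linarith
  obtain ⟨f, hf0, hf1, -⟩ := exists_continuous_zero_one_of_isClosed hF0 hF1 hdis
  obtain ⟨p, hp, hp0, hp1⟩ := exists_zero_of_rectangle ht (u := fun p => u p - ρ)
    (v := fun p => f p - 1 / 2) (hu.sub continuousOn_const) (by fun_prop)
    (fun s hs => by linarith [hl s hs]) (fun s hs => by linarith [hr s hs])
    (fun t _ => by rw [hf0 (show ((0 : ℝ), t) ∈ F0 from Or.inr rfl)]; norm_num)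
    (fun t _ => by rw [hf1 (show ((1 : ℝ), t) ∈ F1 from Or.inr rfl)]; norm_num)
  have hpL : p ∈ L := ⟨hp, by simpa [sub_eq_zero] using hp0⟩
  by_cases hpZ : (⟨p, hpL⟩ : L) ∈ Z
  · have := hf0 (show p ∈ F0 from Or.inl ⟨_, hpZ, rfl⟩)
    rw [this] at hp1
    norm_num at hp1
  · have := hf1 (show p ∈ F1 from Or.inl ⟨_, hpZ, rfl⟩)
    rw [this] at hp1
    norm_num at hp1

/-! ### Primitives along a continuous map -/

/-- `Φ` is, locally on `S`, the composition of `h` with a primitive of `G`. -/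
def IsPullbackPrimitive {X : Type*} [TopologicalSpace X] (G : ℂ → ℂ) (h : X → ℂ) (S : Set X)
    (Φ : X → ℂ) : Prop :=
  ∀ x ∈ S, ∃ P : ℂ → ℂ, (∀ᶠ w in 𝓝 (h x), HasDerivAt P (G w) w) ∧
    ∀ᶠ y in 𝓝[S] x, Φ y = P (h y)

theorem eventually_eq_of_hasDerivAt {G P Q : ℂ → ℂ} {w₀ : ℂ}
    (hP : ∀ᶠ w in 𝓝 w₀, HasDerivAt P (G w) w) (hQ : ∀ᶠ w in 𝓝 w₀, HasDerivAt Q (G w) w) :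
    ∀ᶠ w in 𝓝 w₀, P w - Q w = P w₀ - Q w₀ := by
  obtain ⟨r, hr, h⟩ := Metric.eventually_nhds_iff_ball.1 (hP.and hQ)
  filter_upwards [Metric.ball_mem_nhds w₀ hr] with w hw
  refine Metric.isOpen_ball.is_const_of_deriv_eq_zero (f := fun w => P w - Q w)
    (convex_ball w₀ r).isPreconnected ?_ ?_ hw (Metric.mem_ball_self hr)
  · exact fun z hz => ((h z hz).1.sub (h z hz).2).differentiableAt.differentiableWithinAt
  · intro z hz
    exact ((h z hz).1.sub (h z hz).2).deriv.trans (sub_self _)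

section

variable {X : Type*} [TopologicalSpace X] {G : ℂ → ℂ} {h : X → ℂ} {S T : Set X} {Φ Ψ : X → ℂ}

theorem IsPullbackPrimitive.mono (hΦ : IsPullbackPrimitive G h S Φ) (hTS : T ⊆ S) :
    IsPullbackPrimitive G h T Φ := fun x hx => by
  obtain ⟨P, h1, h2⟩ := hΦ x (hTS hx)
  exact ⟨P, h1, h2.filter_mono (nhdsWithin_mono _ hTS)⟩

/-- Primitives of `G` on a disc differ by a constant, so the difference is locally constant on `S`.
-/
theorem IsPullbackPrimitive.sub_eq (hΦ : IsPullbackPrimitive G h S Φ)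
    (hΨ : IsPullbackPrimitive G h S Ψ) (hh : ContinuousOn h S) (hS : IsPreconnected S)
    {x y : X} (hx : x ∈ S) (hy : y ∈ S) : Φ x - Ψ x = Φ y - Ψ y := by
  have : PreconnectedSpace S := isPreconnected_iff_preconnectedSpace.1 hS
  let f : S → ℂ := fun z => Φ z - Ψ z
  have hf : IsLocallyConstant f := by
    rw [IsLocallyConstant.iff_eventually_eq]
    rintro ⟨z, hz⟩
    obtain ⟨P, hP, hP'⟩ := hΦ z hz
    obtain ⟨Q, hQ, hQ'⟩ := hΨ z hz
    have h1 := (hh z hz).eventually (eventually_eq_of_hasDerivAt hP hQ)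
    have h2 : ∀ᶠ y in 𝓝[S] z, Φ y - Ψ y = Φ z - Ψ z := by
      filter_upwards [h1, hP', hQ'] with y e1 e2 e3
      rw [hP'.self_of_nhdsWithin hz, hQ'.self_of_nhdsWithin hz, e2, e3, e1]
    rw [nhds_subtype_eq_comap_nhdsWithin]
    exact h2.comap _
  exact hf.apply_eq_of_preconnectedSpace ⟨x, hx⟩ ⟨y, hy⟩

/-- On the connected overlap the two functions differ by one constant, which is added on `T`.
Closedness makes a piece invisible near points outside it. -/
theorem IsPullbackPrimitive.glue (hΦ : IsPullbackPrimitive G h S Φ)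
    (hΨ : IsPullbackPrimitive G h T Ψ) (hh : ContinuousOn h (S ∪ T)) (hS : IsClosed S)
    (hT : IsClosed T) (hc : IsPreconnected (S ∩ T)) (hne : (S ∩ T).Nonempty) :
    ∃ Ξ, IsPullbackPrimitive G h (S ∪ T) Ξ := by
  classical
  obtain ⟨x₀, hx₀⟩ := hne
  set c := Φ x₀ - Ψ x₀ with hcdef
  have hdiff : ∀ x ∈ S ∩ T, Φ x = Ψ x + c := fun x hx => by
    have := (hΦ.mono inter_subset_left).sub_eq (hΨ.mono inter_subset_right)
      (hh.mono (inter_subset_left.trans subset_union_left)) hc hx hx₀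
    rw [hcdef, ← this]
    ring
  let Ξ : X → ℂ := fun x => if x ∈ S then Φ x else Ψ x + c
  have eS : ∀ x ∈ S, Ξ x = Φ x := fun x hx => if_pos hx
  have eT : ∀ x ∈ T, Ξ x = Ψ x + c := fun x hx => by
    by_cases hxS : x ∈ S
    · rw [eS x hxS, hdiff x ⟨hxS, hx⟩]
    · exact if_neg hxS
  refine ⟨Ξ, fun x hx => ?_⟩
  by_cases hxS : x ∈ S
  · obtain ⟨P, hP, hP'⟩ := hΦ x hxS
    refine ⟨P, hP, ?_⟩
    rw [nhdsWithin_union, eventually_sup]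
    refine ⟨by filter_upwards [hP', self_mem_nhdsWithin] with y hy hyS; rw [eS y hyS, hy], ?_⟩
    by_cases hxT : x ∈ T
    · obtain ⟨Q, hQ, hQ'⟩ := hΨ x hxT
      have h1 := ((hh x hx).mono subset_union_right).eventually
        (eventually_eq_of_hasDerivAt hP hQ)
      filter_upwards [hQ', self_mem_nhdsWithin, h1] with y hy hyT hy1
      rw [eT y hyT, hy]
      have e1 := hP'.self_of_nhdsWithin hxS
      have e2 := hQ'.self_of_nhdsWithin hxT
      have e3 := hdiff x ⟨hxS, hxT⟩
      rw [e1, e2] at e3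
      rw [e3] at hy1
      linear_combination -hy1
    · have : 𝓝[T] x = ⊥ := by
        rw [← notMem_closure_iff_nhdsWithin_eq_bot, hT.closure_eq]
        exact hxT
      rw [this]
      exact eventually_bot
  · have hxT : x ∈ T := hx.resolve_left hxS
    obtain ⟨Q, hQ, hQ'⟩ := hΨ x hxT
    refine ⟨fun w => Q w + c, hQ.mono fun w hw => hw.add_const c, ?_⟩
    rw [nhdsWithin_union, eventually_sup]
    constructor
    · have : 𝓝[S] x = ⊥ := by
        rw [← notMem_closure_iff_nhdsWithin_eq_bot, hS.closure_eq]
        exact hxS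
      rw [this]
      exact eventually_bot
    · filter_upwards [hQ', self_mem_nhdsWithin] with y hy hyT
      rw [eT y hyT, hy]

theorem exists_hasDerivAt_ball {w : ℂ} (hG : AnalyticAt ℂ G w) :
    ∃ r > 0, ∃ P : ℂ → ℂ, ∀ z ∈ Metric.ball w r, HasDerivAt P (G z) z := by
  obtain ⟨r, hr, hd⟩ := Metric.eventually_nhds_iff_ball.1 hG.eventually_analyticAt
  have hd' : DifferentiableOn ℂ G (Metric.ball w r) := fun z hz =>
    (hd z hz).differentiableAt.differentiableWithinAt
  obtain ⟨P, hP⟩ := hd'.isExactOn_ball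
  exact ⟨r, hr, P, hP⟩

end

/-- By the Lebesgue number lemma small cells are mapped into discs on which `G` has a primitive.
Cells are glued into rows and rows into the rectangle, always along a connected edge. Only the
parameter rectangle has to be free of holes; the image of `h` may overlap itself. -/
theorem exists_isPullbackPrimitive_rectangle {G : ℂ → ℂ} {h : ℝ × ℝ → ℂ} {s₁ s₂ t₁ t₂ : ℝ}
    (hs : s₁ ≤ s₂) (ht : t₁ ≤ t₂) (hh : ContinuousOn h (Icc s₁ s₂ ×ˢ Icc t₁ t₂))
    (hG : ∀ p ∈ Icc s₁ s₂ ×ˢ Icc t₁ t₂, AnalyticAt ℂ G (h p)) :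
    ∃ Φ, IsPullbackPrimitive G h (Icc s₁ s₂ ×ˢ Icc t₁ t₂) Φ := by
  set Q : Set (ℝ × ℝ) := Icc s₁ s₂ ×ˢ Icc t₁ t₂ with hQ
  have hQc : IsCompact Q := isCompact_Icc.prod isCompact_Icc
  -- a mesh size for which every cell is mapped into a disc with a primitive
  obtain ⟨δ, hδ, hcell⟩ : ∃ δ > 0, ∀ p ∈ Q, ∀ S ⊆ Q, S ⊆ Metric.closedBall p δ →
      ∃ Φ, IsPullbackPrimitive G h S Φ := by
    have loc : ∀ p ∈ Q, ∃ V : Set (ℝ × ℝ), V ∈ 𝓝 p ∧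
        ∃ P : ℂ → ℂ, ∀ q ∈ V ∩ Q, ∀ᶠ w in 𝓝 (h q), HasDerivAt P (G w) w := by
      intro p hp
      obtain ⟨r, hr, P, hP⟩ := exists_hasDerivAt_ball (hG p hp)
      have hn : ∀ᶠ q in 𝓝[Q] p, h q ∈ Metric.ball (h p) r :=
        (hh p hp).eventually (Metric.ball_mem_nhds _ hr)
      obtain ⟨V, hV, hV'⟩ := mem_nhdsWithin_iff_exists_mem_nhds_inter.1 hn
      refine ⟨V, hV, P, fun q hq => ?_⟩
      filter_upwards [Metric.isOpen_ball.mem_nhds (hV' hq)] with w hw using hP w hw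
    choose! V hV P hP using loc
    obtain ⟨δ, hδ, hL⟩ := lebesgue_number_lemma_of_metric (c := fun i : Q => interior (V i)) hQc
      (fun _ => isOpen_interior)
      (fun p hp => mem_iUnion.2 ⟨⟨p, hp⟩, mem_interior_iff_mem_nhds.2 (hV p hp)⟩)
    refine ⟨δ / 2, by positivity, fun p hp S hSQ hS => ?_⟩
    obtain ⟨⟨i, hi⟩, hLi⟩ := hL p hp
    refine ⟨fun q => P i (h q), fun q hq => ⟨P i, hP i hi q ⟨interior_subset (hLi ?_), hSQ hq⟩,
      Eventually.of_forall fun _ => rfl⟩⟩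
    have := hS hq
    rw [Metric.mem_closedBall] at this
    rw [Metric.mem_ball]
    linarith
  -- Induction on the number of cells of width δ; the minimum with the right end clips the last
  -- cell, and degenerate rectangles are allowed.
  have row : ∀ n : ℕ, ∀ a b c d : ℝ, a ≤ b → c ≤ d → Icc a b ×ˢ Icc c d ⊆ Q → b - a ≤ n * δ →
      d - c ≤ δ → ∃ Φ, IsPullbackPrimitive G h (Icc a b ×ˢ Icc c d) Φ := by
    intro n
    induction n with
    | zero =>
      intro a b c d hab hcd hsub hn hd
      refine hcell (a, c) (hsub ⟨left_mem_Icc.2 hab, left_mem_Icc.2 hcd⟩) _ hsub ?_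
      rintro ⟨x, y⟩ ⟨⟨h1, h2⟩, h3, h4⟩
      simp only [Nat.cast_zero, zero_mul] at hn
      simp only [Metric.mem_closedBall, Prod.dist_eq, Real.dist_eq, sup_le_iff, abs_le] at *
      refine ⟨⟨by linarith, by linarith⟩, by linarith, by linarith⟩
    | succ n ih =>
      intro a b c d hab hcd hsub hn hd
      push_cast at hn
      set m := min (a + δ) b with hm
      have ham : a ≤ m := le_min (by linarith) hab
      have hmb : m ≤ b := min_le_right _ _
      have eU : Icc a b ×ˢ Icc c d = Icc a m ×ˢ Icc c d ∪ Icc m b ×ˢ Icc c d := by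
        rw [← union_prod, Icc_union_Icc_eq_Icc ham hmb]
      have hsub1 : Icc a m ×ˢ Icc c d ⊆ Q := (eU ▸ subset_union_left).trans hsub
      have hsub2 : Icc m b ×ˢ Icc c d ⊆ Q := (eU ▸ subset_union_right).trans hsub
      obtain ⟨Φ, hΦ⟩ : ∃ Φ, IsPullbackPrimitive G h (Icc a m ×ˢ Icc c d) Φ := by
        refine hcell (a, c) (hsub1 ⟨left_mem_Icc.2 ham, left_mem_Icc.2 hcd⟩) _ hsub1 ?_
        rintro ⟨x, y⟩ ⟨⟨h1, h2⟩, h3, h4⟩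
        have : m ≤ a + δ := min_le_left _ _
        simp only [Metric.mem_closedBall, Prod.dist_eq, Real.dist_eq, sup_le_iff, abs_le] at *
        refine ⟨⟨by linarith, by linarith⟩, by linarith, by linarith⟩
      obtain ⟨Ψ, hΨ⟩ := ih m b c d hmb hcd hsub2 (by
        rcases min_choice (a + δ) b with h | h
        · rw [hm, h]; linarith
        · rw [hm, h, sub_self]; positivity) hd
      rw [eU]
      refine hΦ.glue hΨ (hh.mono (eU ▸ hsub)) (isClosed_Icc.prod isClosed_Icc)
        (isClosed_Icc.prod isClosed_Icc) ?_ ?_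
      · rw [prod_inter_prod, Icc_inter_Icc, inter_self]
        exact isPreconnected_Icc.prod isPreconnected_Icc
      · exact ⟨(m, c), ⟨⟨ham, le_rfl⟩, le_rfl, hcd⟩, ⟨le_rfl, hmb⟩, le_rfl, hcd⟩
  have col : ∀ n : ℕ, ∀ c d : ℝ, c ≤ d → Icc s₁ s₂ ×ˢ Icc c d ⊆ Q → d - c ≤ n * δ →
      ∃ Φ, IsPullbackPrimitive G h (Icc s₁ s₂ ×ˢ Icc c d) Φ := by
    obtain ⟨N, hN⟩ := exists_nat_ge ((s₂ - s₁) / δ)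
    rw [div_le_iff₀ hδ] at hN
    intro n
    induction n with
    | zero =>
      intro c d hcd hsub hn
      refine row N s₁ s₂ c d hs hcd hsub hN ?_
      simp only [Nat.cast_zero, zero_mul] at hn
      linarith
    | succ n ih =>
      intro c d hcd hsub hn
      push_cast at hn
      set m := min (c + δ) d with hm
      have ham : c ≤ m := le_min (by linarith) hcd
      have hmb : m ≤ d := min_le_right _ _
      have eU : Icc s₁ s₂ ×ˢ Icc c d = Icc s₁ s₂ ×ˢ Icc c m ∪ Icc s₁ s₂ ×ˢ Icc m d := by
        rw [← prod_union, Icc_union_Icc_eq_Icc ham hmb]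
      have hsub1 : Icc s₁ s₂ ×ˢ Icc c m ⊆ Q := (eU ▸ subset_union_left).trans hsub
      have hsub2 : Icc s₁ s₂ ×ˢ Icc m d ⊆ Q := (eU ▸ subset_union_right).trans hsub
      obtain ⟨Φ, hΦ⟩ := row N s₁ s₂ c m hs ham hsub1 hN (by
        have : m ≤ c + δ := min_le_left _ _
        linarith)
      obtain ⟨Ψ, hΨ⟩ := ih m d hmb hsub2 (by
        rcases min_choice (c + δ) d with h | h
        · rw [hm, h]; linarith
        · rw [hm, h, sub_self]; positivity)
      rw [eU]
      refine hΦ.glue hΨ (hh.mono (eU ▸ hsub)) (isClosed_Icc.prod isClosed_Icc)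
        (isClosed_Icc.prod isClosed_Icc) ?_ ?_
      · rw [prod_inter_prod, inter_self, Icc_inter_Icc]
        exact isPreconnected_Icc.prod isPreconnected_Icc
      · exact ⟨(s₁, m), ⟨⟨le_rfl, hs⟩, ham, le_rfl⟩, ⟨le_rfl, hs⟩, le_rfl, hmb⟩
  obtain ⟨N, hN⟩ := exists_nat_ge ((t₂ - t₁) / δ)
  rw [div_le_iff₀ hδ] at hN
  exact col N t₁ t₂ ht Subset.rfl hN

/-! ### Primitives along Lipschitz curves -/

theorem IsPullbackPrimitive.comp {X Y : Type*} [TopologicalSpace X] [TopologicalSpace Y]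
    {G : ℂ → ℂ} {h : X → ℂ} {S : Set X} {Φ : X → ℂ} (hΦ : IsPullbackPrimitive G h S Φ)
    {k : Y → ℂ} {T : Set Y} {f : Y → X} (hf : ContinuousOn f T) (hfm : MapsTo f T S)
    (hk : ∀ y ∈ T, h (f y) = k y) : IsPullbackPrimitive G k T (Φ ∘ f) := by
  intro y hy
  obtain ⟨P, hP, hP'⟩ := hΦ (f y) (hfm hy)
  refine ⟨P, hk y hy ▸ hP, ?_⟩
  have h1 : Tendsto f (𝓝[T] y) (𝓝[S] (f y)) := (hf y hy).tendsto_nhdsWithin hfm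
  filter_upwards [h1.eventually hP', self_mem_nhdsWithin] with z hz hzT
  rw [Function.comp_apply, hz, hk z hzT]

/-- Both φ and the indefinite integral are Lipschitz, and almost everywhere they have the same
derivative by the chain rule. An absolutely continuous function with zero derivative almost
everywhere is constant. -/
theorem IsPullbackPrimitive.sub_eq_integral {G : ℂ → ℂ} {γ φ : ℝ → ℂ} {x y : ℝ} {C : ℝ≥0}
    (hxy : x ≤ y) (hγ : LipschitzOnWith C γ (Icc x y))
    (hG : ∀ t ∈ Icc x y, AnalyticAt ℂ G (γ t)) (hφ : IsPullbackPrimitive G γ (Icc x y) φ) :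
    φ y - φ x = ∫ t in x..y, deriv γ t * G (γ t) := by
  have hGc : ContinuousOn (fun t => G (γ t)) (Icc x y) := fun t ht =>
    (hG t ht).continuousAt.comp_continuousWithinAt (hγ.continuousOn t ht)
  have hdγ : ∀ t ∈ Ioo x y, ‖deriv γ t‖ ≤ C := fun t ht =>
    norm_deriv_le_of_lipschitzOn (Icc_mem_nhds ht.1 ht.2) hγ
  obtain ⟨M, hM⟩ := isCompact_Icc.exists_bound_of_continuousOn hGc
  have hbound : ∀ t ∈ Ioo x y, ‖deriv γ t * G (γ t)‖ ≤ C * M := fun t ht => by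
    rw [norm_mul]
    exact mul_le_mul (hdγ t ht) (hM t (Ioo_subset_Icc_self ht)) (norm_nonneg _) C.2
  have hae : ∀ᵐ t ∂volume, t ∈ Ioc x y → ‖deriv γ t * G (γ t)‖ ≤ C * M := by
    filter_upwards [compl_mem_ae_iff.2 (measure_singleton y)] with t ht ht'
    exact hbound t ⟨ht'.1, lt_of_le_of_ne ht'.2 ht⟩
  have hmeas : AEStronglyMeasurable (fun t => deriv γ t * G (γ t))
      (volume.restrict (Ioc x y)) :=
    (aestronglyMeasurable_deriv γ _).mul
      ((hGc.mono Ioc_subset_Icc_self).aestronglyMeasurable measurableSet_Ioc)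
  have hint : IntervalIntegrable (fun t => deriv γ t * G (γ t)) volume x y := by
    rw [intervalIntegrable_iff_integrableOn_Ioc_of_le hxy]
    refine Integrable.of_bound hmeas (C * M) ?_
    rw [ae_restrict_iff' measurableSet_Ioc]
    exact hae
  let g : ℝ → ℂ := fun t => ∫ s in x..t, deriv γ s * G (γ s)
  have hgL : LipschitzOnWith (C * M.toNNReal) g (Icc x y) := by
    refine LipschitzOnWith.of_dist_le_mul fun p hp q hq => ?_
    have h1 : ∀ r ∈ Icc x y, IntervalIntegrable (fun t => deriv γ t * G (γ t)) volume x r :=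
      fun r hr => hint.mono_set (by
        rw [uIcc_of_le hxy, uIcc_of_le hr.1]
        exact Icc_subset_Icc_right hr.2)
    rw [dist_eq_norm, intervalIntegral.integral_interval_sub_left (h1 p hp) (h1 q hq),
      Real.dist_eq]
    have hM0 : 0 ≤ M := (norm_nonneg _).trans (hM x (left_mem_Icc.2 hxy))
    push_cast
    rw [Real.coe_toNNReal _ hM0]
    refine intervalIntegral.norm_integral_le_of_norm_le_const_ae ?_
    filter_upwards [hae] with t ht htm
    refine ht ?_
    have := uIoc_subset_uIcc htm
    rcases htm with ⟨e1, e2⟩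
    exact ⟨lt_of_le_of_lt (le_min hq.1 hp.1) e1, e2.trans (max_le hq.2 hp.2)⟩
  -- Locally φ is `P ∘ γ`, and `P` is Lipschitz on a small disc because its derivative `G` is
  -- bounded there; compactness makes this global.
  have hφL : ∃ C', LipschitzOnWith C' φ (Icc x y) := by
    refine LocallyLipschitzOn.exists_lipschitzOnWith_of_compact isCompact_Icc fun t ht => ?_
    obtain ⟨P, hP, hP'⟩ := hφ t ht
    have hb : ∀ᶠ w in 𝓝 (γ t), ‖G w‖ ≤ ‖G (γ t)‖ + 1 := by
      have := (hG t ht).continuousAt.norm.eventually (gt_mem_nhds (lt_add_one ‖G (γ t)‖))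
      exact this.mono fun _ h => le_of_lt h
    obtain ⟨r, hr, hball⟩ := Metric.eventually_nhds_iff_ball.1 (hP.and hb)
    have hPL : LipschitzOnWith (‖G (γ t)‖₊ + 1) P (Metric.ball (γ t) r) :=
      (convex_ball (γ t) r).lipschitzOnWith_of_nnnorm_hasDerivWithin_le
        (fun w hw => (hball w hw).1.hasDerivWithinAt) (fun w hw => (hball w hw).2)
    refine ⟨(‖G (γ t)‖₊ + 1) * C, {s | s ∈ Icc x y ∧ φ s = P (γ s) ∧ γ s ∈ Metric.ball (γ t) r},
      ?_, ?_⟩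
    · filter_upwards [self_mem_nhdsWithin, hP',
        (hγ.continuousOn t ht).eventually (Metric.ball_mem_nhds _ hr)] with s h1 h2 h3
      exact ⟨h1, h2, h3⟩
    · have h1 := hPL.comp (s := {s | s ∈ Icc x y ∧ φ s = P (γ s) ∧ γ s ∈ Metric.ball (γ t) r})
        (hγ.mono fun s hs => hs.1) (fun s hs => hs.2.2)
      intro p hp q hq
      have := h1 hp hq
      rwa [Function.comp_apply, Function.comp_apply, ← hp.2.1, ← hq.2.1] at this
  obtain ⟨C', hφL⟩ := hφL
  have hac : AbsolutelyContinuousOnInterval (fun t => φ t - g t) x y := by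
    refine AbsolutelyContinuousOnInterval.sub ?_ ?_
    · exact LipschitzOnWith.absolutelyContinuousOnInterval (by rwa [uIcc_of_le hxy])
    · exact LipschitzOnWith.absolutelyContinuousOnInterval (by rwa [uIcc_of_le hxy])
  obtain ⟨c, hc⟩ := hac.const_of_ae_hasDerivAt_zero (by
    filter_upwards [hint.ae_hasDerivAt_integral, hγ.ae_differentiableWithinAt_of_mem_real,
      compl_mem_ae_iff.2 (measure_singleton x), compl_mem_ae_iff.2 (measure_singleton y)]
      with t h1 h2 hx hy ht
    have ht' := ht
    rw [uIcc_of_le hxy] at ht'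
    have hn : Icc x y ∈ 𝓝 t :=
      Icc_mem_nhds (lt_of_le_of_ne ht'.1 (Ne.symm hx)) (lt_of_le_of_ne ht'.2 hy)
    have hdg := h1 ht x (by rw [uIcc_of_le hxy]; exact left_mem_Icc.2 hxy)
    have hdγ := ((h2 ht').differentiableAt hn).hasDerivAt
    obtain ⟨P, hP, hP'⟩ := hφ t ht'
    have h3 := hP.self_of_nhds.comp_of_eq t hdγ rfl
    rw [nhdsWithin_eq_nhds.2 hn] at hP'
    have h4 : HasDerivAt φ (G (γ t) * deriv γ t) t := h3.congr_of_eventuallyEq hP'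
    have h5 := h4.sub hdg
    rwa [mul_comm, sub_self] at h5)
  have e1 := hc x left_mem_uIcc
  have e2 := hc y right_mem_uIcc
  simp only [g, intervalIntegral.integral_same, sub_zero] at e1 e2
  rw [← e1] at e2
  linear_combination e2

/-! ### Circular crosscuts -/

/-- On a compact connected set which `h` maps into a half circle of radius `ρ`, a primitive of `G`
along `h` varies at most by `πρ sup ‖G‖`. -/
theorem IsPullbackPrimitive.norm_sub_le_of_halfCircle {X : Type*} [TopologicalSpace X]
    {G : ℂ → ℂ} {h : X → ℂ} {C : Set X} {Φ : X → ℂ} (hΦ : IsPullbackPrimitive G h C Φ)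
    (hh : ContinuousOn h C) (hC : IsPreconnected C) (hCc : IsCompact C) {σ : ℝ} (hσ : σ ^ 2 = 1)
    {r ρ M : ℝ} (hρ : 0 < ρ) (hc : ∀ p ∈ C, ‖h p - r‖ = ρ) (him : ∀ p ∈ C, 0 ≤ σ * (h p).im)
    (hG : ∀ p ∈ C, AnalyticAt ℂ G (h p)) (hM : ∀ p ∈ C, ‖G (h p)‖ ≤ M) {x y : X} (hx : x ∈ C)
    (hy : y ∈ C) : ‖Φ x - Φ y‖ ≤ Real.pi * (ρ * M) := by
  -- Multiplication by -iσ turns the half plane σ Im ≥ 0 into the right half plane, on which the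
  -- argument is continuous with values in [-π/2, π/2].
  let w : X → ℂ := fun p => (h p - r) * (-(σ * Complex.I))
  have hw : ContinuousOn w C := (hh.sub continuousOn_const).mul continuousOn_const
  have hwre : ∀ p, (w p).re = σ * (h p).im := fun p => by simp [w]; ring
  have hwn : ∀ p ∈ C, ‖w p‖ = ρ := fun p hp => by
    have : |σ| = 1 := by rw [← Real.sqrt_sq_eq_abs, hσ, Real.sqrt_one]
    simp [w, hc p hp, this]
  have hslit : ∀ p ∈ C, w p ∈ Complex.slitPlane := fun p hp => by
    rw [Complex.mem_slitPlane_iff_arg]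
    have h1 := Complex.abs_arg_le_pi_div_two_iff.2 ((hwre p).symm ▸ him p hp)
    refine ⟨fun e => ?_, fun e => ?_⟩
    · rw [e, abs_of_pos Real.pi_pos] at h1
      linarith [Real.pi_pos]
    · have := hwn p hp
      rw [e, norm_zero] at this
      linarith
  let θ : X → ℝ := fun p => (w p).arg
  have hθ : ContinuousOn θ C := fun p hp =>
    (Complex.continuousAt_arg (hslit p hp)).comp_continuousWithinAt (hw p hp)
  have hθb : ∀ p ∈ C, |θ p| ≤ Real.pi / 2 := fun p hp =>
    Complex.abs_arg_le_pi_div_two_iff.2 ((hwre p).symm ▸ him p hp)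
  let e : ℝ → ℂ := fun t => r + (σ * Complex.I) * (ρ * Complex.exp (t * Complex.I))
  have heθ : ∀ p ∈ C, e (θ p) = h p := fun p hp => by
    have h1 := Complex.norm_mul_exp_arg_mul_I (w p)
    rw [hwn p hp] at h1
    simp only [e, θ, h1, w]
    have : (σ : ℂ) ^ 2 = 1 := by exact_mod_cast hσ
    linear_combination (-(h p - r) * (σ : ℂ) ^ 2) * Complex.I_sq + (h p - r) * this
  have hed : ∀ t : ℝ, HasDerivAt e ((σ * Complex.I) * (ρ * (Complex.exp (t * Complex.I) * Complex.I))) t := by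
    intro t
    have h1 : HasDerivAt (fun t : ℝ => (t : ℂ) * Complex.I) Complex.I t := by
      simpa using (Complex.ofRealCLM.hasDerivAt (x := t)).mul_const Complex.I
    exact ((h1.cexp.const_mul (ρ : ℂ)).const_mul _).const_add _
  have hedn : ∀ t : ℝ, ‖deriv e t‖ ≤ ρ := by
    intro t
    have : |σ| = 1 := by rw [← Real.sqrt_sq_eq_abs, hσ, Real.sqrt_one]
    rw [(hed t).deriv]
    simp [this, abs_of_pos hρ, Complex.norm_exp_ofReal_mul_I]
  have heL : LipschitzWith ⟨ρ, hρ.le⟩ e :=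
    lipschitzWith_of_nnnorm_deriv_le (fun t => (hed t).differentiableAt) hedn
  have hT := eq_Icc_of_connected_compact ⟨⟨_, mem_image_of_mem θ hx⟩, hC.image θ hθ⟩
    (hCc.image_of_continuousOn hθ)
  set α := sInf (θ '' C)
  set β := sSup (θ '' C)
  have hpre : ∀ t ∈ Icc α β, ∃ p ∈ C, θ p = t := fun t ht => by rwa [← hT] at ht
  have hαβ : α ≤ β := by
    have : θ x ∈ Icc α β := hT ▸ mem_image_of_mem θ hx
    exact this.1.trans this.2
  have hGe : ∀ t ∈ Icc α β, AnalyticAt ℂ G (e t) := fun t ht => by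
    obtain ⟨p, hp, rfl⟩ := hpre t ht
    rw [heθ p hp]
    exact hG p hp
  -- A primitive along the arc, obtained from a rectangle of zero width. Composed with θ it is a
  -- primitive along `h` on `C`, so it has the same increments as Φ.
  obtain ⟨Ψ₂, hΨ₂⟩ := exists_isPullbackPrimitive_rectangle (G := G) (h := fun p => e p.2)
    (le_refl (0 : ℝ)) hαβ (heL.continuous.comp continuous_snd).continuousOn
    (fun p hp => hGe p.2 hp.2)
  have hΨ : IsPullbackPrimitive G e (Icc α β) (fun t => Ψ₂ (0, t)) :=
    hΨ₂.comp (f := fun t => ((0 : ℝ), t)) (by fun_prop) (fun t ht => ⟨⟨le_rfl, le_rfl⟩, ht⟩)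
      (fun _ _ => rfl)
  have hcmp := hΨ.comp (k := h) hθ (fun p hp => hT ▸ mem_image_of_mem θ hp) heθ
  have key : ∀ s ∈ Icc α β, ∀ t ∈ Icc α β, s ≤ t →
      ‖Ψ₂ (0, t) - Ψ₂ (0, s)‖ ≤ Real.pi * (ρ * M) := by
    intro s hs t ht hst
    have hsub : Icc s t ⊆ Icc α β := Icc_subset_Icc hs.1 ht.2
    rw [IsPullbackPrimitive.sub_eq_integral hst heL.lipschitzOnWith
      (fun q hq => hGe q (hsub hq)) (hΨ.mono hsub)]
    obtain ⟨p, hp, rfl⟩ := hpre s hs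
    obtain ⟨q, hq, rfl⟩ := hpre t ht
    have h1 := abs_le.1 (hθb p hp)
    have h2 := abs_le.1 (hθb q hq)
    have hM0 : 0 ≤ M := (norm_nonneg _).trans (hM x hx)
    refine (intervalIntegral.norm_integral_le_of_norm_le_const (C := ρ * M) fun t ht => ?_).trans ?_
    · rw [uIoc_of_le hst] at ht
      obtain ⟨p', hp', rfl⟩ := hpre t (hsub (Ioc_subset_Icc_self ht))
      rw [norm_mul, heθ p' hp']
      exact mul_le_mul (hedn _) (hM p' hp') (norm_nonneg _) hρ.le
    · rw [mul_comm, abs_of_nonneg (by linarith)]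
      exact mul_le_mul_of_nonneg_right (by linarith) (by positivity)
  have hd := hΦ.sub_eq hcmp hh hC hx hy
  simp only [Function.comp_apply] at hd
  have hxm : θ x ∈ Icc α β := hT ▸ mem_image_of_mem θ hx
  have hym : θ y ∈ Icc α β := hT ▸ mem_image_of_mem θ hy
  rw [show Φ x - Φ y = Ψ₂ (0, θ x) - Ψ₂ (0, θ y) by linear_combination hd]
  rcases le_total (θ x) (θ y) with h | h
  · rw [norm_sub_rev]
    exact key _ hxm _ hym h
  · exact key _ hym _ hxm h

/-- The circle of radius ρ separates the images of the lines t = c and t = d, so the level set of |h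
- r| contains a connected set joining s = 0 to s = 1. On it ‖G‖ ≤ M/ρ, and a half circle has length
πρ. The end points of the crossing may have different parameters τ and τ'. -/
theorem exists_norm_sub_le_of_crossing {G : ℂ → ℂ} {h : ℝ × ℝ → ℂ} {Φ : ℝ × ℝ → ℂ} {c d : ℝ}
    (hΦ : IsPullbackPrimitive G h (Icc 0 1 ×ˢ uIcc c d) Φ)
    (hh : ContinuousOn h (Icc 0 1 ×ˢ uIcc c d)) {σ : ℝ} (hσ : σ ^ 2 = 1)
    {r ρ M : ℝ} (hρ : 0 < ρ) (him : ∀ p ∈ Icc (0 : ℝ) 1 ×ˢ uIcc c d, 0 ≤ σ * (h p).im)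
    (hG : ∀ p ∈ Icc (0 : ℝ) 1 ×ˢ uIcc c d, AnalyticAt ℂ G (h p))
    (hM : ∀ p ∈ Icc (0 : ℝ) 1 ×ˢ uIcc c d, ‖G (h p)‖ * ‖h p - r‖ ≤ M)
    (hsep : (∀ s ∈ Icc (0 : ℝ) 1, ‖h (s, c) - r‖ < ρ ∧ ρ < ‖h (s, d) - r‖) ∨
      ∀ s ∈ Icc (0 : ℝ) 1, ρ < ‖h (s, c) - r‖ ∧ ‖h (s, d) - r‖ < ρ) :
    ∃ τ ∈ uIcc c d, ∃ τ' ∈ uIcc c d, ‖Φ (0, τ) - Φ (1, τ')‖ ≤ Real.pi * M := by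
  wlog hcd : c ≤ d generalizing c d
  · rw [uIcc_comm] at *
    refine this hΦ hh him hG hM (hsep.symm.imp ?_ ?_) (le_of_not_ge hcd)
    · exact fun H s hs => (H s hs).symm
    · exact fun H s hs => (H s hs).symm
  rw [uIcc_of_le hcd] at *
  have hu : ContinuousOn (fun p => ‖h p - r‖) (Icc 0 1 ×ˢ Icc c d) := (hh.sub continuousOn_const).norm
  obtain ⟨C, hCQ, hC, hCc, hCρ, ⟨τ, hτ⟩, τ', hτ'⟩ : ∃ C ⊆ Icc (0 : ℝ) 1 ×ˢ Icc c d,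
      IsPreconnected C ∧ IsCompact C ∧ (∀ p ∈ C, ‖h p - r‖ = ρ) ∧
      (∃ τ, ((0 : ℝ), τ) ∈ C) ∧ ∃ τ, ((1 : ℝ), τ) ∈ C := by
    rcases hsep with H | H
    · exact exists_isPreconnected_level hcd hu (fun s hs => (H s hs).1) (fun s hs => (H s hs).2)
    · obtain ⟨C, h1, h2, h3, h4, h5⟩ := exists_isPreconnected_level (ρ := -ρ) hcd hu.neg
        (fun s hs => by simpa using (H s hs).1) (fun s hs => by simpa using (H s hs).2)
      exact ⟨C, h1, h2, h3, fun p hp => by simpa using h4 p hp, h5⟩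
  refine ⟨τ, (hCQ hτ).2, τ', (hCQ hτ').2, ?_⟩
  have := (hΦ.mono hCQ).norm_sub_le_of_halfCircle (hh.mono hCQ) hC hCc hσ hρ hCρ
    (fun p hp => him p (hCQ hp)) (fun p hp => hG p (hCQ hp)) (M := M / ρ) (fun p hp => by
      rw [le_div_iff₀ hρ, ← hCρ p hp]
      exact hM p (hCQ hp)) hτ hτ'
  rwa [mul_div_cancel₀ _ hρ.ne'] at this

/-! ### Ends of an interval -/

theorem interval_ordConnected (a b : EReal) : (interval a b).OrdConnected :=
  ⟨fun _ hx _ hy _ hz => ⟨hx.1.trans_le (EReal.coe_le_coe_iff.2 hz.1),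
    (EReal.coe_le_coe_iff.2 hz.2).trans_lt hy.2⟩⟩

theorem isOpen_interval (a b : EReal) : IsOpen (interval a b) :=
  (isOpen_lt continuous_const continuous_coe_real_ereal).inter
    (isOpen_lt continuous_coe_real_ereal continuous_const)

theorem measurableSet_interval (a b : EReal) : MeasurableSet (interval a b) :=
  (isOpen_interval a b).measurableSet

theorem interval_nonempty {a b : EReal} (hab : a < b) : (interval a b).Nonempty :=
  EReal.lt_iff_exists_real_btwn.1 hab

theorem lowerEnd_hasBasis {a b : EReal} (hab : a < b) :
    (lowerEnd a).HasBasis (fun c : EReal => a < c) fun c => interval a c :=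
  (nhdsGT_basis_of_exists_gt ⟨b, hab⟩).comap _

theorem upperEnd_hasBasis {a b : EReal} (hab : a < b) :
    (upperEnd b).HasBasis (fun c : EReal => c < b) fun c => interval c b :=
  (nhdsLT_basis_of_exists_lt ⟨a, hab⟩).comap _

/-- The properties of the filters of neighbourhoods of the ends of an interval `I`. -/
structure IsEndFilter (I : Set ℝ) (F : Filter ℝ) : Prop where
  neBot : F.NeBot
  countable : F.IsCountablyGenerated
  mem : I ∈ F
  ordConnected : ∀ U ∈ F, ∃ S ∈ F, S ⊆ U ∧ S.OrdConnected

theorem isEndFilter_lowerEnd {a b : EReal} (hab : a < b) :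
    IsEndFilter (interval a b) (lowerEnd a) where
  neBot := (lowerEnd_hasBasis hab).neBot_iff.2 fun hc => interval_nonempty hc
  countable := by unfold lowerEnd; infer_instance
  mem := (lowerEnd_hasBasis hab).mem_of_mem hab
  ordConnected U hU := by
    obtain ⟨c, hc, h⟩ := (lowerEnd_hasBasis hab).mem_iff.1 hU
    exact ⟨_, (lowerEnd_hasBasis hab).mem_of_mem hc, h, interval_ordConnected _ _⟩

theorem isEndFilter_upperEnd {a b : EReal} (hab : a < b) :
    IsEndFilter (interval a b) (upperEnd b) where
  neBot := (upperEnd_hasBasis hab).neBot_iff.2 fun hc => interval_nonempty hc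
  countable := by unfold upperEnd; infer_instance
  mem := (upperEnd_hasBasis hab).mem_of_mem hab
  ordConnected U hU := by
    obtain ⟨c, hc, h⟩ := (upperEnd_hasBasis hab).mem_iff.1 hU
    exact ⟨_, (upperEnd_hasBasis hab).mem_of_mem hc, h, interval_ordConnected _ _⟩

theorem tendsto_intervalIntegral_upperEnd {a b : EReal} (hab : a < b) {f : ℝ → ℂ}
    (hf : IntegrableOn f (interval a b)) {c : ℝ} (hc : c ∈ interval a b) :
    Tendsto (fun t => ∫ x in c..t, f x) (upperEnd b) (𝓝 (∫ x in interval a b ∩ Ioi c, f x)) := by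
  have hF := isEndFilter_upperEnd hab
  have := hF.countable
  have hm := measurableSet_interval a b
  rw [← setIntegral_indicator measurableSet_Ioi]
  refine Tendsto.congr' (f₁ := fun t => ∫ x in interval a b, (Ioc c t).indicator f x) ?_ ?_
  · have : interval (c : EReal) b ∈ upperEnd b := (upperEnd_hasBasis hab).mem_of_mem hc.2
    filter_upwards [this] with t ht
    have hct : c ≤ t := EReal.coe_le_coe_iff.1 ht.1.le
    have hsub : Ioc c t ⊆ interval a b := fun x hx =>
      ⟨hc.1.trans (EReal.coe_lt_coe_iff.2 hx.1), (EReal.coe_le_coe_iff.2 hx.2).trans_lt ht.2⟩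
    rw [setIntegral_indicator measurableSet_Ioc, intervalIntegral.integral_of_le hct,
      inter_eq_right.2 hsub]
  · refine tendsto_integral_filter_of_dominated_convergence (fun x => ‖f x‖) ?_ ?_ hf.norm ?_
    · exact Eventually.of_forall fun t => hf.aestronglyMeasurable.indicator measurableSet_Ioc
    · exact Eventually.of_forall fun t => Eventually.of_forall fun x =>
        norm_indicator_le_norm_self _ _
    · refine (ae_restrict_iff' hm).2 (Eventually.of_forall fun x hx => ?_)
      refine tendsto_const_nhds.congr' ?_
      have : interval (x : EReal) b ∈ upperEnd b := (upperEnd_hasBasis hab).mem_of_mem hx.2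
      filter_upwards [this] with t ht
      have : x < t := EReal.coe_lt_coe_iff.1 ht.1
      by_cases hxc : c < x <;> simp [indicator, hxc, this.le]

theorem tendsto_intervalIntegral_lowerEnd {a b : EReal} (hab : a < b) {f : ℝ → ℂ}
    (hf : IntegrableOn f (interval a b)) {c : ℝ} (hc : c ∈ interval a b) :
    Tendsto (fun t => ∫ x in c..t, f x) (lowerEnd a) (𝓝 (-∫ x in interval a b ∩ Iic c, f x)) := by
  have hF := isEndFilter_lowerEnd hab
  have := hF.countable
  have hm := measurableSet_interval a b
  rw [← setIntegral_indicator measurableSet_Iic]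
  refine Tendsto.congr' (f₁ := fun t => -∫ x in interval a b, (Ioc t c).indicator f x) ?_ ?_
  · have : interval a (c : EReal) ∈ lowerEnd a := (lowerEnd_hasBasis hab).mem_of_mem hc.1
    filter_upwards [this] with t ht
    have hct : t ≤ c := EReal.coe_le_coe_iff.1 ht.2.le
    have hsub : Ioc t c ⊆ interval a b := fun x hx =>
      ⟨ht.1.trans (EReal.coe_lt_coe_iff.2 hx.1), (EReal.coe_le_coe_iff.2 hx.2).trans_lt hc.2⟩
    rw [setIntegral_indicator measurableSet_Ioc, intervalIntegral.integral_of_ge hct,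
      inter_eq_right.2 hsub]
  · refine (tendsto_integral_filter_of_dominated_convergence (fun x => ‖f x‖) ?_ ?_ hf.norm ?_).neg
    · exact Eventually.of_forall fun t => hf.aestronglyMeasurable.indicator measurableSet_Ioc
    · exact Eventually.of_forall fun t => Eventually.of_forall fun x =>
        norm_indicator_le_norm_self _ _
    · refine (ae_restrict_iff' hm).2 (Eventually.of_forall fun x hx => ?_)
      refine tendsto_const_nhds.congr' ?_
      have : interval a (x : EReal) ∈ lowerEnd a := (lowerEnd_hasBasis hab).mem_of_mem hx.1
      filter_upwards [this] with t ht
      have : t < x := EReal.coe_lt_coe_iff.1 ht.2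
      by_cases hxc : x ≤ c <;> simp [indicator, hxc, this]

/-! ### Cauchy's theorem for a deformation of an interval -/

/-- The deformation `h` contracts to the real point `r`, or recedes to infinity, along `F`, and `G`
is small enough on it for the integrals over circular crosscuts to vanish in the limit. -/
def CrosscutsVanish (I : Set ℝ) (G : ℂ → ℂ) (h : ℝ × ℝ → ℂ) (F : Filter ℝ) : Prop :=
  ∃ r : ℝ, Tendsto (fun p => ‖G (h p)‖ * ‖h p - r‖) (𝓟 (Icc 0 1) ×ˢ F) (𝓝 0) ∧
    ((Tendsto (fun p => ‖h p - r‖) (𝓟 (Icc 0 1) ×ˢ F) (𝓝 0) ∧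
      ∀ s ∈ Icc (0 : ℝ) 1, ∀ t ∈ I, h (s, t) ≠ r) ∨
    Tendsto (fun p => ‖h p - r‖) (𝓟 (Icc 0 1) ×ˢ F) atTop)

theorem eventually_principal_prod_iff {α β : Type*} {S : Set α} {F : Filter β} {P : α × β → Prop} :
    (∀ᶠ p in 𝓟 S ×ˢ F, P p) ↔ ∀ᶠ t in F, ∀ s ∈ S, P (s, t) := by
  rw [eventually_swap_iff, eventually_prod_principal_iff]
  rfl

theorem IsPullbackPrimitive.sub_eq_integral' {G : ℂ → ℂ} {γ φ : ℝ → ℂ} {x y : ℝ} {C : ℝ≥0}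
    (hγ : LipschitzOnWith C γ (uIcc x y)) (hG : ∀ t ∈ uIcc x y, AnalyticAt ℂ G (γ t))
    (hφ : IsPullbackPrimitive G γ (uIcc x y) φ) :
    φ y - φ x = ∫ t in x..y, deriv γ t * G (γ t) := by
  rcases le_total x y with h | h
  · rw [uIcc_of_le h] at *
    exact hφ.sub_eq_integral h hγ hG
  · rw [uIcc_of_ge h] at *
    rw [intervalIntegral.integral_symm, ← hφ.sub_eq_integral h hγ hG]
    ring

/-- A crossing inside a small tail makes Φ(0, τ) and Φ(1, τ') nearly equal. Increments of Φ along
the two horizontal edges are integrals from c₀ over the interval and over the contour, and `V` is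
the increment across the deformation at c₀. That τ and τ' differ is harmless, since both lie in the
prescribed tail `U`. -/
theorem exists_crosscut {I : Set ℝ} (hI : I.OrdConnected) {F : Filter ℝ} (hF : IsEndFilter I F)
    {G : ℂ → ℂ} {h : ℝ × ℝ → ℂ} {γ : ℝ → ℂ} {C : ℝ≥0} (hγ : LipschitzOnWith C γ I)
    (hh : ContinuousOn h (Icc 0 1 ×ˢ I)) (h0 : ∀ t ∈ I, h (0, t) = t) (h1 : ∀ t ∈ I, h (1, t) = γ t)
    {σ : ℝ} (hσ : σ ^ 2 = 1) (him : ∀ p ∈ Icc (0 : ℝ) 1 ×ˢ I, 0 ≤ σ * (h p).im)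
    (hG : ∀ p ∈ Icc (0 : ℝ) 1 ×ˢ I, AnalyticAt ℂ G (h p)) (hend : CrosscutsVanish I G h F)
    {c₀ : ℝ} (hc₀ : c₀ ∈ I) {V : ℂ}
    (hV : ∀ t₁ t₂, Icc t₁ t₂ ⊆ I → c₀ ∈ Icc t₁ t₂ → ∀ Φ,
      IsPullbackPrimitive G h (Icc 0 1 ×ˢ Icc t₁ t₂) Φ → Φ (1, c₀) - Φ (0, c₀) = V)
    {ε : ℝ} (hε : 0 < ε) {U : Set ℝ} (hU : U ∈ F) :
    ∃ τ ∈ U, ∃ τ' ∈ U,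
      ‖(∫ t in c₀..τ', deriv γ t * G (γ t)) - (∫ t in c₀..τ, G t) + V‖ ≤ ε := by
  obtain ⟨r, hGr, hr⟩ := hend
  have := hF.neBot
  have hsmall : ∀ᶠ t in F, ∀ s ∈ Icc (0 : ℝ) 1, ‖G (h (s, t))‖ * ‖h (s, t) - r‖ ≤ ε / Real.pi :=
    eventually_principal_prod_iff.1
      ((hGr.eventually (gt_mem_nhds (div_pos hε Real.pi_pos))).mono fun _ h => le_of_lt h)
  obtain ⟨S, hSF, hS, hSo⟩ := hF.ordConnected _ (inter_mem (inter_mem hU hF.mem) hsmall)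
  obtain ⟨c, hcS⟩ := Filter.nonempty_of_mem hSF
  have hSI : S ⊆ I := fun t ht => (hS ht).1.2
  have hcI : c ∈ I := hSI hcS
  have hcc : ContinuousOn (fun s => ‖h (s, c) - r‖) (Icc 0 1) :=
    ((hh.comp (f := fun s => (s, c)) (by fun_prop) fun s hs => ⟨hs, hcI⟩).sub
      continuousOn_const).norm
  have hne : (Icc (0 : ℝ) 1).Nonempty := nonempty_Icc.2 zero_le_one
  -- At a finite end ρ is half the minimum over s of |h(s, c) - r|, positive because h avoids r; at
  -- infinity ρ is the maximum plus one. The parameter d is then taken far enough towards the end.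
  obtain ⟨d, hdS, ρ, hρ, hsep⟩ : ∃ d ∈ S, ∃ ρ > 0,
      (∀ s ∈ Icc (0 : ℝ) 1, ‖h (s, c) - r‖ < ρ ∧ ρ < ‖h (s, d) - r‖) ∨
      ∀ s ∈ Icc (0 : ℝ) 1, ρ < ‖h (s, c) - r‖ ∧ ‖h (s, d) - r‖ < ρ := by
    rcases hr with ⟨hr0, hrne⟩ | hr
    · obtain ⟨s₀, hs₀, hmin⟩ := isCompact_Icc.exists_isMinOn hne hcc
      have hpos : 0 < ‖h (s₀, c) - r‖ := norm_pos_iff.2 (sub_ne_zero.2 (hrne s₀ hs₀ c hcI))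
      have h2 := eventually_principal_prod_iff.1 (hr0.eventually (gt_mem_nhds (half_pos hpos)))
      obtain ⟨d, hd, hdS⟩ := (h2.and hSF).exists
      refine ⟨d, hdS, _, half_pos hpos, Or.inr fun s hs => ⟨?_, hd s hs⟩⟩
      have : ‖h (s₀, c) - r‖ ≤ ‖h (s, c) - r‖ := hmin hs
      linarith
    · obtain ⟨s₀, hs₀, hmax⟩ := isCompact_Icc.exists_isMaxOn hne hcc
      have h2 := eventually_principal_prod_iff.1
        (hr.eventually (eventually_gt_atTop (‖h (s₀, c) - r‖ + 1)))
      obtain ⟨d, hd, hdS⟩ := (h2.and hSF).exists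
      refine ⟨d, hdS, ‖h (s₀, c) - r‖ + 1, by positivity, Or.inl fun s hs => ⟨?_, hd s hs⟩⟩
      have : ‖h (s, c) - r‖ ≤ ‖h (s₀, c) - r‖ := hmax hs
      linarith
  have hcd : uIcc c d ⊆ S := hSo.uIcc_subset hcS hdS
  -- The rectangle must contain c₀ as well as c and d, so that one primitive serves both the base
  -- point and the crossing.
  set t₁ := min (min c d) c₀ with ht₁
  set t₂ := max (max c d) c₀ with ht₂
  have hmin : t₁ ∈ I := by
    rcases min_choice (min c d) c₀ with e | e
    · rw [ht₁, e]
      rcases min_choice c d with e' | e' <;> rw [e']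
      exacts [hcI, hSI hdS]
    · rwa [ht₁, e]
  have hmax : t₂ ∈ I := by
    rcases max_choice (max c d) c₀ with e | e
    · rw [ht₂, e]
      rcases max_choice c d with e' | e' <;> rw [e']
      exacts [hcI, hSI hdS]
    · rwa [ht₂, e]
  have hc₀m : c₀ ∈ Icc t₁ t₂ := ⟨min_le_right _ _, le_max_right _ _⟩
  have hcdm : uIcc c d ⊆ Icc t₁ t₂ := Icc_subset_Icc (min_le_left _ _) (le_max_left _ _)
  have hIcc : Icc t₁ t₂ ⊆ I := hI.out hmin hmax
  have hmono : Icc (0 : ℝ) 1 ×ˢ Icc t₁ t₂ ⊆ Icc (0 : ℝ) 1 ×ˢ I := prod_mono Subset.rfl hIcc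
  obtain ⟨Φ, hΦ⟩ := exists_isPullbackPrimitive_rectangle zero_le_one (hc₀m.1.trans hc₀m.2)
    (hh.mono hmono) (fun p hp => hG p (hmono hp))
  have hmono' : Icc (0 : ℝ) 1 ×ˢ uIcc c d ⊆ Icc (0 : ℝ) 1 ×ˢ Icc t₁ t₂ := prod_mono Subset.rfl hcdm
  obtain ⟨τ, hτ, τ', hτ', hle⟩ := exists_norm_sub_le_of_crossing (hΦ.mono hmono')
    (hh.mono (hmono'.trans hmono)) hσ hρ (fun p hp => him p (hmono (hmono' hp)))
    (fun p hp => hG p (hmono (hmono' hp))) (fun p hp => (hS (hcd hp.2)).2 p.1 hp.1) hsep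
  refine ⟨τ, (hS (hcd hτ)).1.1, τ', (hS (hcd hτ')).1.1, ?_⟩
  have hΦ1 : IsPullbackPrimitive G γ (Icc t₁ t₂) (fun t => Φ (1, t)) :=
    hΦ.comp (f := fun t => ((1 : ℝ), t)) (by fun_prop) (fun t ht => ⟨by simp, ht⟩)
      (fun t ht => h1 t (hIcc ht))
  have hΦ0 : IsPullbackPrimitive G (fun t : ℝ => (t : ℂ)) (Icc t₁ t₂) (fun t => Φ (0, t)) :=
    hΦ.comp (f := fun t => ((0 : ℝ), t)) (by fun_prop) (fun t ht => ⟨by simp, ht⟩)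
      (fun t ht => h0 t (hIcc ht))
  have hs1 : uIcc c₀ τ' ⊆ Icc t₁ t₂ := ordConnected_Icc.uIcc_subset hc₀m (hcdm hτ')
  have hs0 : uIcc c₀ τ ⊆ Icc t₁ t₂ := ordConnected_Icc.uIcc_subset hc₀m (hcdm hτ)
  have e1 := (hΦ1.mono hs1).sub_eq_integral' (hγ.mono (hs1.trans hIcc)) (fun t ht => by
    rw [← h1 t (hIcc (hs1 ht))]
    exact hG _ ⟨by simp, hIcc (hs1 ht)⟩)
  have e0 := (hΦ0.mono hs0).sub_eq_integral' (C := 1)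
    ((Complex.isometry_ofReal.lipschitz).lipschitzOnWith) (fun t ht => by
    rw [← h0 t (hIcc (hs0 ht))]
    exact hG _ ⟨by simp, hIcc (hs0 ht)⟩)
  have hd : ∀ t : ℝ, deriv (fun t : ℝ => (t : ℂ)) t = 1 := fun t =>
    (Complex.ofRealCLM.hasDerivAt (x := t)).deriv.trans (by simp)
  simp only [hd, one_mul] at e0
  rw [← e1, ← e0, ← hV t₁ t₂ hIcc hc₀m Φ hΦ,
    show Φ (1, τ') - Φ (1, c₀) - (Φ (0, τ) - Φ (0, c₀)) + (Φ (1, c₀) - Φ (0, c₀))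
      = -(Φ (0, τ) - Φ (1, τ')) by ring, norm_neg]
  rwa [mul_div_cancel₀ _ Real.pi_pos.ne'] at hle

/-- Cauchy's theorem for a deformation of an interval whose ends are controlled. -/
theorem integral_eq_of_crosscutsVanish {a b : EReal} (hab : a < b)
    {G : ℂ → ℂ} {h : ℝ × ℝ → ℂ} {γ : ℝ → ℂ} {C : ℝ≥0} (hγ : LipschitzOnWith C γ (interval a b))
    (hh : ContinuousOn h (Icc 0 1 ×ˢ interval a b)) (h0 : ∀ t ∈ interval a b, h (0, t) = t)
    (h1 : ∀ t ∈ interval a b, h (1, t) = γ t)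
    {σ : ℝ} (hσ : σ ^ 2 = 1) (him : ∀ p ∈ Icc (0 : ℝ) 1 ×ˢ interval a b, 0 ≤ σ * (h p).im)
    (hG : ∀ p ∈ Icc (0 : ℝ) 1 ×ˢ interval a b, AnalyticAt ℂ G (h p))
    (ha : CrosscutsVanish (interval a b) G h (lowerEnd a))
    (hb : CrosscutsVanish (interval a b) G h (upperEnd b))
    (hint : IntegrableOn (fun t => deriv γ t * G (γ t)) (interval a b))
    (hint0 : IntegrableOn (fun t : ℝ => G t) (interval a b)) :
    ∫ t in interval a b, deriv γ t * G (γ t) = ∫ t in interval a b, G t := by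
  obtain ⟨c₀, hc₀⟩ := interval_nonempty hab
  set I := interval a b with hIdef
  have hI : I.OrdConnected := interval_ordConnected a b
  have hmono : ∀ {t₁ t₂}, Icc t₁ t₂ ⊆ I → Icc (0 : ℝ) 1 ×ˢ Icc t₁ t₂ ⊆ Icc (0 : ℝ) 1 ×ˢ I :=
    fun h => prod_mono Subset.rfl h
  have hcc : Icc c₀ c₀ ⊆ I := by
    rw [Icc_self, singleton_subset_iff]
    exact hc₀
  -- The rectangle of zero width over c₀ fixes the transverse increment `V`, independently of the
  -- larger rectangles used near the ends.
  obtain ⟨Ψ, hΨ⟩ := exists_isPullbackPrimitive_rectangle zero_le_one (le_refl c₀)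
    (hh.mono (hmono hcc)) (fun p hp => hG p (hmono hcc hp))
  have hV : ∀ t₁ t₂, Icc t₁ t₂ ⊆ I → c₀ ∈ Icc t₁ t₂ → ∀ Φ,
      IsPullbackPrimitive G h (Icc 0 1 ×ˢ Icc t₁ t₂) Φ →
        Φ (1, c₀) - Φ (0, c₀) = Ψ (1, c₀) - Ψ (0, c₀) := by
    intro t₁ t₂ _ hc Φ hΦ
    have := (hΦ.mono (prod_mono Subset.rfl (Icc_subset_Icc hc.1 hc.2))).sub_eq hΨ
      (hh.mono (hmono hcc)) (isPreconnected_Icc.prod isPreconnected_Icc)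
      (x := (1, c₀)) (y := (0, c₀)) ⟨by simp, by simp⟩ ⟨by simp, by simp⟩
    linear_combination this
  set V := Ψ (1, c₀) - Ψ (0, c₀)
  -- Each end gives the relation L - L₀ + V = 0 between the one-sided integrals. Subtracting the
  -- relations at the two ends eliminates V.
  have lim : ∀ F : Filter ℝ, IsEndFilter I F → CrosscutsVanish I G h F → ∀ L L₀ : ℂ,
      Tendsto (fun t => ∫ x in c₀..t, deriv γ x * G (γ x)) F (𝓝 L) →
      Tendsto (fun t => ∫ x in c₀..t, G x) F (𝓝 L₀) → L - L₀ + V = 0 := by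
    intro F hF hend L L₀ hL hL₀
    rw [← norm_eq_zero]
    refine le_antisymm (le_of_forall_pos_le_add fun ε hε => ?_) (norm_nonneg _)
    have hU : {t | ‖(∫ x in c₀..t, deriv γ x * G (γ x)) - L‖ < ε / 3} ∩
        {t | ‖(∫ x in c₀..t, G x) - L₀‖ < ε / 3} ∈ F := by
      have e1 := Metric.tendsto_nhds.1 hL (ε / 3) (by positivity)
      have e2 := Metric.tendsto_nhds.1 hL₀ (ε / 3) (by positivity)
      simp only [dist_eq_norm] at e1 e2
      exact inter_mem e1 e2
    obtain ⟨τ, hτ, τ', hτ', hle⟩ := exists_crosscut hI hF hγ hh h0 h1 hσ him hG hend hc₀ hV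
      (show 0 < ε / 3 by positivity) hU
    have e1 : ‖(∫ x in c₀..τ', deriv γ x * G (γ x)) - L‖ < ε / 3 := hτ'.1
    have e2 : ‖(∫ x in c₀..τ, G x) - L₀‖ < ε / 3 := hτ.2
    set P := ∫ x in c₀..τ', deriv γ x * G (γ x)
    set P₀ := ∫ x in c₀..τ, G x
    calc ‖L - L₀ + V‖ = ‖(P - P₀ + V) - (P - L) + (P₀ - L₀)‖ := by congr 1; ring
      _ ≤ ‖P - P₀ + V‖ + ‖P - L‖ + ‖P₀ - L₀‖ :=
        (norm_add_le _ _).trans (add_le_add_left (norm_sub_le _ _) _)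
      _ ≤ 0 + ε := by linarith
  have e1 := lim _ (isEndFilter_upperEnd hab) hb _ _
    (tendsto_intervalIntegral_upperEnd hab hint hc₀)
    (tendsto_intervalIntegral_upperEnd hab hint0 hc₀)
  have e2 := lim _ (isEndFilter_lowerEnd hab) ha _ _
    (tendsto_intervalIntegral_lowerEnd hab hint hc₀)
    (tendsto_intervalIntegral_lowerEnd hab hint0 hc₀)
  have split : ∀ f : ℝ → ℂ, IntegrableOn f I →
      ∫ t in I, f t = (∫ t in I ∩ Ioi c₀, f t) + ∫ t in I ∩ Iic c₀, f t := by
    intro f hf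
    rw [← compl_Ioi, ← sdiff_eq, integral_inter_add_sdiff measurableSet_Ioi hf]
  rw [split _ hint, split _ hint0]
  linear_combination e1 - e2

/-! ### The sheets -/

theorem sheet_im_pos {D : Set ℂ} (hD : ∀ z ∈ D, z.im < 0) {l : ℤˣ} {z : ℂ} (hz : z ∈ sheet D l) :
    0 < ((l : ℤ) : ℝ) * z.im := by
  rcases Int.units_eq_one_or l with rfl | rfl
  · have h1 : conj z ∈ D := by simpa [sheet] using hz
    simpa using hD _ h1
  · have h1 : z ∈ D := by simpa [sheet] using hz
    simpa using hD _ h1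

theorem units_cast_sq (l : ℤˣ) : ((l : ℤ) : ℝ) ^ 2 = 1 := by
  rcases Int.units_eq_one_or l with rfl | rfl <;> simp

theorem interval_subset_closure_sheet {D : Set ℂ} {I : Set ℝ}
    (hb : (fun x : ℝ => (x : ℂ)) '' I ⊆ frontier D) (l : ℤˣ) {t : ℝ} (ht : t ∈ I) :
    (t : ℂ) ∈ closure (sheet D l) := by
  have h1 : (t : ℂ) ∈ closure D := frontier_subset_closure (hb ⟨t, ht, rfl⟩)
  rcases Int.units_eq_one_or l with rfl | rfl
  · have h2 : sheet D 1 = (fun z : ℂ => conj z) '' D := by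
      ext z
      simp only [sheet, if_true, mem_ofPred_eq, mem_image]
      exact ⟨fun h => ⟨_, h, by simp⟩, by rintro ⟨w, hw, rfl⟩; simpa using hw⟩
    rw [h2]
    have := image_closure_subset_closure_image Complex.continuous_conj ⟨_, h1, rfl⟩
    simpa using this
  · simpa [sheet] using h1

/-! ### Convergence factors -/

/-- A function which is bounded by one and decays in a closed half plane, and tends to one as
`δ → 0`. -/
noncomputable def convergenceFactor (σ : ℝ) (N : ℕ) (δ : ℝ) (w : ℂ) : ℂ :=
  ((1 + δ * (w * (-(σ * Complex.I)))) ^ N)⁻¹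

section

variable {σ δ : ℝ} {N : ℕ} {w : ℂ}

theorem convergenceFactor_base_re : (1 + δ * (w * (-(σ * Complex.I)))).re = 1 + δ * (σ * w.im) := by
  simp [-mul_eq_mul_left_iff, mul_comm σ]

theorem one_le_norm_convergenceFactor_base (hδ : 0 ≤ δ) (hw : 0 ≤ σ * w.im) :
    1 ≤ ‖1 + δ * (w * (-(σ * Complex.I)))‖ := by
  refine le_trans ?_ (Complex.re_le_norm _)
  rw [convergenceFactor_base_re]
  nlinarith [mul_nonneg hδ hw]

/-- The base is 1 + ζ with Re ζ ≥ 0, whence |1 + ζ| ≥ |ζ|. -/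
theorem norm_le_norm_convergenceFactor_base (hσ : σ ^ 2 = 1) (hδ : 0 ≤ δ) (hw : 0 ≤ σ * w.im) :
    δ * ‖w‖ ≤ ‖1 + δ * (w * (-(σ * Complex.I)))‖ := by
  have h1 : δ * ‖w‖ = ‖δ * (w * (-(σ * Complex.I)))‖ := by
    have : |σ| = 1 := by rw [← Real.sqrt_sq_eq_abs, hσ, Real.sqrt_one]
    simp [this, abs_of_nonneg hδ]
  rw [h1, Complex.norm_def, Complex.norm_def]
  refine Real.sqrt_le_sqrt ?_
  rw [Complex.normSq_apply, Complex.normSq_apply, convergenceFactor_base_re]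
  have h2 : (δ * (w * (-(σ * Complex.I)))).re = δ * (σ * w.im) := by
    simp [-mul_eq_mul_left_iff, mul_comm σ]
  have h3 : (1 + δ * (w * (-(σ * Complex.I)))).im = (δ * (w * (-(σ * Complex.I)))).im := by simp
  rw [h2, h3]
  nlinarith [mul_nonneg hδ hw]

theorem norm_convergenceFactor_le_one (hδ : 0 ≤ δ) (hw : 0 ≤ σ * w.im) :
    ‖convergenceFactor σ N δ w‖ ≤ 1 := by
  rw [convergenceFactor, norm_inv, norm_pow]
  exact inv_le_one_of_one_le₀ (one_le_pow₀ (one_le_norm_convergenceFactor_base hδ hw))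

theorem norm_convergenceFactor_le (hσ : σ ^ 2 = 1) (hδ : 0 < δ) (hw : 0 ≤ σ * w.im) (hw0 : w ≠ 0)
    {k : ℕ} (hk : k ≤ N) : ‖convergenceFactor σ N δ w‖ ≤ ((δ * ‖w‖) ^ k)⁻¹ := by
  rw [convergenceFactor, norm_inv, norm_pow]
  have : 0 < δ * ‖w‖ := mul_pos hδ (norm_pos_iff.2 hw0)
  refine inv_anti₀ (by positivity) ?_
  calc (δ * ‖w‖) ^ k ≤ ‖1 + δ * (w * (-(σ * Complex.I)))‖ ^ k :=
        pow_le_pow_left₀ this.le (norm_le_norm_convergenceFactor_base hσ hδ.le hw) k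
    _ ≤ _ := pow_le_pow_right₀ (one_le_norm_convergenceFactor_base hδ.le hw) hk

theorem analyticAt_convergenceFactor (hδ : 0 ≤ δ) (hw : 0 ≤ σ * w.im) :
    AnalyticAt ℂ (convergenceFactor σ N δ) w := by
  unfold convergenceFactor
  refine AnalyticAt.inv (by fun_prop) ?_
  have := one_le_norm_convergenceFactor_base hδ hw
  exact pow_ne_zero _ (norm_pos_iff.1 (by linarith))

theorem tendsto_convergenceFactor : Tendsto (fun n : ℕ => convergenceFactor σ N (1 / ((n : ℝ) + 1)) w)
    atTop (𝓝 1) := by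
  have h1 : Tendsto (fun n : ℕ => ((1 / ((n : ℝ) + 1) : ℝ) : ℂ)) atTop (𝓝 0) := by
    have := (Complex.continuous_ofReal.tendsto 0).comp tendsto_one_div_add_atTop_nhds_zero_nat
    simpa [Function.comp_def] using this
  have h2 : Tendsto (fun n : ℕ => (1 + ((1 / ((n : ℝ) + 1) : ℝ) : ℂ) * (w * (-(σ * Complex.I)))) ^ N)
      atTop (𝓝 1) := by
    simpa using ((h1.mul_const (w * (-(σ * Complex.I)))).const_add 1).pow N
  simpa [convergenceFactor] using h2.inv₀ one_ne_zero

end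

/-! ### Integrals along admissible contours -/

section

variable {V : Type*} [NormedAddCommGroup V] [NormedSpace ℂ V] {K : ℂ → V} {a b : EReal} {D : Set ℂ}
  {l : ℤˣ} {γ : ℝ → ℂ}

omit [NormedSpace ℂ V] in
-- The power bound is assumed on the sheets only. Points of the interval are limits of points of a
-- sheet, and `K` is continuous there.
theorem norm_le_rpow_of_mem_interval {I : Set ℝ}
    (hb : (fun x : ℝ => (x : ℂ)) '' I ⊆ frontier D) {C p ε r : ℝ}
    (h : ∀ μ ∈ sheet D l, ‖μ - (r : ℂ)‖ < ε → ‖K μ‖ ≤ C * ‖μ - (r : ℂ)‖ ^ p)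
    {t : ℝ} (ht : t ∈ I) (htr : t ≠ r) (hε : ‖(t : ℂ) - r‖ < ε) (hK : ContinuousAt K (t : ℂ)) :
    ‖K t‖ ≤ C * ‖(t : ℂ) - r‖ ^ p := by
  have hcl := mem_closure_iff_nhdsWithin_neBot.1 (interval_subset_closure_sheet hb l ht)
  have hne : ‖(t : ℂ) - r‖ ≠ 0 := by
    rw [norm_ne_zero_iff, sub_ne_zero]
    exact_mod_cast htr
  have hc : ContinuousAt (fun μ : ℂ => C * ‖μ - (r : ℂ)‖ ^ p) (t : ℂ) :=
    continuousAt_const.mul (ContinuousAt.rpow_const (by fun_prop) (Or.inl hne))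
  have hε' : ∀ᶠ μ in 𝓝[sheet D l] (t : ℂ), ‖μ - (r : ℂ)‖ < ε :=
    nhdsWithin_le_nhds ((ContinuousAt.norm (by fun_prop) :
      ContinuousAt (fun μ : ℂ => ‖μ - (r : ℂ)‖) (t : ℂ)).eventually (gt_mem_nhds hε))
  refine le_of_tendsto_of_tendsto (b := 𝓝[sheet D l] (t : ℂ)) (hK.norm.mono_left nhdsWithin_le_nhds)
    (hc.tendsto.mono_left nhdsWithin_le_nhds) ?_
  filter_upwards [hε', self_mem_nhdsWithin] with μ h1 h2 using h μ h2 h1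

omit [NormedSpace ℂ V] in
-- At a finite end the crosscut quantity is O(|h - r|^(p+1)) with p > -1, so no decay of the factor
-- is needed. At infinity a sufficiently high power of the factor beats the polynomial growth of
-- `K`. The threshold `k` depends only on the end, so one exponent can serve both ends and all δ.
theorem crosscutsVanish_of_deformationEnd {h : ℝ × ℝ → ℂ} {e : EReal} {F : Filter ℝ}
    {I : Set ℝ} (hI : I ∈ F) (hend : DeformationEnd K h e F)
    (he : (∃ r : ℝ, e = r) ∨ e = ⊥ ∨ e = ⊤) (hne : ∀ r : ℝ, e = r → r ∉ I)
    (hb : (fun x : ℝ => (x : ℂ)) '' I ⊆ frontier D) (hD : ∀ z ∈ D, z.im < 0)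
    (h0 : ∀ t ∈ I, h (0, t) = t) (hm : ∀ s ∈ Ioc (0 : ℝ) 1, ∀ t ∈ I, h (s, t) ∈ sheet D l)
    (hK : ∀ t ∈ I, ContinuousAt K (t : ℂ))
    (hbound : ∀ r : ℝ, e = r → ∃ C > 0, ∃ p : ℝ, -1 < p ∧ p ≤ 0 ∧
      ∃ ε > 0, ∀ l : ℤˣ, ∀ μ ∈ sheet D l, ‖μ - (r : ℂ)‖ < ε → ‖K μ‖ ≤ C * ‖μ - (r : ℂ)‖ ^ p) :
    ∃ k : ℕ, ∀ G : ℂ → ℂ, ∀ M : ℝ,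
      (∀ p ∈ Icc (0 : ℝ) 1 ×ˢ I, ‖G (h p)‖ ≤ M * ‖K (h p)‖) → ∀ δ > 0, ∀ N ≥ k,
      CrosscutsVanish I (fun w => G w * convergenceFactor ((l : ℤ) : ℝ) N δ w) h F := by
  have him : ∀ p ∈ Icc (0 : ℝ) 1 ×ˢ I, 0 ≤ ((l : ℤ) : ℝ) * (h p).im := by
    rintro ⟨s, t⟩ ⟨hs, ht⟩
    rcases eq_or_lt_of_le hs.1 with rfl | hs0
    · rw [h0 t ht]
      simp
    · exact (sheet_im_pos hD (hm s ⟨hs0, hs.2⟩ t ht)).le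
  have hdom : ∀ᶠ p in 𝓟 (Icc (0 : ℝ) 1) ×ˢ F, p ∈ Icc (0 : ℝ) 1 ×ˢ I :=
    prod_mem_prod (mem_principal_self _) hI
  rcases he with ⟨r, rfl⟩ | he
  · obtain ⟨C, hC, p, hp, -, ε, hε, hKb⟩ := hbound r rfl
    have hlim := hend.1 r rfl
    have hlim0 : Tendsto (fun q => ‖h q - r‖) (𝓟 (Icc (0 : ℝ) 1) ×ˢ F) (𝓝 0) := by
      have := (hlim.sub_const (r : ℂ)).norm
      simpa using this
    have hhr : ∀ s ∈ Icc (0 : ℝ) 1, ∀ t ∈ I, h (s, t) ≠ r := by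
      intro s hs t ht e
      rcases eq_or_lt_of_le hs.1 with rfl | hs0
      · rw [h0 t ht] at e
        have : t = r := by exact_mod_cast e
        exact hne r rfl (this ▸ ht)
      · have := sheet_im_pos hD (hm s ⟨hs0, hs.2⟩ t ht)
        rw [e] at this
        simp at this
    refine ⟨0, fun G M hGM δ hδ N _ => ⟨r, ?_, Or.inl ⟨hlim0, hhr⟩⟩⟩
    have hlim1 : Tendsto (fun q => |M| * (C * ‖h q - r‖ ^ (p + 1))) (𝓟 (Icc (0 : ℝ) 1) ×ˢ F)
        (𝓝 0) := by
      have h1 := hlim0.rpow_const (p := p + 1) (Or.inr (by linarith))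
      rw [Real.zero_rpow (by linarith)] at h1
      simpa using (h1.const_mul C).const_mul |M|
    refine squeeze_zero' (Eventually.of_forall fun _ => by positivity) ?_ hlim1
    filter_upwards [hdom, hlim0.eventually (gt_mem_nhds hε)] with q hq hqε
    have hKq : ‖K (h q)‖ ≤ C * ‖h q - r‖ ^ p := by
      obtain ⟨s, t⟩ := q
      obtain ⟨hs, ht⟩ := hq
      rcases eq_or_lt_of_le hs.1 with e | hs0
      · dsimp only at e
        subst e
        rw [h0 t ht] at hqε ⊢
        exact norm_le_rpow_of_mem_interval hb (hKb l) ht (fun e => hne r rfl (e ▸ ht)) hqε (hK t ht)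
      · exact hKb l _ (hm s ⟨hs0, hs.2⟩ t ht) hqε
    have hpos : 0 < ‖h q - r‖ := norm_pos_iff.2 (sub_ne_zero.2 (hhr q.1 hq.1 q.2 hq.2))
    have h1 : ‖G (h q)‖ ≤ |M| * (C * ‖h q - r‖ ^ p) :=
      (hGM q hq).trans (mul_le_mul (le_abs_self M) hKq (norm_nonneg _) (abs_nonneg _))
    rw [norm_mul, Real.rpow_add_one hpos.ne']
    calc ‖G (h q)‖ * ‖convergenceFactor ((l : ℤ) : ℝ) N δ (h q)‖ * ‖h q - r‖
        ≤ (|M| * (C * ‖h q - r‖ ^ p)) * 1 * ‖h q - r‖ := by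
          gcongr
          exact norm_convergenceFactor_le_one hδ.le (him q hq)
      _ = _ := by ring
  · obtain ⟨hlim, C, m, hCm⟩ := hend.2 he
    -- The m powers cancel the growth of `K`, one more cancels the weight |h|, and the last leaves a
    -- bound that tends to zero.
    refine ⟨m + 2, fun G M hGM δ hδ N hN => ⟨0, ?_, Or.inr (by simpa using hlim)⟩⟩
    have hlim1 : Tendsto (fun q => |M| * (|C| * 2 ^ m) * (δ ^ (m + 2))⁻¹ * ‖h q‖⁻¹)
        (𝓟 (Icc (0 : ℝ) 1) ×ˢ F) (𝓝 0) := by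
      simpa using (tendsto_inv_atTop_zero.comp hlim).const_mul _
    refine squeeze_zero' (Eventually.of_forall fun _ => by positivity) ?_ hlim1
    filter_upwards [hdom, hCm, hlim.eventually (eventually_ge_atTop 1)] with q hq hCq hq1
    have hpos : 0 < ‖h q‖ := by linarith
    have h1 : ‖K (h q)‖ ≤ |C| * (2 ^ m * ‖h q‖ ^ m) := by
      refine hCq.trans (mul_le_mul (le_abs_self C) ?_ (by positivity) (abs_nonneg _))
      rw [← mul_pow]
      exact pow_le_pow_left₀ (by linarith) (by linarith) m
    have h2 : ‖G (h q)‖ ≤ |M| * (|C| * (2 ^ m * ‖h q‖ ^ m)) :=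
      (hGM q hq).trans (mul_le_mul (le_abs_self M) h1 (norm_nonneg _) (abs_nonneg _))
    have h3 := norm_convergenceFactor_le (units_cast_sq l) hδ (him q hq) (norm_pos_iff.1 hpos) hN
    rw [norm_mul, Complex.ofReal_zero, sub_zero]
    calc ‖G (h q)‖ * ‖convergenceFactor ((l : ℤ) : ℝ) N δ (h q)‖ * ‖h q‖
        ≤ (|M| * (|C| * (2 ^ m * ‖h q‖ ^ m))) * ((δ * ‖h q‖) ^ (m + 2))⁻¹ * ‖h q‖ := by
          gcongr
      _ = _ := by
          rw [mul_pow]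
          field_simp
          ring

/-- Cauchy's theorem is applied to `G` times the convergence factor. The factor is bounded by one,
so dominated convergence removes it on both sides as δ = 1/(n + 1) → 0. -/
theorem contour_integral_eq_scalar (hab : a < b) (hD : ∀ z ∈ D, z.im < 0)
    (hb : (fun x : ℝ => (x : ℂ)) '' interval a b ⊆ frontier D)
    (hKI : ∀ t ∈ interval a b, AnalyticAt ℂ K (t : ℂ))
    (hbound : ∀ r : ℝ, (a = r ∨ b = r) → ∃ C > 0, ∃ p : ℝ, -1 < p ∧ p ≤ 0 ∧
      ∃ ε > 0, ∀ l : ℤˣ, ∀ μ ∈ sheet D l, ‖μ - (r : ℂ)‖ < ε → ‖K μ‖ ≤ C * ‖μ - (r : ℂ)‖ ^ p)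
    (hγ : IsAdmissibleContour K a b (sheet D l) γ)
    (hint : IntegrableOn (fun t : ℝ => K t) (interval a b))
    {G : ℂ → ℂ} {M : ℝ} (hGs : ∀ w ∈ sheet D l, AnalyticAt ℂ G w)
    (hGI : ∀ t ∈ interval a b, AnalyticAt ℂ G (t : ℂ))
    (hGK : ∀ w, 0 ≤ ((l : ℤ) : ℝ) * w.im → ‖G w‖ ≤ M * ‖K w‖) :
    ∫ t in interval a b, deriv γ t * G (γ t) = ∫ t in interval a b, G t := by
  obtain ⟨C, hlip⟩ := hγ.lipschitz
  obtain ⟨h, hh, h0, h1, hm, hea, heb⟩ := hγ.deformation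
  set I := interval a b with hIdef
  have hIm := measurableSet_interval a b
  have hcase : ∀ p ∈ Icc (0 : ℝ) 1 ×ˢ I, h p ∈ sheet D l ∨ ∃ t ∈ I, h p = (t : ℂ) := by
    rintro ⟨s, t⟩ ⟨hs, ht⟩
    rcases eq_or_lt_of_le hs.1 with rfl | hs0
    · exact Or.inr ⟨t, ht, h0 t ht⟩
    · exact Or.inl (hm s ⟨hs0, hs.2⟩ t ht)
  have him : ∀ p ∈ Icc (0 : ℝ) 1 ×ˢ I, 0 ≤ ((l : ℤ) : ℝ) * (h p).im := by
    intro p hp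
    rcases hcase p hp with hp | ⟨t, -, hp⟩
    · exact (sheet_im_pos hD hp).le
    · rw [hp]; simp
  have hγs : ∀ t ∈ I, γ t ∈ sheet D l := fun t ht => h1 t ht ▸ hm 1 (by simp) t ht
  have hends : ∀ e : EReal, (∃ r : ℝ, e = r) ∨ e = ⊥ ∨ e = ⊤ := by
    intro e
    induction e with
    | bot => simp
    | top => simp
    | coe x => exact Or.inl ⟨x, rfl⟩
  obtain ⟨k₁, hk₁⟩ := crosscutsVanish_of_deformationEnd (l := l) (isEndFilter_lowerEnd hab).mem hea
    (hends a) (by rintro r rfl hr; exact lt_irrefl _ hr.1) hb hD h0 hm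
    (fun t ht => (hKI t ht).continuousAt) (fun r hr => hbound r (Or.inl hr))
  obtain ⟨k₂, hk₂⟩ := crosscutsVanish_of_deformationEnd (l := l) (isEndFilter_upperEnd hab).mem heb
    (hends b) (by rintro r rfl hr; exact lt_irrefl _ hr.2) hb hD h0 hm
    (fun t ht => (hKI t ht).continuousAt) (fun r hr => hbound r (Or.inr hr))
  set N := max k₁ k₂
  set σ : ℝ := ((l : ℤ) : ℝ) with hσdef
  have hGh : ∀ p ∈ Icc (0 : ℝ) 1 ×ˢ I, ‖G (h p)‖ ≤ M * ‖K (h p)‖ := fun p hp => hGK _ (him p hp)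
  have hGan : ∀ p ∈ Icc (0 : ℝ) 1 ×ˢ I, AnalyticAt ℂ G (h p) := by
    intro p hp
    rcases hcase p hp with hp | ⟨t, ht, hp⟩
    · exact hGs _ hp
    · rw [hp]; exact hGI t ht
  have hγim : ∀ t ∈ I, 0 ≤ σ * (γ t).im := fun t ht => (sheet_im_pos hD (hγs t ht)).le
  have hGγ : ContinuousOn (fun t => G (γ t)) I := fun t ht =>
    (hGs _ (hγs t ht)).continuousAt.comp_continuousWithinAt (hlip.continuousOn t ht)
  have hG0 : ContinuousOn (fun t : ℝ => G t) I := fun t ht =>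
    ((hGI t ht).continuousAt.comp Complex.continuous_ofReal.continuousAt).continuousWithinAt
  have int1 : IntegrableOn (fun t => deriv γ t * G (γ t)) I := by
    refine (hγ.finite_variation.const_mul M).mono'
      ((aestronglyMeasurable_deriv γ _).mul (hGγ.aestronglyMeasurable hIm)) ?_
    refine (ae_restrict_iff' hIm).2 (Eventually.of_forall fun t ht => ?_)
    rw [norm_mul, mul_comm, ← mul_assoc]
    exact mul_le_mul_of_nonneg_right (hGK _ (hγim t ht)) (norm_nonneg _)
  have int0 : IntegrableOn (fun t : ℝ => G t) I := by
    refine (hint.norm.const_mul M).mono' (hG0.aestronglyMeasurable hIm) ?_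
    exact (ae_restrict_iff' hIm).2 (Eventually.of_forall fun t _ => hGK _ (by simp))
  have hcf1 : ∀ δ : ℝ, 0 ≤ δ → ContinuousOn (fun t => convergenceFactor σ N δ (γ t)) I :=
    fun δ hδ t ht => (analyticAt_convergenceFactor hδ (hγim t ht)).continuousAt.comp_continuousWithinAt
      (hlip.continuousOn t ht)
  have hcf0 : ∀ δ : ℝ, 0 ≤ δ → ContinuousOn (fun t : ℝ => convergenceFactor σ N δ t) I :=
    fun δ hδ t ht => ((analyticAt_convergenceFactor (w := (t : ℂ)) hδ (by simp)).continuousAt.comp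
      Complex.continuous_ofReal.continuousAt).continuousWithinAt
  have eqδ : ∀ n : ℕ, ∫ t in I, deriv γ t * (G (γ t) * convergenceFactor σ N (1 / ((n : ℝ) + 1)) (γ t))
      = ∫ t in I, G t * convergenceFactor σ N (1 / ((n : ℝ) + 1)) t := by
    intro n
    have hδ : (0 : ℝ) < 1 / ((n : ℝ) + 1) := by positivity
    refine integral_eq_of_crosscutsVanish (h := h)
      (G := fun w => G w * convergenceFactor σ N (1 / ((n : ℝ) + 1)) w) hab hlip hh h0 h1
      (units_cast_sq l) him
      (fun p hp => (hGan p hp).mul (analyticAt_convergenceFactor hδ.le (him p hp)))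
      (hk₁ G M hGh _ hδ N (le_max_left _ _)) (hk₂ G M hGh _ hδ N (le_max_right _ _)) ?_ ?_
    · refine int1.norm.mono' ((aestronglyMeasurable_deriv γ _).mul
        ((hGγ.mul (hcf1 _ hδ.le)).aestronglyMeasurable hIm)) ?_
      refine (ae_restrict_iff' hIm).2 (Eventually.of_forall fun t ht => ?_)
      rw [← mul_assoc, norm_mul]
      exact mul_le_of_le_one_right (norm_nonneg _) (norm_convergenceFactor_le_one hδ.le (hγim t ht))
    · refine int0.norm.mono' ((hG0.mul (hcf0 _ hδ.le)).aestronglyMeasurable hIm) ?_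
      refine (ae_restrict_iff' hIm).2 (Eventually.of_forall fun t ht => ?_)
      rw [norm_mul]
      exact mul_le_of_le_one_right (norm_nonneg _) (norm_convergenceFactor_le_one hδ.le (by simp))
  have lim1 : Tendsto (fun n : ℕ => ∫ t in I, deriv γ t *
      (G (γ t) * convergenceFactor σ N (1 / ((n : ℝ) + 1)) (γ t))) atTop
      (𝓝 (∫ t in I, deriv γ t * G (γ t))) := by
    refine tendsto_integral_of_dominated_convergence (fun t => ‖deriv γ t * G (γ t)‖) (fun n => ?_)
      int1.norm (fun n => ?_) ?_
    · exact (aestronglyMeasurable_deriv γ _).mul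
        ((hGγ.mul (hcf1 _ (by positivity))).aestronglyMeasurable hIm)
    · refine (ae_restrict_iff' hIm).2 (Eventually.of_forall fun t ht => ?_)
      rw [← mul_assoc, norm_mul]
      exact mul_le_of_le_one_right (norm_nonneg _)
        (norm_convergenceFactor_le_one (by positivity) (hγim t ht))
    · refine Eventually.of_forall fun t => ?_
      simpa using ((tendsto_convergenceFactor (σ := σ) (N := N) (w := γ t)).const_mul
        (G (γ t))).const_mul (deriv γ t)
  have lim0 : Tendsto (fun n : ℕ => ∫ t in I,
      (G t * convergenceFactor σ N (1 / ((n : ℝ) + 1)) t)) atTop (𝓝 (∫ t in I, G t)) := by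
    refine tendsto_integral_of_dominated_convergence (fun t : ℝ => ‖G t‖) (fun n => ?_)
      int0.norm (fun n => ?_) ?_
    · exact (hG0.mul (hcf0 _ (by positivity))).aestronglyMeasurable hIm
    · refine (ae_restrict_iff' hIm).2 (Eventually.of_forall fun t ht => ?_)
      rw [norm_mul]
      exact mul_le_of_le_one_right (norm_nonneg _)
        (norm_convergenceFactor_le_one (by positivity) (by simp))
    · refine Eventually.of_forall fun t => ?_
      simpa using (tendsto_convergenceFactor (σ := σ) (N := N) (w := (t : ℂ))).const_mul (G t)
  refine tendsto_nhds_unique lim1 ?_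
  simp only [eqδ]
  exact lim0

end

/-! ### Spectral measures -/

section

variable {H : Type*} [NormedAddCommGroup H] [InnerProductSpace ℂ H] [CompleteSpace H]
  (E : ProjMeasure H) {A : H →ₗ.[ℂ] H} {S T : Set ℝ}

theorem ProjMeasure.measure_apply (hS : MeasurableSet S) (x : H) :
    E.measure x S = ENNReal.ofReal (‖E.proj S x‖ ^ 2) :=
  Measure.ofMeasurable_apply S hS

theorem ProjMeasure.measureReal_apply (hS : MeasurableSet S) (x : H) :
    (E.measure x).real S = ‖E.proj S x‖ ^ 2 := by
  rw [Measure.real, E.measure_apply hS, ENNReal.toReal_ofReal (by positivity)]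

instance (x : H) : IsFiniteMeasure (E.measure x) :=
  ⟨by rw [E.measure_apply MeasurableSet.univ]; exact ENNReal.ofReal_lt_top⟩

theorem ProjMeasure.measureReal_univ (x : H) : (E.measure x).real univ = ‖x‖ ^ 2 := by
  rw [E.measureReal_apply MeasurableSet.univ, E.proj_univ]
  rfl

theorem ProjMeasure.proj_proj_self (hS : MeasurableSet S) (x : H) :
    E.proj S (E.proj S x) = E.proj S x := by
  have := congrArg (fun T : H →L[ℂ] H => T x) (E.isStarProjection S hS).isIdempotentElem.eq
  simpa using this

theorem ProjMeasure.inner_proj_left (hS : MeasurableSet S) (x y : H) :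
    inner ℂ (E.proj S x) y = inner ℂ x (E.proj S y) := by
  have h : ContinuousLinearMap.adjoint (E.proj S) = E.proj S :=
    (E.isStarProjection S hS).isSelfAdjoint
  rw [← ContinuousLinearMap.adjoint_inner_right, h]

theorem ProjMeasure.inner_proj_self (hS : MeasurableSet S) (x : H) :
    inner ℂ x (E.proj S x) = ((‖E.proj S x‖ ^ 2 : ℝ) : ℂ) := by
  rw [← E.proj_proj_self hS, ← E.inner_proj_left hS, E.proj_proj_self hS,
    inner_self_eq_norm_sq_to_K]
  norm_cast

theorem ProjMeasure.norm_proj_le (hS : MeasurableSet S) (x : H) : ‖E.proj S x‖ ≤ ‖x‖ := by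
  have h1 : (E.measure x).real S ≤ (E.measure x).real univ := measureReal_mono (subset_univ S)
  rw [E.measureReal_apply hS, E.measureReal_univ] at h1
  exact le_of_sq_le_sq h1 (norm_nonneg _)

theorem ProjMeasure.norm_proj_union_sq (hS : MeasurableSet S) (hT : MeasurableSet T)
    (hd : Disjoint S T) (x : H) :
    ‖E.proj (S ∪ T) x‖ ^ 2 = ‖E.proj S x‖ ^ 2 + ‖E.proj T x‖ ^ 2 := by
  rw [← E.measureReal_apply (hS.union hT), ← E.measureReal_apply hS, ← E.measureReal_apply hT,
    measureReal_union hd hT]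

/-- The quadratic forms ‖E(S)x‖² are additive because they form a measure, and on a complex space
the form determines the operator. -/
theorem ProjMeasure.proj_union (hS : MeasurableSet S) (hT : MeasurableSet T)
    (hd : Disjoint S T) : E.proj (S ∪ T) = E.proj S + E.proj T := by
  refine ContinuousLinearMap.coe_injective ((ext_inner_map _ _).1 fun x => ?_)
  have h : ∀ U, MeasurableSet U → inner ℂ (E.proj U x) x = ((‖E.proj U x‖ ^ 2 : ℝ) : ℂ) :=
    fun U hU => by rw [E.inner_proj_left hU, E.inner_proj_self hU]
  simp only [ContinuousLinearMap.coe_coe, inner_add_left,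
    ContinuousLinearMap.toLinearMap_add, LinearMap.add_apply]
  rw [h _ (hS.union hT), h _ hS, h _ hT, E.norm_proj_union_sq hS hT hd]
  push_cast
  rfl

/-- With y = E(S)x additivity gives ‖E(S ∪ T)y‖² = ‖y‖² + ‖E(T)y‖², while E(S ∪ T) does not increase
the norm. -/
theorem ProjMeasure.proj_proj_of_disjoint (hS : MeasurableSet S) (hT : MeasurableSet T)
    (hd : Disjoint S T) (x : H) : E.proj T (E.proj S x) = 0 := by
  have h1 := E.norm_proj_union_sq hS hT hd (E.proj S x)
  have h2 := E.norm_proj_le (hS.union hT) (E.proj S x)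
  rw [E.proj_proj_self hS] at h1
  have h3 := pow_le_pow_left₀ (norm_nonneg _) h2 2
  have : ‖E.proj T (E.proj S x)‖ ^ 2 ≤ 0 := by linarith
  simpa using le_antisymm this (by positivity)

theorem ProjMeasure.proj_proj (hS : MeasurableSet S) (hT : MeasurableSet T) (x : H) :
    E.proj S (E.proj T x) = E.proj (S ∩ T) x := by
  have hST := hS.inter hT
  have e1 : E.proj T x = E.proj (S ∩ T) x + E.proj (T \ S) x := by
    have := E.proj_union hST (hT.diff hS)
      (disjoint_sdiff_right.mono_left inter_subset_left)
    rw [inter_comm S T, inter_union_sdiff] at this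
    rw [this, inter_comm]
    rfl
  have e2 : ∀ y, E.proj S y = E.proj (S ∩ T) y + E.proj (S \ T) y := by
    intro y
    have := E.proj_union hST (hS.diff hT)
      (disjoint_sdiff_right.mono_left inter_subset_right)
    rw [inter_union_sdiff] at this
    rw [this]
    rfl
  rw [e1, map_add, E.proj_proj_of_disjoint (hT.diff hS) hS disjoint_sdiff_left, add_zero, e2,
    E.proj_proj_self hST, E.proj_proj_of_disjoint hST (hS.diff hT)
      (disjoint_sdiff_right.mono_left inter_subset_right), add_zero]

theorem ProjMeasure.measure_proj (hS : MeasurableSet S) (x : H) :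
    E.measure (E.proj S x) = (E.measure x).restrict S := by
  ext T hT
  rw [Measure.restrict_apply hT, E.measure_apply hT, E.measure_apply (hT.inter hS),
    E.proj_proj hT hS]

theorem ProjMeasure.proj_compl (hS : MeasurableSet S) (x : H) :
    E.proj S x + E.proj Sᶜ x = x := by
  have := E.proj_union hS hS.compl disjoint_compl_right
  rw [union_compl_self, E.proj_univ] at this
  exact (congrArg (fun T : H →L[ℂ] H => T x) this).symm

variable {E}

theorem integrable_id_of_sq {μ : Measure ℝ} [IsFiniteMeasure μ]
    (h : Integrable (fun t : ℝ => t ^ 2) μ) : Integrable (fun t : ℝ => t) μ := by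
  refine ((integrable_const (1 : ℝ)).add h).mono' (by fun_prop) (Eventually.of_forall fun t => ?_)
  rw [Real.norm_eq_abs, Pi.add_apply]
  nlinarith [sq_abs t, sq_nonneg (|t| - 1), abs_nonneg t]

theorem ProjMeasure.IsSpectralMeasureOf.integrable_sq (hE : E.IsSpectralMeasureOf A) {x : H}
    (hx : x ∈ A.domain) : Integrable (fun t : ℝ => t ^ 2) (E.measure x) := (hE.1 x).1 hx

theorem ProjMeasure.IsSpectralMeasureOf.proj_mem (hE : E.IsSpectralMeasureOf A)
    (hS : MeasurableSet S) {x : H} (hx : x ∈ A.domain) : E.proj S x ∈ A.domain := by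
  rw [hE.1, E.measure_proj hS]
  exact (hE.integrable_sq hx).restrict

theorem ProjMeasure.IsSpectralMeasureOf.proj_mem_of_bounded (hE : E.IsSpectralMeasureOf A)
    (hS : MeasurableSet S) {n : ℝ} (hn : ∀ t ∈ S, |t| ≤ n) (x : H) : E.proj S x ∈ A.domain := by
  rw [hE.1, E.measure_proj hS]
  refine Integrable.of_bound (by fun_prop) (n ^ 2) ?_
  refine (ae_restrict_iff' hS).2 (Eventually.of_forall fun t ht => ?_)
  rw [norm_pow, Real.norm_eq_abs]
  exact pow_le_pow_left₀ (abs_nonneg _) (hn t ht) 2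

/-- Only diagonal values ⟨x, Ax⟩ are prescribed. Vectors of complementary spectral subspaces have
additive measures, also for u + cv with |c| = 1, so the cross terms of the form cancel; c = 1 and c
= i isolate ⟨u, Av⟩. -/
theorem ProjMeasure.IsSpectralMeasureOf.inner_eq_zero (hE : E.IsSpectralMeasureOf A)
    (hS : MeasurableSet S) {u v : A.domain} (hu : E.proj S (u : H) = u)
    (hv : E.proj S (v : H) = 0) : inner ℂ (u : H) (A v) = 0 := by
  have orth : ∀ T, MeasurableSet T → inner ℂ (E.proj T (u : H)) (E.proj T (v : H)) = 0 := by
    intro T hT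
    rw [E.inner_proj_left hT, E.proj_proj_self hT, ← hu, E.inner_proj_left hS, E.proj_proj hS hT,
      inter_comm, ← E.proj_proj hT hS, hv, map_zero, inner_zero_right]
  have key : ∀ c : ℂ, ‖c‖ = 1 → c * inner ℂ (u : H) (A v) + conj c * inner ℂ (v : H) (A u) = 0 := by
    intro c hc
    have hm : E.measure ((u + c • v : A.domain) : H) = E.measure (u : H) + E.measure (v : H) := by
      ext T hT
      rw [Measure.add_apply, E.measure_apply hT, E.measure_apply hT, E.measure_apply hT,
        ← ENNReal.ofReal_add (by positivity) (by positivity)]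
      congr 1
      simp only [Submodule.coe_add, Submodule.coe_smul, map_add, map_smul]
      have := norm_add_sq_eq_norm_sq_add_norm_sq_of_inner_eq_zero (𝕜 := ℂ) (E.proj T (u : H))
        (c • E.proj T (v : H)) (by rw [inner_smul_right, orth T hT, mul_zero])
      rw [norm_smul, hc, one_mul] at this
      simpa only [sq] using this
    have h1 := hE.2 (u + c • v)
    rw [hm, integral_add_measure (integrable_id_of_sq (hE.integrable_sq u.2))
      (integrable_id_of_sq (hE.integrable_sq v.2)), Complex.ofReal_add, ← hE.2 u, ← hE.2 v,
      LinearPMap.map_add, LinearPMap.map_smul] at h1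
    simp only [Submodule.coe_add, Submodule.coe_smul, inner_add_left, inner_add_right,
      inner_smul_left, inner_smul_right] at h1
    have h2 : conj c * c = 1 := by
      rw [← Complex.normSq_eq_conj_mul_self, Complex.normSq_eq_norm_sq, hc]
      simp
    linear_combination h1 - inner ℂ (v : H) (A v) * h2
  have k1 := key 1 (by simp)
  have k2 := key Complex.I (by simp)
  simp only [map_one, one_mul, Complex.conj_I] at k1 k2
  linear_combination (1 / 2 : ℂ) * k1 - (Complex.I / 2) * k2
    + ((inner ℂ (u : H) (A v) - inner ℂ (v : H) (A u)) / 2) * Complex.I_sq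

/-- Split both arguments by `S` and its complement: the mixed terms vanish, and the domain is dense
enough to test equality. -/
theorem ProjMeasure.IsSpectralMeasureOf.map_proj (hE : E.IsSpectralMeasureOf A)
    (hA : IsSelfAdjoint A) (hS : MeasurableSet S) (x : A.domain) :
    A ⟨E.proj S (x : H), hE.proj_mem hS x.2⟩ = E.proj S (A x) := by
  have hd : Dense (A.domain : Set H) := hA.dense_domain
  have part : ∀ U : Set ℝ, ∀ hU : MeasurableSet U, ∀ u v : A.domain,
      inner ℂ (E.proj U (u : H))
        (A ⟨E.proj Uᶜ (v : H), hE.proj_mem hU.compl v.2⟩) = 0 := by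
    intro U hU u v
    refine hE.inner_eq_zero hU (u := ⟨E.proj U (u : H), hE.proj_mem hU u.2⟩) ?_ ?_
    · exact E.proj_proj_self hU _
    · exact E.proj_proj_of_disjoint hU.compl hU disjoint_compl_left _
  have hx : x = (⟨E.proj S (x : H), hE.proj_mem hS x.2⟩ : A.domain)
      + ⟨E.proj Sᶜ (x : H), hE.proj_mem hS.compl x.2⟩ := Subtype.ext (E.proj_compl hS x).symm
  refine hd.eq_of_inner_right (𝕜 := ℂ) fun y hy => ?_
  rw [← E.inner_proj_left hS]
  have e1 : inner ℂ (E.proj S y) (A x)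
      = inner ℂ (E.proj S y) (A ⟨E.proj S (x : H), hE.proj_mem hS x.2⟩) := by
    conv_lhs => rw [hx]
    rw [LinearPMap.map_add, inner_add_right, part _ hS ⟨y, hy⟩ x, add_zero]
  have e2 := part _ hS.compl ⟨y, hy⟩ x
  simp only [compl_compl] at e2
  rw [e1]
  conv_lhs => rw [← E.proj_compl hS y]
  rw [inner_add_left, e2, add_zero]

end

/-! ### Second moments of the spectral measure and the resolvent -/

section

variable {H : Type*} [NormedAddCommGroup H] [InnerProductSpace ℂ H] [CompleteSpace H]
  {E : ProjMeasure H} {A : H →ₗ.[ℂ] H} {S T : Set ℝ}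

theorem ProjMeasure.IsSpectralMeasureOf.inner_proj_proj (hE : E.IsSpectralMeasureOf A)
    (hA : IsSelfAdjoint A) (hS : MeasurableSet S) (x : A.domain) :
    inner ℂ (E.proj S (x : H)) (E.proj S (A x)) = ((∫ t in S, t ∂(E.measure (x : H)) : ℝ) : ℂ) := by
  rw [← hE.map_proj hA hS, ← E.measure_proj hS]
  exact hE.2 ⟨_, hE.proj_mem hS x.2⟩

theorem inner_map_comm_of_isSelfAdjoint (hA : IsSelfAdjoint A) (x y : A.domain) :
    inner ℂ (A x) (y : H) = inner ℂ (x : H) (A y) := by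
  have h := LinearPMap.adjoint_isFormalAdjoint hA.dense_domain
  rw [LinearPMap.isSelfAdjoint_def.1 hA] at h
  exact h x y

/-- The second moment is extracted from the diagonal identity ⟨x, Ax⟩ = ∫ t alone, applied to v + y
with v = (A + n)y. The cross term of its measure is 2(t + n)μ, nonnegative because μ lives on [-n,
n]. Expanding the form then equates 2⟨v, Ay⟩ with 2∫ t(t + n) dμ. -/
theorem ProjMeasure.IsSpectralMeasureOf.norm_sq_of_bounded (hE : E.IsSpectralMeasureOf A)
    (hA : IsSelfAdjoint A) {n : ℝ} (y : A.domain)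
    (hy : E.proj (Icc (-n) n) (y : H) = y) :
    ‖A y‖ ^ 2 = ∫ t, t ^ 2 ∂(E.measure (y : H)) := by
  have hS : MeasurableSet (Icc (-n) n) := measurableSet_Icc
  set μ := E.measure (y : H) with hμ
  have hμS : μ.restrict (Icc (-n) n) = μ := by rw [hμ, ← E.measure_proj hS, hy]
  have haeS : ∀ᵐ t ∂μ, t ∈ Icc (-n) n := by
    rw [← hμS]
    exact ae_restrict_mem hS
  have hw : E.proj (Icc (-n) n) (A y) = A y := by
    have := hE.map_proj hA hS y
    rw [← this]
    congr 1
    exact Subtype.ext hy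
  have hwd : A y ∈ A.domain := by
    rw [← hw]
    exact hE.proj_mem_of_bounded hS (n := n) (fun t ht => abs_le.2 ht) _
  let v : A.domain := ⟨A y, hwd⟩ + (n : ℂ) • y
  have hv : (v : H) = A y + (n : ℂ) • (y : H) := rfl
  have hint : Integrable (fun t : ℝ => t) μ := integrable_id_of_sq (hE.integrable_sq y.2)
  have hint2 : Integrable (fun t : ℝ => t ^ 2) μ := hE.integrable_sq y.2
  have hnn : ∀ᵐ t ∂μ, 0 ≤ 2 * (t + n) := by
    filter_upwards [haeS] with t ht
    linarith [ht.1]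
  have hm : E.measure ((v + y : A.domain) : H)
      = E.measure (v : H) + μ + μ.withDensity (fun t => ENNReal.ofReal (2 * (t + n))) := by
    ext U hU
    have hint' : IntegrableOn (fun t : ℝ => 2 * (t + n)) U μ :=
      ((hint.add (integrable_const n)).const_mul 2).integrableOn
    have hnn' : 0 ≤ ∫ t in U, 2 * (t + n) ∂μ :=
      integral_nonneg_of_ae (ae_restrict_of_ae hnn)
    rw [Measure.add_apply, Measure.add_apply, hμ, E.measure_apply hU, E.measure_apply hU,
      E.measure_apply hU, withDensity_apply _ hU, ← hμ,
      ← ofReal_integral_eq_lintegral_ofReal hint' (ae_restrict_of_ae hnn),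
      ← ENNReal.ofReal_add (by positivity) (by positivity),
      ← ENNReal.ofReal_add (by positivity) hnn']
    congr 1
    have h1 := hE.inner_proj_proj hA hU y
    rw [Submodule.coe_add, map_add, @norm_add_sq ℂ]
    have h2 : RCLike.re (inner ℂ (E.proj U (v : H)) (E.proj U (y : H)))
        = ∫ t in U, (t + n) ∂μ := by
      rw [← inner_conj_symm, RCLike.conj_re, hv, map_add, map_smul, inner_add_right, h1,
        inner_smul_right, inner_self_eq_norm_sq_to_K,
        integral_add hint.integrableOn (integrable_const n), setIntegral_const, smul_eq_mul,
        hμ, E.measureReal_apply hU, mul_comm _ n]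
      simp only [map_add, RCLike.re_to_complex, Complex.ofReal_re]
      rw [add_right_inj]
      norm_cast
      exact Complex.re_ofReal_mul _ _
    rw [h2, integral_const_mul]
    ring
  have hvy := hE.integrable_sq (v + y).2
  have hvy1 := integrable_id_of_sq hvy
  have hq := hE.2 (v + y)
  rw [hm] at hvy1 hq
  have hi1 := (integrable_add_measure.1 hvy1).1
  have hi2 := (integrable_add_measure.1 hvy1).2
  rw [integral_add_measure hi1 hi2, integral_add_measure (integrable_add_measure.1 hi1).1 hint,
    integral_withDensity_eq_integral_toReal_smul (by fun_prop)
      (Eventually.of_forall fun _ => ENNReal.ofReal_lt_top)] at hq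
  have e1 : ∫ t, (ENNReal.ofReal (2 * (t + n))).toReal • t ∂μ
      = 2 * ∫ t, t ^ 2 ∂μ + 2 * n * ∫ t, t ∂μ := by
    rw [← integral_const_mul, ← integral_const_mul,
      ← integral_add (hint2.const_mul _) (hint.const_mul _)]
    refine integral_congr_ae ?_
    filter_upwards [hnn] with t ht
    rw [ENNReal.toReal_ofReal ht, smul_eq_mul]
    ring
  rw [e1, LinearPMap.map_add] at hq
  simp only [Submodule.coe_add, inner_add_left, inner_add_right, Complex.ofReal_add,
    ← hE.2 v] at hq
  rw [hμ, ← hE.2 y, ← hμ] at hq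
  have hsymm : inner ℂ (y : H) (A v) = inner ℂ (A y) (v : H) :=
    (inner_map_comm_of_isSelfAdjoint hA y v).symm
  have hvAy : inner ℂ (v : H) (A y) = ((‖A y‖ ^ 2 + n * ∫ t, t ∂μ : ℝ) : ℂ) := by
    rw [hv, inner_add_left, inner_smul_left, hE.2 y, inner_self_eq_norm_sq_to_K, ← hμ]
    simp
  have hvAy' : inner ℂ (A y) (v : H) = ((‖A y‖ ^ 2 + n * ∫ t, t ∂μ : ℝ) : ℂ) := by
    rw [← inner_conj_symm, hvAy, Complex.conj_ofReal]
  rw [hsymm, hvAy, hvAy'] at hq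
  have hq' : ((2 * (‖A y‖ ^ 2 + n * ∫ t, t ∂μ) : ℝ) : ℂ)
      = ((2 * ∫ t, t ^ 2 ∂μ + 2 * n * ∫ t, t ∂μ : ℝ) : ℂ) := by
    push_cast at hq ⊢
    linear_combination hq
  have := Complex.ofReal_injective hq'
  linarith

/-- Truncation to [-n, n] commutes with A, and both sides converge as n grows. -/
theorem ProjMeasure.IsSpectralMeasureOf.norm_sq (hE : E.IsSpectralMeasureOf A)
    (hA : IsSelfAdjoint A) (y : A.domain) :
    ‖A y‖ ^ 2 = ∫ t, t ^ 2 ∂(E.measure (y : H)) := by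
  have hU : ⋃ n : ℕ, Icc (-(n : ℝ)) n = univ := by
    refine eq_univ_of_forall fun t => ?_
    obtain ⟨n, hn⟩ := exists_nat_ge |t|
    exact mem_iUnion.2 ⟨n, abs_le.1 hn⟩
  have hmono : Monotone fun n : ℕ => Icc (-(n : ℝ)) n := fun m n h =>
    Icc_subset_Icc (by simpa using h) (by simpa using h)
  have key : ∀ n : ℕ, (E.measure (A y)).real (Icc (-(n : ℝ)) n)
      = ∫ t in Icc (-(n : ℝ)) n, t ^ 2 ∂(E.measure (y : H)) := by
    intro n
    have h1 := hE.norm_sq_of_bounded hA (n := n)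
      ⟨E.proj (Icc (-(n : ℝ)) n) y, hE.proj_mem measurableSet_Icc y.2⟩
      (E.proj_proj_self measurableSet_Icc _)
    rw [hE.map_proj hA measurableSet_Icc] at h1
    rw [E.measureReal_apply measurableSet_Icc, h1, E.measure_proj measurableSet_Icc]
  have l1 : Tendsto (fun n : ℕ => (E.measure (A y)).real (Icc (-(n : ℝ)) n)) atTop
      (𝓝 ((E.measure (A y)).real univ)) := by
    rw [← hU]
    exact (ENNReal.tendsto_toReal (measure_ne_top _ _)).comp (tendsto_measure_iUnion_atTop hmono)
  have l2 : Tendsto (fun n : ℕ => ∫ t in Icc (-(n : ℝ)) n, t ^ 2 ∂(E.measure (y : H))) atTop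
      (𝓝 (∫ t in univ, t ^ 2 ∂(E.measure (y : H)))) := by
    rw [← hU]
    exact tendsto_setIntegral_of_monotone (fun _ => measurableSet_Icc) hmono
      (hE.integrable_sq y.2).integrableOn
  simp only [key] at l1
  have := tendsto_nhds_unique l1 l2
  rwa [E.measureReal_univ, Measure.restrict_univ] at this

theorem ProjMeasure.IsSpectralMeasureOf.norm_sub_smul_sq (hE : E.IsSpectralMeasureOf A)
    (hA : IsSelfAdjoint A) (z : ℂ) (y : A.domain) :
    ‖A y - z • (y : H)‖ ^ 2 = ∫ t : ℝ, ‖(t : ℂ) - z‖ ^ 2 ∂(E.measure (y : H)) := by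
  have hint2 := hE.integrable_sq y.2
  have hint := integrable_id_of_sq hint2
  have e : ∀ t : ℝ, ‖(t : ℂ) - z‖ ^ 2 = t ^ 2 - (2 * z.re) * t + ‖z‖ ^ 2 := fun t => by
    rw [← Complex.normSq_eq_norm_sq, ← Complex.normSq_eq_norm_sq, Complex.normSq_apply,
      Complex.normSq_apply]
    simp
    ring
  simp only [e]
  rw [integral_add (f := fun t : ℝ => t ^ 2 - 2 * z.re * t) (hint2.sub (hint.const_mul _))
    (integrable_const _), integral_sub hint2 (hint.const_mul _), integral_const_mul, integral_const, smul_eq_mul,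
    E.measureReal_univ, ← hE.norm_sq hA, @norm_sub_sq ℂ, inner_smul_right, norm_smul,
    ← inner_conj_symm, hE.2 y]
  simp
  ring

theorem ProjMeasure.IsSpectralMeasureOf.measure_sub_smul (hE : E.IsSpectralMeasureOf A)
    (hA : IsSelfAdjoint A) (z : ℂ) (y : A.domain) :
    E.measure (A y - z • (y : H))
      = (E.measure (y : H)).withDensity (fun t : ℝ => ENNReal.ofReal (‖(t : ℂ) - z‖ ^ 2)) := by
  ext S hS
  have hint : Integrable (fun t : ℝ => ‖(t : ℂ) - z‖ ^ 2) (E.measure (y : H)) := by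
    have e : ∀ t : ℝ, ‖(t : ℂ) - z‖ ^ 2 = t ^ 2 - (2 * z.re) * t + ‖z‖ ^ 2 := fun t => by
      rw [← Complex.normSq_eq_norm_sq, ← Complex.normSq_eq_norm_sq, Complex.normSq_apply,
        Complex.normSq_apply]
      simp
      ring
    simp only [e]
    exact ((hE.integrable_sq y.2).sub
      ((integrable_id_of_sq (hE.integrable_sq y.2)).const_mul _)).add (integrable_const _)
  rw [withDensity_apply _ hS, ← ofReal_integral_eq_lintegral_ofReal hint.integrableOn
    (Eventually.of_forall fun t => by positivity), E.measure_apply hS, map_sub, map_smul,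
    ← hE.map_proj hA hS, ← E.measure_proj hS]
  congr 1
  exact hE.norm_sub_smul_sq hA z ⟨E.proj S (y : H), hE.proj_mem hS y.2⟩

/-- With x = Rf the measure of f = (A - z)x is |t - z|² times that of x. The integral thus becomes
that of conj(t - z), the conjugate of ⟨x, f⟩. -/
theorem ProjMeasure.IsSpectralMeasureOf.inner_resolvent (hE : E.IsSpectralMeasureOf A)
    (hA : IsSelfAdjoint A) {z : ℂ} (hz : z.im ≠ 0) {R : H →L[ℂ] H} (hR : IsResolventAt A z R)
    (f : H) : inner ℂ f (R f) = ∫ t : ℝ, ((t : ℂ) - z)⁻¹ ∂(E.measure f) := by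
  obtain ⟨hx, hf⟩ := hR.1 f
  set x : A.domain := ⟨R f, hx⟩ with hxdef
  have hfx : A x - z • (x : H) = f := hf
  have hint := integrable_id_of_sq (hE.integrable_sq x.2)
  have h1 : inner ℂ (x : H) f = ∫ t : ℝ, ((t : ℂ) - z) ∂(E.measure (x : H)) := by
    rw [integral_sub hint.ofReal (integrable_const _), integral_const,
      E.measureReal_univ, ← hfx, inner_sub_right, inner_smul_right, hE.2,
      inner_self_eq_norm_sq_to_K, integral_complex_ofReal]
    simp [mul_comm]
  have hne : ∀ t : ℝ, (t : ℂ) - z ≠ 0 := fun t e => hz (by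
    have := congrArg Complex.im e
    simpa using this)
  have h2 : ∫ t : ℝ, ((t : ℂ) - z)⁻¹ ∂(E.measure f)
      = ∫ t : ℝ, conj ((t : ℂ) - z) ∂(E.measure (x : H)) := by
    rw [← hfx, hE.measure_sub_smul hA z x, integral_withDensity_eq_integral_toReal_smul
      (by fun_prop) (by simp)]
    refine integral_congr_ae (Eventually.of_forall fun t => ?_)
    dsimp only
    rw [ENNReal.toReal_ofReal (by positivity), Complex.real_smul, ← Complex.normSq_eq_norm_sq,
      Complex.normSq_eq_conj_mul_self, mul_assoc, mul_inv_cancel₀ (hne t), mul_one]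
  rw [h2, integral_conj, ← h1, inner_conj_symm]

/-- On the range of E(ball) the operator A - s has norm at most ε, yet it is bounded below through
R. The radius is chosen so that ‖R‖ε ≤ 1/2, which forces the range to be zero. -/
theorem ProjMeasure.IsSpectralMeasureOf.measure_ball_eq_zero (hE : E.IsSpectralMeasureOf A)
    (hA : IsSelfAdjoint A) {s : ℝ} {R : H →L[ℂ] H} (hR : IsResolventAt A (s : ℂ) R) (f : H) :
    E.measure f (Metric.closedBall s (1 / (2 * (‖R‖ + 1)))) = 0 := by
  set ε : ℝ := 1 / (2 * (‖R‖ + 1)) with hε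
  have hε0 : 0 < ε := by positivity
  have hS : MeasurableSet (Metric.closedBall s ε) := measurableSet_closedBall
  rw [E.measure_apply hS]
  set y := E.proj (Metric.closedBall s ε) f with hy
  have hyd : y ∈ A.domain := hE.proj_mem_of_bounded hS (n := |s| + ε) (fun t ht => by
    rw [mem_closedBall_iff_norm, Real.norm_eq_abs] at ht
    calc |t| = |s + (t - s)| := by ring_nf
      _ ≤ |s| + |t - s| := abs_add_le _ _
      _ ≤ _ := by linarith) f
  have hRy := hR.2 ⟨y, hyd⟩
  have h1 : ‖A ⟨y, hyd⟩ - (s : ℂ) • y‖ ^ 2 ≤ (ε * ‖y‖) ^ 2 := by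
    have h2 := hE.norm_sub_smul_sq hA s ⟨y, hyd⟩
    dsimp only at h2
    rw [h2]
    have hyy : E.measure y = (E.measure y).restrict (Metric.closedBall s ε) := by
      rw [← E.measure_proj hS, hy, E.proj_proj_self hS]
    have hb : ∀ᵐ t : ℝ ∂(E.measure y), ‖(t : ℂ) - s‖ ^ 2 ≤ ε ^ 2 := by
      rw [hyy]
      filter_upwards [ae_restrict_mem hS] with t ht
      rw [mem_closedBall_iff_norm, Real.norm_eq_abs] at ht
      rw [← Complex.ofReal_sub, Complex.norm_real]
      exact pow_le_pow_left₀ (norm_nonneg _) ht 2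
    calc ∫ t : ℝ, ‖(t : ℂ) - s‖ ^ 2 ∂(E.measure y) ≤ ∫ _ : ℝ, ε ^ 2 ∂(E.measure y) :=
          integral_mono_of_nonneg (Eventually.of_forall fun _ => by positivity)
            (integrable_const _) hb
      _ = (ε * ‖y‖) ^ 2 := by
          rw [integral_const, smul_eq_mul, E.measureReal_univ]
          ring
  have h2 : ‖A ⟨y, hyd⟩ - (s : ℂ) • y‖ ≤ ε * ‖y‖ := le_of_sq_le_sq h1 (by positivity)
  have h3 : ‖y‖ ≤ ‖R‖ * (ε * ‖y‖) := by
    calc ‖y‖ = ‖R (A ⟨y, hyd⟩ - (s : ℂ) • y)‖ := by rw [hRy]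
      _ ≤ ‖R‖ * ‖A ⟨y, hyd⟩ - (s : ℂ) • y‖ := R.le_opNorm _
      _ ≤ _ := mul_le_mul_of_nonneg_left h2 (norm_nonneg _)
  have h4 : ‖R‖ * ε ≤ 1 / 2 := by
    rw [hε, mul_one_div, div_le_iff₀ (by positivity)]
    linarith [norm_nonneg R]
  have h5 : ‖y‖ = 0 := by nlinarith [norm_nonneg y]
  rw [h5]
  simp

theorem ProjMeasure.IsSpectralMeasureOf.measure_compl_eq_zero (hE : E.IsSpectralMeasureOf A)
    (hA : IsSelfAdjoint A) {I : Set ℝ}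
    (hI : unboundedSpectrum A ⊆ (fun x : ℝ => (x : ℂ)) '' I) (f : H) : E.measure f Iᶜ = 0 := by
  refine measure_null_of_locally_null _ fun s hs => ?_
  have : (s : ℂ) ∉ unboundedSpectrum A := fun h => by
    obtain ⟨t, ht, e⟩ := hI h
    have : t = s := Complex.ofReal_injective e
    exact hs (this ▸ ht)
  simp only [unboundedSpectrum, mem_ofPred_eq, not_not] at this
  obtain ⟨R, hR⟩ := this
  exact ⟨_, mem_nhdsWithin_of_mem_nhds (Metric.closedBall_mem_nhds s (by positivity)),
    hE.measure_ball_eq_zero hA hR f⟩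

end

/-! ### `K` as the density of the compressed spectral measure -/

section

variable {H₀ H₁ : Type*}
  [NormedAddCommGroup H₀] [InnerProductSpace ℂ H₀] [CompleteSpace H₀]
  [NormedAddCommGroup H₁] [InnerProductSpace ℂ H₁] [CompleteSpace H₁]
  {A₀ : H₀ →ₗ.[ℂ] H₀} {A₁ : H₁ →L[ℂ] H₁} {B : H₁ →L[ℂ] H₀} {E : ProjMeasure H₀}
  {a b : EReal} {D : Set ℂ} {K : ℂ → H₁ →L[ℂ] H₁}

theorem Setting.analyticAt_interval (hS : Setting A₀ A₁ B E a b D K) {t : ℝ}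
    (ht : t ∈ interval a b) : AnalyticAt ℂ K (t : ℂ) :=
  hS.analytic _ (Or.inl (Or.inr ⟨t, ht, rfl⟩))

theorem Setting.analyticAt_sheet (hS : Setting A₀ A₁ B E a b D K) {l : ℤˣ} {w : ℂ}
    (hw : w ∈ sheet D l) : AnalyticAt ℂ K w := by
  rcases Int.units_eq_one_or l with rfl | rfl
  · exact hS.analytic _ (Or.inr hw)
  · exact hS.analytic _ (Or.inl (Or.inl hw))

theorem Setting.continuousOn_interval (hS : Setting A₀ A₁ B E a b D K) :
    ContinuousOn (fun t : ℝ => K t) (interval a b) := fun _ ht =>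
  ((hS.analyticAt_interval ht).continuousAt.comp
    Complex.continuous_ofReal.continuousAt).continuousWithinAt

theorem inner_spectralFunctionB (u : H₁) (t : ℝ) :
    inner ℂ u (spectralFunctionB E B t u) = (((E.measure (B u)).real (Iio t) : ℝ) : ℂ) := by
  rw [E.measureReal_apply measurableSet_Iio, ← E.inner_proj_self measurableSet_Iio]
  simp only [spectralFunctionB, ContinuousLinearMap.comp_apply]
  rw [ContinuousLinearMap.adjoint_inner_right]

theorem Setting.hasDerivAt_inner (hS : Setting A₀ A₁ B E a b D K) (u : H₁) {t : ℝ}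
    (ht : t ∈ interval a b) :
    HasDerivAt (fun t => (((E.measure (B u)).real (Iio t) : ℝ) : ℂ)) (inner ℂ u (K t u)) t := by
  have h1 : HasDerivAt (fun t => spectralFunctionB E B t u) (K t u) t := by
    simpa [Function.comp_def] using
      ((ContinuousLinearMap.apply ℂ H₁ u).restrictScalars ℝ).hasFDerivAt.comp_hasDerivAt t
        (hS.hasDerivAt t ht)
  have h2 := ((innerSL ℂ u).restrictScalars ℝ).hasFDerivAt.comp_hasDerivAt t h1
  simpa only [Function.comp_def, ContinuousLinearMap.coe_restrictScalars', innerSL_apply_apply,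
    inner_spectralFunctionB] using h2

theorem Setting.hasDerivAt_measureReal (hS : Setting A₀ A₁ B E a b D K) (u : H₁) {t : ℝ}
    (ht : t ∈ interval a b) :
    HasDerivAt (fun t => (E.measure (B u)).real (Iio t)) (inner ℂ u (K t u)).re t := by
  simpa [Function.comp_def] using Complex.reCLM.hasFDerivAt.comp_hasDerivAt t (hS.hasDerivAt_inner u ht)

theorem Setting.inner_im (hS : Setting A₀ A₁ B E a b D K) (u : H₁) {t : ℝ}
    (ht : t ∈ interval a b) : (inner ℂ u (K t u)).im = 0 := by
  have := Complex.imCLM.hasFDerivAt.comp_hasDerivAt t (hS.hasDerivAt_inner u ht)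
  simp only [Function.comp_def, Complex.imCLM_apply, Complex.ofReal_im] at this
  exact this.unique (hasDerivAt_const t 0)

theorem Setting.inner_nonneg (hS : Setting A₀ A₁ B E a b D K) (u : H₁) {t : ℝ}
    (ht : t ∈ interval a b) : 0 ≤ (inner ℂ u (K t u)).re := by
  have hm : Monotone fun t => (E.measure (B u)).real (Iio t) := fun s t h =>
    measureReal_mono (Iio_subset_Iio h)
  rw [← (hS.hasDerivAt_measureReal u ht).deriv]
  exact hm.deriv_nonneg

theorem Setting.continuousOn_inner (hS : Setting A₀ A₁ B E a b D K) (u v : H₁) :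
    ContinuousOn (fun t : ℝ => inner ℂ u (K t v)) (interval a b) :=
  continuousOn_const.inner ((ContinuousLinearMap.apply ℂ H₁ v).continuous.comp_continuousOn
    hS.continuousOn_interval)

/-- The distribution function of the measure has the continuous nonnegative derivative ⟨u, K(t)u⟩ on
Δ₀, so the fundamental theorem of calculus evaluates all half-open intervals, and these determine
the measure. -/
theorem Setting.measure_restrict_Ico (hS : Setting A₀ A₁ B E a b D K) (u : H₁) {c d : ℝ}
    (hc : c ∈ interval a b) (hd : d ∈ interval a b) :
    (E.measure (B u)).restrict (Ico c d)
      = (volume.restrict (Ico c d)).withDensity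
          (fun t : ℝ => ENNReal.ofReal (inner ℂ u (K t u)).re) := by
  have hI := interval_ordConnected a b
  have hcd : Icc c d ⊆ interval a b := hI.out hc hd
  have hcont : ContinuousOn (fun t : ℝ => (inner ℂ u (K t u)).re) (interval a b) :=
    Complex.continuous_re.comp_continuousOn (hS.continuousOn_inner u u)
  have key : ∀ x y, c ≤ x → x ≤ y → y ≤ d → E.measure (B u) (Ico x y)
      = ∫⁻ t in Ico x y, ENNReal.ofReal (inner ℂ u (K t u)).re := by
    intro x y hx hxy hy
    have hsub : Icc x y ⊆ interval a b := (Icc_subset_Icc hx hy).trans hcd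
    have hint : IntervalIntegrable (fun t : ℝ => (inner ℂ u (K t u)).re) volume x y :=
      (hcont.mono (by rwa [uIcc_of_le hxy])).intervalIntegrable
    have h1 := intervalIntegral.integral_eq_sub_of_hasDerivAt (fun t ht =>
      hS.hasDerivAt_measureReal u (hsub (by rwa [uIcc_of_le hxy] at ht))) hint
    rw [intervalIntegral.integral_of_le hxy, ← integral_Ico_eq_integral_Ioc] at h1
    have hio : IntegrableOn (fun t : ℝ => (inner ℂ u (K t u)).re) (Ico x y) := by
      rw [integrableOn_Ico_iff_integrableOn_Ioo, ← integrableOn_Ioc_iff_integrableOn_Ioo]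
      exact (intervalIntegrable_iff_integrableOn_Ioc_of_le hxy).1 hint
    rw [← ofReal_integral_eq_lintegral_ofReal hio ((ae_restrict_iff' measurableSet_Ico).2
      (Eventually.of_forall fun t ht => hS.inner_nonneg u (hsub (Ico_subset_Icc_self ht)))), h1,
      ← measureReal_sdiff (Iio_subset_Iio hxy) measurableSet_Iio, Iio_sdiff_Iio, ofReal_measureReal]
  refine Measure.ext_of_Ico _ _ fun x y hxy => ?_
  rw [Measure.restrict_apply measurableSet_Ico, withDensity_apply _ measurableSet_Ico,
    Measure.restrict_restrict measurableSet_Ico, Ico_inter_Ico]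
  rcases le_or_gt (max x c) (min y d) with h | h
  · exact key _ _ (le_max_right _ _) h (min_le_right _ _)
  · rw [Ico_eq_empty_of_le h.le]
    simp

theorem Setting.measure_restrict_interval (hS : Setting A₀ A₁ B E a b D K) (u : H₁) :
    (E.measure (B u)).restrict (interval a b)
      = (volume.restrict (interval a b)).withDensity
          (fun t : ℝ => ENNReal.ofReal (inner ℂ u (K t u)).re) := by
  have hcov : interval a b = ⋃ q : {q : ℚ × ℚ // (q.1 : ℝ) ∈ interval a b ∧ (q.2 : ℝ) ∈ interval a b},
      Ico (q.1.1 : ℝ) (q.1.2 : ℝ) := by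
    ext x
    simp only [mem_iUnion, Subtype.exists, Prod.exists, exists_prop]
    constructor
    · intro hx
      obtain ⟨p, hp1, hp2⟩ := EReal.lt_iff_exists_rat_btwn.1 hx.1
      obtain ⟨q, hq1, hq2⟩ := EReal.lt_iff_exists_rat_btwn.1 hx.2
      exact ⟨p, q, ⟨⟨hp1, hp2.trans hx.2⟩, hx.1.trans hq1, hq2⟩,
        ⟨(EReal.coe_lt_coe_iff.1 hp2).le, EReal.coe_lt_coe_iff.1 hq1⟩⟩
    · rintro ⟨p, q, ⟨hp, hq⟩, hx⟩
      exact (interval_ordConnected a b).out hp hq (Ico_subset_Icc_self hx)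
  have hm := measurableSet_interval a b
  rw [← restrict_withDensity hm, hcov, Measure.restrict_iUnion_congr]
  rintro ⟨⟨p, q⟩, hp, hq⟩
  rw [restrict_withDensity measurableSet_Ico]
  exact hS.measure_restrict_Ico u hp hq

/-- No mass lies off Δ₀: the complement of its closure is in the resolvent set, and its frontier is
Lebesgue null, hence null by absolute continuity. -/
theorem Setting.measure_eq (hS : Setting A₀ A₁ B E a b D K) (u : H₁) :
    E.measure (B u) = (volume.restrict (interval a b)).withDensity
          (fun t : ℝ => ENNReal.ofReal (inner ℂ u (K t u)).re) := by
  rw [← hS.measure_restrict_interval, eq_comm, Measure.restrict_eq_self_of_ae_mem]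
  rw [ae_iff]
  have h1 : E.measure (B u) (closure (interval a b))ᶜ = 0 :=
    hS.spectralMeasure.measure_compl_eq_zero hS.selfAdjoint₀ hS.spectrum₀.subset _
  have h2 : E.measure (B u) (frontier (interval a b)) = 0 :=
    hS.absolutelyContinuous _ ((interval_ordConnected a b).convex.addHaar_frontier volume)
  refine measure_mono_null (fun t ht => ?_) (measure_union_null h1 h2)
  by_cases h : t ∈ closure (interval a b)
  · exact Or.inr ⟨h, fun h' => ht (interior_subset h')⟩
  · exact Or.inl h

theorem Setting.integrable_inner_self (hS : Setting A₀ A₁ B E a b D K) (u : H₁) :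
    IntegrableOn (fun t : ℝ => inner ℂ u (K t u)) (interval a b) := by
  have hm := measurableSet_interval a b
  have hre : IntegrableOn (fun t : ℝ => (inner ℂ u (K t u)).re) (interval a b) := by
    refine ⟨(Complex.continuous_re.comp_continuousOn
      (hS.continuousOn_inner u u)).aestronglyMeasurable hm, ?_⟩
    rw [hasFiniteIntegral_iff_ofReal ((ae_restrict_iff' hm).2
      (Eventually.of_forall fun t ht => hS.inner_nonneg u ht))]
    have h := measure_lt_top (E.measure (B u)) univ
    rwa [hS.measure_eq, withDensity_apply _ MeasurableSet.univ, Measure.restrict_univ] at h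
  refine hre.ofReal.congr ((ae_restrict_iff' hm).2 (Eventually.of_forall fun t ht => ?_))
  exact Complex.ext (by simp) (by simpa using (hS.inner_im u ht).symm)

theorem Setting.integrable_inner (hS : Setting A₀ A₁ B E a b D K) (u v : H₁) :
    IntegrableOn (fun t : ℝ => inner ℂ u (K t v)) (interval a b) := by
  have h := fun w => hS.integrable_inner_self w
  have e : (fun t : ℝ => inner ℂ u (K t v)) = fun t : ℝ =>
      (inner ℂ (u + v) (K t (u + v)) - inner ℂ (u - v) (K t (u - v))
        - Complex.I * inner ℂ (u + Complex.I • v) (K t (u + Complex.I • v))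
        + Complex.I * inner ℂ (u - Complex.I • v) (K t (u - Complex.I • v))) / 4 := by
    funext t
    have h1 := inner_map_polarization (K t : H₁ →ₗ[ℂ] H₁) u v
    simp only [ContinuousLinearMap.coe_coe] at h1
    rw [← inner_conj_symm, h1]
    simp only [map_div₀, map_add, map_sub, map_mul, inner_conj_symm, Complex.conj_I]
    rw [show conj (4 : ℂ) = 4 from map_ofNat _ 4]
    ring
  rw [e]
  exact ((((h _).sub (h _)).sub ((h _).const_mul _)).add ((h _).const_mul _)).div_const _

/-- Diagonal entries are densities of finite measures, polarization gives the other entries, and in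
finite dimension the entries dominate the operator norm. -/
theorem Setting.integrable [FiniteDimensional ℂ H₁] (hS : Setting A₀ A₁ B E a b D K) :
    IntegrableOn (fun t : ℝ => K t) (interval a b) := by
  let e := stdOrthonormalBasis ℂ H₁
  have hb : IntegrableOn (fun t : ℝ => ∑ j, ∑ i, ‖inner ℂ (e i) (K t (e j))‖) (interval a b) :=
    integrable_finsetSum _ fun j _ => integrable_finsetSum _ fun i _ => (hS.integrable_inner _ _).norm
  refine hb.mono' (hS.continuousOn_interval.aestronglyMeasurable (measurableSet_interval a b))
    (Eventually.of_forall fun t => ?_)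
  refine ContinuousLinearMap.opNorm_le_bound _ (by positivity) fun x => ?_
  have h1 : K t x = ∑ j, e.repr x j • K t (e j) := by
    conv_lhs => rw [← e.sum_repr x, map_sum]
    simp only [map_smul]
  rw [h1, Finset.sum_mul]
  refine (norm_sum_le _ _).trans (Finset.sum_le_sum fun j _ => ?_)
  rw [norm_smul, mul_comm]
  refine mul_le_mul ?_ ?_ (norm_nonneg _) (by positivity)
  · conv_lhs => rw [← e.sum_repr (K t (e j))]
    refine (norm_sum_le _ _).trans (Finset.sum_le_sum fun i _ => ?_)
    rw [norm_smul, e.norm_eq_one, mul_one, e.repr_apply_apply]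
  · rw [e.repr_apply_apply]
    exact (norm_inner_le_norm _ _).trans (by rw [e.norm_eq_one, one_mul])

theorem norm_inv_ofReal_sub_le {z : ℂ} (hz : z.im ≠ 0) (t : ℝ) :
    ‖((t : ℂ) - z)⁻¹‖ ≤ |z.im|⁻¹ := by
  rw [norm_inv]
  refine inv_anti₀ (abs_pos.2 hz) ?_
  have := Complex.abs_im_le_norm ((t : ℂ) - z)
  simpa using this

theorem Setting.integrable_resolvent_smul [FiniteDimensional ℂ H₁]
    (hS : Setting A₀ A₁ B E a b D K) {z : ℂ} (hz : z.im ≠ 0) :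
    IntegrableOn (fun t : ℝ => ((t : ℂ) - z)⁻¹ • K t) (interval a b) := by
  refine (hS.integrable.norm.const_mul |z.im|⁻¹).mono' ?_ (Eventually.of_forall fun t => ?_)
  · have : Measurable fun t : ℝ => ((t : ℂ) - z)⁻¹ := by fun_prop
    exact this.aestronglyMeasurable.smul hS.integrable.aestronglyMeasurable
  · rw [norm_smul]
    exact mul_le_mul_of_nonneg_right (norm_inv_ofReal_sub_le hz t) (norm_nonneg _)

/-- The compressed resolvent as a Cauchy integral of the density. -/
theorem Setting.adjoint_comp_resolvent_comp [FiniteDimensional ℂ H₁]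
    (hS : Setting A₀ A₁ B E a b D K) {z : ℂ} (hz : z.im ≠ 0) {R : H₀ →L[ℂ] H₀}
    (hR : IsResolventAt A₀ z R) :
    (ContinuousLinearMap.adjoint B).comp (R.comp B)
      = ∫ t : ℝ in interval a b, ((t : ℂ) - z)⁻¹ • K t := by
  have hm := measurableSet_interval a b
  have hint := hS.integrable_resolvent_smul hz
  refine ContinuousLinearMap.coe_injective ((ext_inner_map _ _).1 fun u => ?_)
  rw [← inner_conj_symm, ← inner_conj_symm (_ : H₁) u]
  congr 1
  simp only [ContinuousLinearMap.coe_coe, ContinuousLinearMap.comp_apply]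
  rw [ContinuousLinearMap.adjoint_inner_right,
    hS.spectralMeasure.inner_resolvent hS.selfAdjoint₀ hz hR, hS.measure_eq,
    integral_withDensity_eq_integral_toReal_smul₀ ?_
      (Eventually.of_forall fun _ => ENNReal.ofReal_lt_top),
    ContinuousLinearMap.integral_apply hint, ← integral_inner (hint.apply_continuousLinearMap u)]
  · refine setIntegral_congr_fun hm fun t ht => ?_
    rw [ENNReal.toReal_ofReal (hS.inner_nonneg u ht), smul_apply,
      inner_smul_right, Complex.real_smul, mul_comm]
    congr 1
    exact Complex.ext (by simp) (by simpa using (hS.inner_im u ht).symm)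
  · exact (Complex.continuous_re.comp_continuousOn
      (hS.continuousOn_inner u u)).aemeasurable hm |>.ennreal_ofReal

end

/-! ### Invertibility in finite dimension -/

section

variable {H : Type*} [NormedAddCommGroup H] [InnerProductSpace ℂ H] [FiniteDimensional ℂ H]

theorem isUnit_of_bounded_below {T : H →L[ℂ] H} {c : ℝ} (hc : 0 < c)
    (h : ∀ x, c * ‖x‖ ≤ ‖T x‖) : IsUnit T := by
  have hinj : Function.Injective (T : H →ₗ[ℂ] H) := by
    rw [← LinearMap.ker_eq_bot, LinearMap.ker_eq_bot']
    intro x hx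
    have h1 := h x
    rw [show T x = 0 from hx, norm_zero] at h1
    exact norm_le_zero_iff.1 (by nlinarith [norm_nonneg x])
  have hu : IsUnit (T : Module.End ℂ H) := (Module.End.isUnit_iff _).2
    ⟨hinj, LinearMap.injective_iff_surjective.1 hinj⟩
  have := hu.map (Module.End.toContinuousLinearMap H : Module.End ℂ H ≃ₐ[ℂ] H →L[ℂ] H)
  exact this

theorem norm_inverse_le_of_bounded_below {T : H →L[ℂ] H} {c : ℝ} (hc : 0 < c)
    (h : ∀ x, c * ‖x‖ ≤ ‖T x‖) : ‖Ring.inverse T‖ ≤ c⁻¹ := by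
  refine ContinuousLinearMap.opNorm_le_bound _ (by positivity) fun x => ?_
  have h1 := h (Ring.inverse T x)
  have h2 : T (Ring.inverse T x) = x := by
    have := congrArg (fun S : H →L[ℂ] H => S x) (Ring.mul_inverse_cancel T (isUnit_of_bounded_below hc h))
    simpa using this
  rw [h2] at h1
  rw [inv_mul_eq_div, le_div_iff₀ hc]
  linarith

theorem mem_spectrum_iff_hasEigenvalue {T : H →L[ℂ] H} {z : ℂ} :
    z ∈ spectrum ℂ T ↔ Module.End.HasEigenvalue (T : Module.End ℂ H) z := by
  rw [Module.End.hasEigenvalue_iff_mem_spectrum,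
    ← AlgEquiv.spectrum_eq (Module.End.toContinuousLinearMap H : Module.End ℂ H ≃ₐ[ℂ] H →L[ℂ] H)]
  rfl

theorem exists_eigenvector_of_mem_spectrum {T : H →L[ℂ] H} {z : ℂ} (hz : z ∈ spectrum ℂ T) :
    ∃ u : H, ‖u‖ = 1 ∧ T u = z • u := by
  obtain ⟨v, hv⟩ := (mem_spectrum_iff_hasEigenvalue.1 hz).exists_hasEigenvector
  have hv0 : ‖v‖ ≠ 0 := norm_ne_zero_iff.2 hv.2
  refine ⟨((‖v‖⁻¹ : ℝ) : ℂ) • v, ?_, ?_⟩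
  · rw [norm_smul]
    simp [hv0]
  · rw [map_smul, smul_comm]
    congr 1
    exact hv.apply_eq_smul

/-- In an eigenbasis of A₁ each coordinate is multiplied by λᵢ - μ, whose modulus is at least the
distance from μ to the spectrum. -/
theorem infDist_mul_norm_le [CompleteSpace H] {A₁ : H →L[ℂ] H} (hA : IsSelfAdjoint A₁) (μ : ℂ) (x : H) :
    Metric.infDist μ (spectrum ℂ A₁) * ‖x‖ ≤ ‖A₁ x - μ • x‖ := by
  have hsym : (A₁ : H →ₗ[ℂ] H).IsSymmetric := hA.isSymmetric
  let e := hsym.eigenvectorBasis rfl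
  let lam := hsym.eigenvalues rfl
  have hlam : ∀ i, Metric.infDist μ (spectrum ℂ A₁) ≤ ‖(lam i : ℂ) - μ‖ := fun i => by
    rw [← dist_eq_norm, dist_comm]
    exact Metric.infDist_le_dist_of_mem
      (mem_spectrum_iff_hasEigenvalue.2 (hsym.hasEigenvalue_eigenvalues rfl i))
  have hrep : ∀ i, e.repr (A₁ x - μ • x) i = ((lam i : ℂ) - μ) * e.repr x i := fun i => by
    have := hsym.eigenvectorBasis_apply_self_apply rfl x i
    rw [map_sub, map_smul]
    simp only [PiLp.sub_apply, PiLp.smul_apply, smul_eq_mul, sub_mul]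
    congr 1
  refine le_of_sq_le_sq ?_ (norm_nonneg _)
  rw [mul_pow, ← e.repr.norm_map, ← e.repr.norm_map (A₁ x - μ • x), EuclideanSpace.norm_sq_eq,
    EuclideanSpace.norm_sq_eq, Finset.mul_sum]
  refine Finset.sum_le_sum fun i _ => ?_
  rw [hrep, norm_mul, mul_pow]
  exact mul_le_mul_of_nonneg_right (pow_le_pow_left₀ Metric.infDist_nonneg (hlam i) 2) (by positivity)

theorem infDist_le_norm_of_mem_spectrum_add [CompleteSpace H] {A₁ X : H →L[ℂ] H}
    (hA : IsSelfAdjoint A₁) {z : ℂ} (hz : z ∈ spectrum ℂ (A₁ + X)) :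
    Metric.infDist z (spectrum ℂ A₁) ≤ ‖X‖ := by
  obtain ⟨u, hu, hzu⟩ := exists_eigenvector_of_mem_spectrum hz
  have h1 := infDist_mul_norm_le hA z u
  rw [add_apply] at hzu
  rw [hu, mul_one, show A₁ u - z • u = -(X u) by rw [← hzu]; abel, norm_neg] at h1
  exact h1.trans (by simpa [hu] using X.le_opNorm u)

end

/-! ### The basic equation -/

section

variable {H : Type*} [NormedAddCommGroup H] [InnerProductSpace ℂ H] [FiniteDimensional ℂ H]
  {A₁ : H →L[ℂ] H} {K : ℂ → H →L[ℂ] H} {a b : EReal} {γ : ℝ → ℂ} {d : ℝ} {X Y : H →L[ℂ] H}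

/-- The hypotheses on a contour under which the basic equation is a contraction: along `γ` the
operator `A₁ - γ(t)` is bounded below by `d`. -/
structure IsGoodContour (A₁ : H →L[ℂ] H) (K : ℂ → H →L[ℂ] H) (a b : EReal) (γ : ℝ → ℂ) (d : ℝ) :
    Prop where
  pos : 0 < d
  bound : ∀ t ∈ interval a b, ∀ x, d * ‖x‖ ≤ ‖A₁ x - γ t • x‖
  continuousOn : ContinuousOn γ (interval a b)
  continuousOn_comp : ContinuousOn (fun t => K (γ t)) (interval a b)
  integrable : IntegrableOn (fun t => ‖K (γ t)‖ * ‖deriv γ t‖) (interval a b)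

omit [FiniteDimensional ℂ H] in
theorem variation_nonneg : 0 ≤ variation K a b γ := integral_nonneg fun _ => by positivity

namespace IsGoodContour

variable (h : IsGoodContour A₁ K a b γ d)

include h

omit [FiniteDimensional ℂ H] in
theorem bounded_below {t : ℝ} (ht : t ∈ interval a b) (X : H →L[ℂ] H) (x : H) :
    (d - ‖X‖) * ‖x‖ ≤ ‖(A₁ + X - γ t • (1 : H →L[ℂ] H)) x‖ := by
  have h1 := h.bound t ht x
  have h2 : A₁ x - γ t • x = (A₁ + X - γ t • (1 : H →L[ℂ] H)) x - X x := by
    simp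
    abel
  have h3 := X.le_opNorm x
  rw [h2] at h1
  have h4 := norm_sub_le ((A₁ + X - γ t • (1 : H →L[ℂ] H)) x) (X x)
  linarith

theorem isUnit {t : ℝ} (ht : t ∈ interval a b) (hX : ‖X‖ < d) :
    IsUnit (A₁ + X - γ t • (1 : H →L[ℂ] H)) :=
  isUnit_of_bounded_below (sub_pos.2 hX) (h.bounded_below ht X)

theorem norm_inverse_le {t : ℝ} (ht : t ∈ interval a b) (hX : ‖X‖ < d) :
    ‖Ring.inverse (A₁ + X - γ t • (1 : H →L[ℂ] H))‖ ≤ (d - ‖X‖)⁻¹ :=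
  norm_inverse_le_of_bounded_below (sub_pos.2 hX) (h.bounded_below ht X)

theorem aestronglyMeasurable (hX : ‖X‖ < d) : AEStronglyMeasurable
    (fun t => deriv γ t • (K (γ t) * Ring.inverse (A₁ + X - γ t • (1 : H →L[ℂ] H))))
    (volume.restrict (interval a b)) := by
  have : CompleteSpace H := FiniteDimensional.complete ℂ H
  refine (aestronglyMeasurable_deriv γ _).smul
    ((h.continuousOn_comp.mul fun t ht => ?_).aestronglyMeasurable (measurableSet_interval a b))
  obtain ⟨U, hU⟩ := h.isUnit ht hX
  have h1 : ContinuousAt Ring.inverse (A₁ + X - γ t • (1 : H →L[ℂ] H)) :=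
    hU ▸ NormedRing.inverse_continuousAt U
  have h2 : ContinuousWithinAt (fun t => A₁ + X - γ t • (1 : H →L[ℂ] H)) (interval a b) t :=
    continuousWithinAt_const.sub ((h.continuousOn t ht).smul continuousWithinAt_const)
  exact ContinuousAt.comp_continuousWithinAt (f := fun t => A₁ + X - γ t • (1 : H →L[ℂ] H)) h1 h2

theorem integrable_transformator (hX : ‖X‖ < d) : IntegrableOn
    (fun t => deriv γ t • (K (γ t) * Ring.inverse (A₁ + X - γ t • (1 : H →L[ℂ] H))))
    (interval a b) := by
  refine (h.integrable.mul_const (d - ‖X‖)⁻¹).mono' (h.aestronglyMeasurable hX)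
    ((ae_restrict_iff' (measurableSet_interval a b)).2 (Eventually.of_forall fun t ht => ?_))
  rw [norm_smul, mul_comm]
  calc _ ≤ (‖K (γ t)‖ * ‖Ring.inverse (A₁ + X - γ t • (1 : H →L[ℂ] H))‖) * ‖deriv γ t‖ := by
        gcongr
        exact norm_mul_le _ _
    _ ≤ (‖K (γ t)‖ * (d - ‖X‖)⁻¹) * ‖deriv γ t‖ := by
        gcongr
        exact h.norm_inverse_le ht hX
    _ = _ := by ring

theorem norm_transformator_le (hX : ‖X‖ < d) :
    ‖transformator K a b γ (A₁ + X)‖ ≤ variation K a b γ * (d - ‖X‖)⁻¹ := by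
  rw [transformator, norm_neg, variation, ← integral_mul_const]
  refine norm_integral_le_of_norm_le (h.integrable.mul_const _)
    ((ae_restrict_iff' (measurableSet_interval a b)).2 (Eventually.of_forall fun t ht => ?_))
  rw [norm_smul, mul_comm]
  calc _ ≤ (‖K (γ t)‖ * ‖Ring.inverse (A₁ + X - γ t • (1 : H →L[ℂ] H))‖) * ‖deriv γ t‖ := by
        gcongr
        exact norm_mul_le _ _
    _ ≤ (‖K (γ t)‖ * (d - ‖X‖)⁻¹) * ‖deriv γ t‖ := by
        gcongr
        exact h.norm_inverse_le ht hX
    _ = _ := by ring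

theorem norm_transformator_sub_le (hX : ‖X‖ < d) (hY : ‖Y‖ < d) :
    ‖transformator K a b γ (A₁ + X) - transformator K a b γ (A₁ + Y)‖
      ≤ variation K a b γ * ((d - ‖X‖)⁻¹ * (d - ‖Y‖)⁻¹) * ‖X - Y‖ := by
  have e : transformator K a b γ (A₁ + X) - transformator K a b γ (A₁ + Y)
      = -∫ t in interval a b,
        (deriv γ t • (K (γ t) * Ring.inverse (A₁ + X - γ t • (1 : H →L[ℂ] H)))
          - deriv γ t • (K (γ t) * Ring.inverse (A₁ + Y - γ t • (1 : H →L[ℂ] H)))) := by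
    rw [integral_sub (h.integrable_transformator hX) (h.integrable_transformator hY),
      transformator, transformator]
    abel
  rw [e, norm_neg, variation, ← integral_mul_const, ← integral_mul_const]
  refine norm_integral_le_of_norm_le ((h.integrable.mul_const _).mul_const _)
    ((ae_restrict_iff' (measurableSet_interval a b)).2 (Eventually.of_forall fun t ht => ?_))
  set P := A₁ + X - γ t • (1 : H →L[ℂ] H)
  set Q := A₁ + Y - γ t • (1 : H →L[ℂ] H)
  have hPQ : Ring.inverse P - Ring.inverse Q = Ring.inverse P * (Y - X) * Ring.inverse Q := by
    have e1 := Ring.inverse_mul_cancel P (h.isUnit ht hX)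
    have e2 := Ring.mul_inverse_cancel Q (h.isUnit ht hY)
    rw [show Y - X = Q - P by simp only [P, Q]; abel, mul_sub, sub_mul, mul_assoc, e2, e1]
    simp
  rw [← smul_sub, ← mul_sub, hPQ, norm_smul, mul_comm]
  have i1 := h.norm_inverse_le ht hX
  have i2 := h.norm_inverse_le ht hY
  have p1 : 0 < (d - ‖X‖)⁻¹ := inv_pos.2 (sub_pos.2 hX)
  calc _ ≤ (‖K (γ t)‖ * ((‖Ring.inverse P‖ * ‖X - Y‖) * ‖Ring.inverse Q‖)) * ‖deriv γ t‖ := by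
        gcongr
        refine (norm_mul_le _ _).trans ?_
        gcongr
        refine (norm_mul_le _ _).trans ?_
        gcongr
        rw [norm_sub_rev X Y]
        exact norm_mul_le _ _
    _ ≤ (‖K (γ t)‖ * (((d - ‖X‖)⁻¹ * ‖X - Y‖) * (d - ‖Y‖)⁻¹)) * ‖deriv γ t‖ := by
        gcongr
    _ = _ := by ring

end IsGoodContour

/-- The smaller root of `r (d - r) = V`. -/
theorem small_root {d V : ℝ} (hd : 0 < d) (hV : 0 ≤ V) (h : V < 1 / 4 * d ^ 2) :
    0 ≤ d / 2 - √(d ^ 2 / 4 - V) ∧ d / 2 - √(d ^ 2 / 4 - V) < d / 2 ∧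
      (d / 2 - √(d ^ 2 / 4 - V)) * (d - (d / 2 - √(d ^ 2 / 4 - V))) = V := by
  have h1 : 0 < d ^ 2 / 4 - V := by linarith
  have h2 := Real.sqrt_pos.2 h1
  have h3 := Real.sq_sqrt h1.le
  refine ⟨?_, by linarith, by nlinarith⟩
  have : √(d ^ 2 / 4 - V) ≤ d / 2 := by
    rw [show d / 2 = √((d / 2) ^ 2) from (Real.sqrt_sq (by linarith)).symm]
    exact Real.sqrt_le_sqrt (by nlinarith)
  linarith

namespace IsGoodContour

variable {r : ℝ} (h : IsGoodContour A₁ K a b γ d)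

include h

/-- Since V = r(d - r), the ball of radius r is preserved and the Lipschitz constant is V/(d - r)² =
r/(d - r) < 1. The parameter `s` provides the path from X = 0 to the solution. -/
theorem exists_fixedPoint (hr0 : 0 ≤ r) (hrd : r < d / 2) (hr : r * (d - r) = variation K a b γ)
    {s : ℝ} (hs : s ∈ Icc (0 : ℝ) 1) :
    ∃ X : H →L[ℂ] H, ‖X‖ ≤ r ∧ X = s • transformator K a b γ (A₁ + X) := by
  have : CompleteSpace H := FiniteDimensional.complete ℂ H
  have hd := h.pos
  have hdr : 0 < d - r := by linarith
  have hV := variation_nonneg (K := K) (a := a) (b := b) (γ := γ)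
  let f : (H →L[ℂ] H) → (H →L[ℂ] H) := fun X => s • transformator K a b γ (A₁ + X)
  let B := Metric.closedBall (0 : H →L[ℂ] H) r
  have hmaps : MapsTo f B B := by
    intro X hX
    rw [mem_closedBall_zero_iff] at hX ⊢
    have h1 := h.norm_transformator_le (X := X) (by linarith)
    have h2 : (d - ‖X‖)⁻¹ ≤ (d - r)⁻¹ := inv_anti₀ hdr (by linarith)
    have h3 : ‖transformator K a b γ (A₁ + X)‖ ≤ r := by
      refine h1.trans ((mul_le_mul_of_nonneg_left h2 hV).trans ?_)
      rw [← hr, mul_assoc, mul_inv_cancel₀ hdr.ne', mul_one]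
    simp only [f]
    rw [norm_smul, Real.norm_eq_abs, abs_of_nonneg hs.1]
    nlinarith [hs.2, norm_nonneg (transformator K a b γ (A₁ + X))]
  have hq : r * (d - r)⁻¹ < 1 := by
    rw [mul_inv_lt_iff₀ hdr]
    linarith
  have hq0 : 0 ≤ r * (d - r)⁻¹ := by positivity
  have hc : ContractingWith ⟨r * (d - r)⁻¹, hq0⟩ (hmaps.restrict f B B) := by
    refine ⟨hq, LipschitzWith.of_dist_le_mul ?_⟩
    rintro ⟨X, hX⟩ ⟨Y, hY⟩
    rw [mem_closedBall_zero_iff] at hX hY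
    have h1 := h.norm_transformator_sub_le (X := X) (Y := Y) (by linarith) (by linarith)
    have h2 : (d - ‖X‖)⁻¹ ≤ (d - r)⁻¹ := inv_anti₀ hdr (by linarith)
    have h3 : (d - ‖Y‖)⁻¹ ≤ (d - r)⁻¹ := inv_anti₀ hdr (by linarith)
    have h4 : 0 ≤ (d - ‖X‖)⁻¹ := inv_nonneg.2 (by linarith)
    have h5 : 0 ≤ (d - ‖Y‖)⁻¹ := inv_nonneg.2 (by linarith)
    rw [Subtype.dist_eq, Subtype.dist_eq, dist_eq_norm, dist_eq_norm]
    simp only [MapsTo.val_restrict_apply, f]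
    change _ ≤ (r * (d - r)⁻¹) * ‖X - Y‖
    rw [← smul_sub, norm_smul, Real.norm_eq_abs, abs_of_nonneg hs.1]
    calc _ ≤ 1 * ‖transformator K a b γ (A₁ + X) - transformator K a b γ (A₁ + Y)‖ := by
          gcongr
          exact hs.2
      _ ≤ variation K a b γ * ((d - r)⁻¹ * (d - r)⁻¹) * ‖X - Y‖ := by
          rw [one_mul]
          refine h1.trans ?_
          gcongr
      _ = _ := by
          rw [← hr]
          field_simp
  obtain ⟨X, hX, hfix, -⟩ := ContractingWith.exists_fixedPoint' Metric.isClosed_closedBall.isComplete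
    hmaps hc (x := 0) (by simpa [B] using hr0) (edist_ne_top _ _)
  exact ⟨X, mem_closedBall_zero_iff.1 hX, hfix.symm⟩

/-- From r < d/2 follows V = r(d - r) ≤ (d - r)², so d - ‖X‖ ≥ √V, while d - ‖Y‖ > √V. The Lipschitz
quotient V/((d - ‖X‖)(d - ‖Y‖)) is therefore below one. -/
theorem eq_of_fixedPoint (hr0 : 0 ≤ r) (hrd : r < d / 2) (hr : r * (d - r) = variation K a b γ)
    (hX : ‖X‖ ≤ r) (hXe : X = transformator K a b γ (A₁ + X))
    (hY : ‖Y‖ < d - √(variation K a b γ)) (hYe : Y = transformator K a b γ (A₁ + Y)) : Y = X := by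
  have hd := h.pos
  have hV := variation_nonneg (K := K) (a := a) (b := b) (γ := γ)
  have hdr : 0 < d - r := by linarith
  have hs := Real.sqrt_nonneg (variation K a b γ)
  have hss := Real.sq_sqrt hV
  have h1 := h.norm_transformator_sub_le (X := Y) (Y := X) (by linarith) (by linarith)
  rw [← hXe, ← hYe] at h1
  by_contra hne
  have hpos : 0 < ‖Y - X‖ := norm_pos_iff.2 (sub_ne_zero.2 hne)
  have h2 : √(variation K a b γ) ≤ d - r := by
    refine Real.sqrt_le_iff.2 ⟨hdr.le, ?_⟩
    rw [← hr]
    nlinarith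
  have pX : 0 < d - ‖X‖ := by linarith
  have pY : 0 < d - ‖Y‖ := by linarith
  have h3 : variation K a b γ < (d - ‖Y‖) * (d - ‖X‖) := by
    rw [← hss, sq]
    nlinarith
  rw [← mul_inv, ← div_eq_mul_inv] at h1
  have h4 : variation K a b γ / ((d - ‖Y‖) * (d - ‖X‖)) < 1 := (div_lt_one (by positivity)).2 h3
  nlinarith

/-- Changing the parameter moves the map by at most r|s - s'|; absorbing the contraction term
multiplies this by (1 - r/(d - r))⁻¹ = (d - r)/(d - 2r). -/
theorem norm_fixedPoint_sub_le (hr0 : 0 ≤ r) (hrd : r < d / 2)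
    (hr : r * (d - r) = variation K a b γ) {s s' : ℝ} (hs : s ∈ Icc (0 : ℝ) 1)
    (hX : ‖X‖ ≤ r) (hXe : X = s • transformator K a b γ (A₁ + X))
    (hY : ‖Y‖ ≤ r) (hYe : Y = s' • transformator K a b γ (A₁ + Y)) :
    ‖X - Y‖ ≤ r * (d - r) / (d - 2 * r) * |s - s'| := by
  have hd := h.pos
  have hV := variation_nonneg (K := K) (a := a) (b := b) (γ := γ)
  have hdr : 0 < d - r := by linarith
  have hdr2 : 0 < d - 2 * r := by linarith
  have h1 := h.norm_transformator_sub_le (X := X) (Y := Y) (by linarith) (by linarith)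
  have h0 := h.norm_transformator_le (X := Y) (by linarith)
  have h2 : (d - ‖X‖)⁻¹ ≤ (d - r)⁻¹ := inv_anti₀ hdr (by linarith)
  have h3 : (d - ‖Y‖)⁻¹ ≤ (d - r)⁻¹ := inv_anti₀ hdr (by linarith)
  have h4 : 0 ≤ (d - ‖X‖)⁻¹ := inv_nonneg.2 (by linarith)
  have h5 : 0 ≤ (d - ‖Y‖)⁻¹ := inv_nonneg.2 (by linarith)
  have k0 : ‖transformator K a b γ (A₁ + Y)‖ ≤ r := by
    refine h0.trans ((mul_le_mul_of_nonneg_left h3 hV).trans ?_)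
    rw [← hr, mul_assoc, mul_inv_cancel₀ hdr.ne', mul_one]
  have k1 : ‖transformator K a b γ (A₁ + X) - transformator K a b γ (A₁ + Y)‖
      ≤ r / (d - r) * ‖X - Y‖ := by
    calc _ ≤ variation K a b γ * ((d - r)⁻¹ * (d - r)⁻¹) * ‖X - Y‖ := by
          refine h1.trans ?_
          gcongr
      _ = _ := by
          rw [← hr]
          field_simp
  have e : X - Y = s • (transformator K a b γ (A₁ + X) - transformator K a b γ (A₁ + Y))
      + (s - s') • transformator K a b γ (A₁ + Y) := by
    conv_lhs => rw [hXe, hYe]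
    module
  have k2 : ‖X - Y‖ ≤ r / (d - r) * ‖X - Y‖ + |s - s'| * r := by
    conv_lhs => rw [e]
    refine (norm_add_le _ _).trans (add_le_add ?_ ?_)
    · rw [norm_smul, Real.norm_eq_abs, abs_of_nonneg hs.1]
      exact (mul_le_of_le_one_left (norm_nonneg _) hs.2).trans k1
    · rw [norm_smul, Real.norm_eq_abs]
      exact mul_le_mul_of_nonneg_left k0 (abs_nonneg _)
  have k3 : (d - 2 * r) * ‖X - Y‖ ≤ (d - r) * (|s - s'| * r) := by
    have := mul_le_mul_of_nonneg_left k2 hdr.le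
    have e2 : (d - r) * (r / (d - r) * ‖X - Y‖ + |s - s'| * r)
        = r * ‖X - Y‖ + (d - r) * (|s - s'| * r) := by
      field_simp
    rw [e2] at this
    linarith
  rw [div_mul_eq_mul_div, le_div_iff₀ hdr2]
  linarith

end IsGoodContour

end

/-! ### Admissible contours -/

section

variable {V : Type*} [NormedAddCommGroup V] [NormedSpace ℂ V] {K : ℂ → V} {a b : EReal}
  {D' σ : Set ℂ} {γ : ℝ → ℂ}

omit [NormedSpace ℂ V] in
theorem IsAdmissibleContour.mem (hγ : IsAdmissibleContour K a b D' γ) {t : ℝ}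
    (ht : t ∈ interval a b) : γ t ∈ D' := by
  obtain ⟨h, -, -, h1, hD, -, -⟩ := hγ.deformation
  rw [← h1 t ht]
  exact hD 1 ⟨one_pos, le_rfl⟩ t ht

omit [NormedSpace ℂ V] in
theorem IsAdmissibleContour.continuousOn (hγ : IsAdmissibleContour K a b D' γ) :
    ContinuousOn γ (interval a b) := by
  obtain ⟨C, hC⟩ := hγ.lipschitz
  exact hC.continuousOn

omit [NormedSpace ℂ V] in
theorem DeformationEnd.tendsto_one {h : ℝ × ℝ → ℂ} {e : EReal} {F : Filter ℝ}
    (hF : DeformationEnd K h e F) {r : ℝ} (hr : e = r) :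
    Tendsto (fun t => h (1, t)) F (𝓝 (r : ℂ)) := by
  refine (hF.1 r hr).comp (tendsto_prod_iff'.2 ⟨?_, tendsto_id⟩)
  exact tendsto_principal.2 (Eventually.of_forall fun _ => ⟨zero_le_one, le_rfl⟩)

theorem contourDist_le (σ : Set ℂ) {t : ℝ} (ht : t ∈ interval a b) :
    contourDist a b γ σ ≤ Metric.infDist (γ t) σ :=
  ciInf_le (f := fun t : interval a b => Metric.infDist (γ t) σ)
    ⟨0, by rintro _ ⟨t, rfl⟩; exact Metric.infDist_nonneg⟩ ⟨t, ht⟩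

theorem contourDist_nonneg (σ : Set ℂ) : 0 ≤ contourDist a b γ σ :=
  Real.iInf_nonneg fun _ => Metric.infDist_nonneg

omit [NormedSpace ℂ V] in
-- The contour runs into every finite end point, so that end is a limit of points at distance at
-- least d from σ.
theorem IsAdmissibleContour.contourDist_le_infDist_end (hγ : IsAdmissibleContour K a b D' γ)
    (hab : a < b) (σ : Set ℂ) {r : ℝ} (hr : a = r ∨ b = r) :
    contourDist a b γ σ ≤ Metric.infDist (r : ℂ) σ := by
  obtain ⟨h, -, -, h1, -, ha, hb⟩ := hγ.deformation
  have key : ∀ F : Filter ℝ, F.NeBot → interval a b ∈ F →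
      Tendsto (fun t => h (1, t)) F (𝓝 (r : ℂ)) → contourDist a b γ σ ≤ Metric.infDist (r : ℂ) σ := by
    intro F _ hmem hF
    refine ge_of_tendsto ((Metric.continuous_infDist_pt σ).continuousAt.tendsto.comp hF) ?_
    filter_upwards [hmem] with t ht
    simpa [h1 t ht] using contourDist_le σ ht
  rcases hr with hr | hr
  · exact key _ (isEndFilter_lowerEnd hab).neBot (isEndFilter_lowerEnd hab).mem (ha.tendsto_one hr)
  · exact key _ (isEndFilter_upperEnd hab).neBot (isEndFilter_upperEnd hab).mem (hb.tendsto_one hr)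

omit [NormedSpace ℂ V] in
/-- Real points closer to `σ ⊆ (a, b)` than the contour lie in `(a, b)`. -/
theorem IsAdmissibleContour.mem_interval (hγ : IsAdmissibleContour K a b D' γ) (hab : a < b)
    (hσ : σ ⊆ (fun x : ℝ => (x : ℂ)) '' interval a b) (hne : σ.Nonempty) {x : ℝ}
    (hx : Metric.infDist (x : ℂ) σ < contourDist a b γ σ) : x ∈ interval a b := by
  obtain ⟨_, hy, hxy⟩ := (Metric.infDist_lt_iff hne).1 hx
  obtain ⟨y, hyI, rfl⟩ := hσ hy
  have key : ∀ r : ℝ, (a = r ∨ b = r) → |x - y| < |r - y| := by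
    intro r hr
    have h1 := (hγ.contourDist_le_infDist_end hab σ hr).trans (Metric.infDist_le_dist_of_mem hy)
    rw [Complex.dist_eq, ← Complex.ofReal_sub, Complex.norm_real, Real.norm_eq_abs] at h1 hxy
    exact hxy.trans_le h1
  refine ⟨?_, ?_⟩
  · by_contra! hxa
    have h1 := hyI.1
    induction a using EReal.rec with
    | bot => simp at hxa
    | top => simp at h1
    | coe r =>
      have h2 := key r (Or.inl rfl)
      rw [EReal.coe_le_coe_iff] at hxa
      rw [EReal.coe_lt_coe_iff] at h1
      rw [abs_of_neg (by linarith), abs_of_neg (by linarith)] at h2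
      linarith
  · by_contra! hxb
    have h1 := hyI.2
    induction b using EReal.rec with
    | bot => simp at h1
    | top => simp at hxb
    | coe r =>
      have h2 := key r (Or.inr rfl)
      rw [EReal.coe_le_coe_iff] at hxb
      rw [EReal.coe_lt_coe_iff] at h1
      rw [abs_of_pos (by linarith), abs_of_pos (by linarith)] at h2
      linarith

/-- The Cauchy transform of `K` along the contour. -/
noncomputable def cauchyTransform (K : ℂ → V) (a b : EReal) (γ : ℝ → ℂ) (z : ℂ) : V :=
  ∫ t in interval a b, (deriv γ t * (γ t - z)⁻¹) • K (γ t)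

end

/-! ### Deforming operator integrals to the interval -/

section

variable {H₀ H₁ : Type*}
  [NormedAddCommGroup H₀] [InnerProductSpace ℂ H₀] [CompleteSpace H₀]
  [NormedAddCommGroup H₁] [InnerProductSpace ℂ H₁] [CompleteSpace H₁] [FiniteDimensional ℂ H₁]
  {A₀ : H₀ →ₗ.[ℂ] H₀} {A₁ : H₁ →L[ℂ] H₁} {B : H₁ →L[ℂ] H₀} {E : ProjMeasure H₀}
  {a b : EReal} {D : Set ℂ} {K : ℂ → H₁ →L[ℂ] H₁} {l : ℤˣ} {γ : ℝ → ℂ}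

omit [FiniteDimensional ℂ H₁] in
theorem Setting.continuousOn_comp (hS : Setting A₀ A₁ B E a b D K)
    (hγ : IsAdmissibleContour K a b (sheet D l) γ) :
    ContinuousOn (fun t => K (γ t)) (interval a b) := fun t ht =>
  (hS.analyticAt_sheet (hγ.mem ht)).continuousAt.comp_continuousWithinAt (hγ.continuousOn t ht)

theorem Setting.isGoodContour (hS : Setting A₀ A₁ B E a b D K)
    (hγ : IsAdmissibleContour K a b (sheet D l) γ)
    (hlt : variation K a b γ < 1 / 4 * contourDist a b γ (spectrum ℂ A₁) ^ 2) :
    IsGoodContour A₁ K a b γ (contourDist a b γ (spectrum ℂ A₁)) where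
  pos := (contourDist_nonneg _).lt_of_ne fun h => by
    rw [← h] at hlt
    linarith [variation_nonneg (K := K) (a := a) (b := b) (γ := γ)]
  bound t ht x := (mul_le_mul_of_nonneg_right (contourDist_le _ ht) (norm_nonneg x)).trans
    (infDist_mul_norm_le hS.selfAdjoint₁ _ x)
  continuousOn := hγ.continuousOn
  continuousOn_comp := hS.continuousOn_comp hγ
  integrable := hγ.finite_variation

/-- Deformation of the contour to the real interval. -/
theorem Setting.contour_integral_eq (hS : Setting A₀ A₁ B E a b D K)
    (hγ : IsAdmissibleContour K a b (sheet D l) γ) {R : ℂ → H₁ →L[ℂ] H₁} {M : ℝ}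
    (hR : ∀ w : ℂ, 0 ≤ ((l : ℤ) : ℝ) * w.im → AnalyticAt ℂ R w)
    (hM : ∀ w : ℂ, 0 ≤ ((l : ℤ) : ℝ) * w.im → ‖R w‖ ≤ M) :
    ∫ t in interval a b, deriv γ t • (K (γ t) * R (γ t))
      = ∫ t : ℝ in interval a b, K t * R t := by
  have hm := measurableSet_interval a b
  have hsh : ∀ w ∈ sheet D l, 0 ≤ ((l : ℤ) : ℝ) * w.im := fun w hw =>
    (sheet_im_pos hS.lowerHalfPlane hw).le
  have hre : ∀ t : ℝ, 0 ≤ ((l : ℤ) : ℝ) * (t : ℂ).im := fun t => by simp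
  have hM0 : 0 ≤ M := (norm_nonneg _).trans (hM 0 (by simp))
  have i1 : IntegrableOn (fun t => deriv γ t • (K (γ t) * R (γ t))) (interval a b) := by
    refine (hγ.finite_variation.mul_const M).mono' ((aestronglyMeasurable_deriv γ _).smul
      ((((hS.continuousOn_comp hγ).mul fun t ht => ?_)).aestronglyMeasurable hm))
      ((ae_restrict_iff' hm).2 (Eventually.of_forall fun t ht => ?_))
    · exact (hR _ (hsh _ (hγ.mem ht))).continuousAt.comp_continuousWithinAt (hγ.continuousOn t ht)
    · rw [norm_smul, mul_comm, mul_right_comm]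
      gcongr
      exact (norm_mul_le _ _).trans (by gcongr; exact hM _ (hsh _ (hγ.mem ht)))
  have i2 : IntegrableOn (fun t : ℝ => K t * R t) (interval a b) := by
    refine (hS.integrable.norm.mul_const M).mono'
      ((hS.continuousOn_interval.mul fun t ht => ?_).aestronglyMeasurable hm)
      (Eventually.of_forall fun t => ?_)
    · exact ((hR _ (hre t)).continuousAt.comp
        Complex.continuous_ofReal.continuousAt).continuousWithinAt
    · exact (norm_mul_le _ _).trans (by gcongr; exact hM _ (hre t))
  ext y
  refine ext_inner_left ℂ fun x => ?_
  rw [ContinuousLinearMap.integral_apply i1, ContinuousLinearMap.integral_apply i2,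
    ← integral_inner (i1.apply_continuousLinearMap y),
    ← integral_inner (i2.apply_continuousLinearMap y)]
  have hG : ∀ w, AnalyticAt ℂ K w → 0 ≤ ((l : ℤ) : ℝ) * w.im →
      AnalyticAt ℂ (fun w => inner ℂ x ((K w * R w) y)) w := fun w hK hw => by
    have h1 : AnalyticAt ℂ (fun w => K w * R w) w := hK.mul (hR w hw)
    exact ((innerSL ℂ x).comp (ContinuousLinearMap.apply ℂ H₁ y)).analyticAt _ |>.comp h1
  have key := contour_integral_eq_scalar (l := l) (G := fun w => inner ℂ x ((K w * R w) y))
    (M := ‖x‖ * (M * ‖y‖))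
    hS.lt hS.lowerHalfPlane hS.boundary (fun t ht => hS.analyticAt_interval ht) hS.endBound hγ
    hS.integrable (fun w hw => hG w (hS.analyticAt_sheet hw) (hsh w hw))
    (fun t ht => hG t (hS.analyticAt_interval ht) (hre t)) (fun w hw => by
      refine (norm_inner_le_norm _ _).trans ?_
      rw [mul_assoc]
      gcongr
      refine ((K w * R w).le_opNorm y).trans ?_
      rw [mul_right_comm]
      gcongr
      refine (norm_mul_le _ _).trans ?_
      rw [mul_comm]
      gcongr
      exact hM w hw)
  rw [← key]
  refine integral_congr_ae (Eventually.of_forall fun t => ?_)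
  simp [inner_smul_right]

theorem le_norm_sub_of_im {w z : ℂ} (hz : ((l : ℤ) : ℝ) * z.im < 0)
    (hw : 0 ≤ ((l : ℤ) : ℝ) * w.im) : |z.im| ≤ ‖w - z‖ := by
  refine le_trans ?_ (Complex.abs_im_le_norm (w - z))
  rw [Complex.sub_im]
  rcases Int.units_eq_one_or l with rfl | rfl
  · simp only [Units.val_one, Int.cast_one, one_mul] at hz hw
    rw [abs_of_neg hz, abs_of_nonneg (by linarith)]
    linarith
  · simp only [Units.val_neg, Units.val_one, Int.cast_neg, Int.cast_one, neg_mul, one_mul] at hz hw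
    rw [abs_of_pos (by linarith), abs_of_nonpos (by linarith)]
    linarith

/-- The deformation sweeps only the closed half plane on the side of the sheet, while the pole z
lies strictly on the other side. -/
theorem Setting.cauchyTransform_eq (hS : Setting A₀ A₁ B E a b D K)
    (hγ : IsAdmissibleContour K a b (sheet D l) γ) {z : ℂ} (hz : ((l : ℤ) : ℝ) * z.im < 0) :
    cauchyTransform K a b γ z = ∫ t : ℝ in interval a b, ((t : ℂ) - z)⁻¹ • K t := by
  have hz0 : 0 < |z.im| := abs_pos.2 fun h => by simp [h] at hz
  have h := hS.contour_integral_eq hγ (R := fun w => (w - z)⁻¹ • (1 : H₁ →L[ℂ] H₁))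
    (M := |z.im|⁻¹ * ‖(1 : H₁ →L[ℂ] H₁)‖) (fun w hw => ?_) (fun w hw => ?_)
  · simp only [mul_smul_comm, mul_one, smul_smul] at h
    exact h
  · have h1 := le_norm_sub_of_im hz hw
    have h2 : w - z ≠ 0 := norm_pos_iff.1 (hz0.trans_le h1)
    exact ((analyticAt_id.sub analyticAt_const).inv h2).smul analyticAt_const
  · rw [norm_smul, norm_inv]
    gcongr
    exact le_norm_sub_of_im hz hw

/-- Points within r < d of σ(A₁) stay at distance at least d - r from the contour. The transform
along Γ is therefore continuous across the real axis there, unlike the integral over the interval.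
-/
theorem Setting.continuousOn_cauchyTransform (hS : Setting A₀ A₁ B E a b D K)
    (hγ : IsAdmissibleContour K a b (sheet D l) γ) {r : ℝ}
    (hr : r < contourDist a b γ (spectrum ℂ A₁)) :
    ContinuousOn (cauchyTransform K a b γ) {z | Metric.infDist z (spectrum ℂ A₁) ≤ r} := by
  have hm := measurableSet_interval a b
  set d := contourDist a b γ (spectrum ℂ A₁)
  have hb : ∀ z ∈ {z | Metric.infDist z (spectrum ℂ A₁) ≤ r}, ∀ t ∈ interval a b,
      d - r ≤ ‖γ t - z‖ := by
    intro z hz t ht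
    have h1 := Metric.infDist_le_infDist_add_dist (s := spectrum ℂ A₁) (x := γ t) (y := z)
    have h2 := contourDist_le (γ := γ) (spectrum ℂ A₁) ht
    rw [dist_eq_norm] at h1
    have h3 : Metric.infDist z (spectrum ℂ A₁) ≤ r := hz
    linarith
  refine continuousOn_of_dominated (bound := fun t => (d - r)⁻¹ * (‖K (γ t)‖ * ‖deriv γ t‖))
    (fun z hz => ?_) (fun z hz => ?_) (hγ.finite_variation.const_mul _) ?_
  · refine AEStronglyMeasurable.smul ((aestronglyMeasurable_deriv γ _).mul ?_)
      ((hS.continuousOn_comp hγ).aestronglyMeasurable hm)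
    exact ((hγ.continuousOn.sub continuousOn_const).inv₀ fun t ht =>
      norm_pos_iff.1 ((sub_pos.2 hr).trans_le (hb z hz t ht))).aestronglyMeasurable hm
  · refine (ae_restrict_iff' hm).2 (Eventually.of_forall fun t ht => ?_)
    rw [norm_smul, norm_mul, norm_inv]
    calc _ = ‖γ t - z‖⁻¹ * (‖K (γ t)‖ * ‖deriv γ t‖) := by ring
      _ ≤ _ :=
        mul_le_mul_of_nonneg_right (inv_anti₀ (sub_pos.2 hr) (hb z hz t ht)) (by positivity)
  · refine (ae_restrict_iff' hm).2 (Eventually.of_forall fun t ht => ?_)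
    exact (continuousOn_const.mul ((continuousOn_const.sub continuousOn_id).inv₀ fun z hz =>
      norm_pos_iff.1 ((sub_pos.2 hr).trans_le (hb z hz t ht)))).smul continuousOn_const

end

/-! ### Eigenvalues cannot cross the real axis -/

section

variable {H : Type*} [NormedAddCommGroup H] [InnerProductSpace ℂ H] [FiniteDimensional ℂ H]

/-- The determinant is the product of z - w over the eigenvalues w. The bound turns the location of
the spectrum into a condition that is closed in the operator. -/
theorem pow_finrank_le_norm_det {T : H →L[ℂ] H} {z : ℂ} {η : ℝ} (hη : 0 ≤ η)
    (h : ∀ w ∈ spectrum ℂ T, η ≤ ‖z - w‖) :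
    η ^ Module.finrank ℂ H ≤ ‖(z • (1 : H →L[ℂ] H) - T).det‖ := by
  have h1 : (z • (1 : H →L[ℂ] H) - T).det = (T : Module.End ℂ H).charpoly.eval z := by
    rw [LinearMap.eval_charpoly]
    rfl
  have hs := IsAlgClosed.splits (T : Module.End ℂ H).charpoly
  rw [h1, hs.eval_eq_prod_roots_of_monic (LinearMap.charpoly_monic _), ← LinearMap.charpoly_natDegree
    (T : Module.End ℂ H), hs.natDegree_eq_card_roots]
  have hroots : ∀ w ∈ (T : Module.End ℂ H).charpoly.roots, η ≤ ‖z - w‖ := fun w hw => h w <|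
    mem_spectrum_iff_hasEigenvalue.2 <| (Module.End.hasEigenvalue_iff_isRoot_charpoly _ _).2
      (Polynomial.isRoot_of_mem_roots hw)
  generalize (T : Module.End ℂ H).charpoly.roots = S at hroots
  induction S using Multiset.induction with
  | empty => simp
  | cons w S ih =>
    rw [Multiset.card_cons, pow_succ', Multiset.map_cons, Multiset.prod_cons, norm_mul]
    exact mul_le_mul (hroots w (Multiset.mem_cons_self _ _))
      (ih fun v hv => hroots v (Multiset.mem_cons_of_mem hv)) (by positivity) (norm_nonneg _)

theorem det_eq_zero_of_mem_spectrum {T : H →L[ℂ] H} {z : ℂ} (hz : z ∈ spectrum ℂ T) :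
    (z • (1 : H →L[ℂ] H) - T).det = 0 := by
  have h1 : (z • (1 : H →L[ℂ] H) - T).det = (T : Module.End ℂ H).charpoly.eval z := by
    rw [LinearMap.eval_charpoly]
    rfl
  rw [h1]
  exact (Module.End.hasEigenvalue_iff_isRoot_charpoly _ _).1 (mem_spectrum_iff_hasEigenvalue.1 hz)

/-- If the eigenvalues of a continuous path of operators start in a closed half plane and avoid a
strip adjacent to its boundary, then they stay in the half plane. -/
theorem spectrum_im_neg_of_path {Z : ℝ → H →L[ℂ] H} (hZ : ContinuousOn Z (Icc 0 1)) {c δ : ℝ}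
    (hδ : 0 < δ) (h0 : ∀ z ∈ spectrum ℂ (Z 0), c * z.im ≤ 0)
    (hstrip : ∀ s ∈ Ioc (0 : ℝ) 1, ∀ z ∈ spectrum ℂ (Z s), 0 ≤ c * z.im → δ ≤ c * z.im)
    (hc : |c| = 1) :
    ∀ z ∈ spectrum ℂ (Z 1), c * z.im < 0 := by
  let A : Set ℝ := {s | ∀ z ∈ spectrum ℂ (Z s), c * z.im ≤ 0}
  have hclosed : IsClosed (A ∩ Icc 0 1) := by
    -- Membership in A means |det(z - Z_s)| ≥ (c Im z)ⁿ for all z with c Im z ≥ 0: an eigenvalue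
    -- with c Im z > 0 would make the left side vanish.
    have e : A ∩ Icc 0 1 = ⋂ z : {z : ℂ // 0 ≤ c * z.im}, Icc 0 1 ∩
        (fun s => ‖((z : ℂ) • (1 : H →L[ℂ] H) - Z s).det‖) ⁻¹'
          Ici ((c * (z : ℂ).im) ^ Module.finrank ℂ H) := by
      refine Subset.antisymm (fun s hs => mem_iInter.2 fun z => ⟨hs.2, ?_⟩) fun s hs => ?_
      · refine pow_finrank_le_norm_det z.2 fun w hw => ?_
        have h1 := Complex.abs_im_le_norm ((z : ℂ) - w)
        have h2 : |c * ((z : ℂ) - w).im| = |((z : ℂ) - w).im| := by rw [abs_mul, hc, one_mul]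
        have h3 := le_abs_self (c * ((z : ℂ) - w).im)
        rw [Complex.sub_im, mul_sub] at h3
        have h4 := hs.1 w hw
        rw [Complex.sub_im, mul_sub] at h2
        rw [Complex.sub_im] at h1
        linarith
      · rw [mem_iInter] at hs
        refine ⟨fun z hz => ?_, (hs ⟨0, by simp⟩).1⟩
        by_contra! h
        have h1 : (c * z.im) ^ Module.finrank ℂ H ≤ ‖(z • (1 : H →L[ℂ] H) - Z s).det‖ :=
          (hs ⟨z, h.le⟩).2
        rw [det_eq_zero_of_mem_spectrum hz, norm_zero] at h1
        exact absurd h1 (not_le.2 (by positivity))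
    rw [e]
    refine isClosed_iInter fun z => ContinuousOn.preimage_isClosed_of_isClosed ?_ isClosed_Icc
      isClosed_Ici
    exact (ContinuousLinearMap.continuous_det.comp_continuousOn (continuousOn_const.sub hZ)).norm
  have hsub : Icc (0 : ℝ) 1 ⊆ A := by
    refine hclosed.Icc_subset_of_forall_mem_nhdsWithin h0 fun s hs => ?_
    -- Upper semicontinuity of the spectrum keeps it below c Im z = δ for slightly larger
    -- parameters, and the strip hypothesis then excludes 0 ≤ c Im z < δ.
    have hopen : IsOpen {z : ℂ | c * z.im < δ} :=
      isOpen_lt (continuous_const.mul Complex.continuous_im) continuous_const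
    have h1 := (upperHemicontinuous_spectrum ℂ (H →L[ℂ] H)).forall_isOpen (Z s) _ hopen
      fun z hz => (hs.1 z hz).trans_lt hδ
    have h2 : Tendsto Z (𝓝[>] s) (𝓝 (Z s)) :=
      (hZ s ⟨hs.2.1, hs.2.2.le⟩).mono_left (nhdsWithin_le_iff.2
        (mem_of_superset (Ioo_mem_nhdsGT hs.2.2) fun t ht => ⟨hs.2.1.trans ht.1.le, ht.2.le⟩))
    filter_upwards [h2.eventually h1, Ioo_mem_nhdsGT hs.2.2] with t ht htI z hz
    by_contra! h
    exact absurd (ht hz) (not_lt.2 (hstrip t ⟨hs.2.1.trans_lt htI.1, htI.2.le⟩ z hz h.le))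
  intro z hz
  by_contra! h
  exact absurd (hsub ⟨zero_le_one, le_rfl⟩ z hz) (not_le.2 (hδ.trans_le (hstrip 1 ⟨one_pos, le_rfl⟩ z hz h)))

end

/-! ### Sign of the Cauchy transform near the real axis -/

section

variable {H₀ H₁ : Type*}
  [NormedAddCommGroup H₀] [InnerProductSpace ℂ H₀] [CompleteSpace H₀]
  [NormedAddCommGroup H₁] [InnerProductSpace ℂ H₁] [CompleteSpace H₁] [FiniteDimensional ℂ H₁]
  {A₀ : H₀ →ₗ.[ℂ] H₀} {A₁ : H₁ →L[ℂ] H₁} {B : H₁ →L[ℂ] H₀} {E : ProjMeasure H₀}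
  {a b : EReal} {D : Set ℂ} {K : ℂ → H₁ →L[ℂ] H₁} {l : ℤˣ} {γ : ℝ → ℂ}

/-- A Poisson type estimate: below the real axis the Cauchy integral of the density has imaginary
part bounded away from zero. -/
theorem Setting.im_inner_cauchy_le (hS : Setting A₀ A₁ B E a b D K) (u : H₁) {x ε κ : ℝ}
    (hε : 0 < ε) (hsub : Ioo (x - ε) (x + ε) ⊆ interval a b)
    (hκ : ∀ t ∈ Ioo (x - ε) (x + ε), κ ≤ (inner ℂ u (K t u)).re) (hκ0 : 0 ≤ κ) :
    ((l : ℤ) : ℝ) * (inner ℂ u ((∫ t : ℝ in interval a b,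
      ((t : ℂ) - (x - (((l : ℤ) : ℝ) * ε : ℝ) * Complex.I))⁻¹ • K t) u)).im ≤ -κ := by
  set z : ℂ := x - (((l : ℤ) : ℝ) * ε : ℝ) * Complex.I with hz
  have hzre : z.re = x := by simp [hz]
  have hzim : z.im = -(((l : ℤ) : ℝ) * ε) := by simp [hz]
  have hl := units_cast_sq l
  have hl0 : ((l : ℤ) : ℝ) ≠ 0 := fun h => by simp [h] at hl
  have hz0 : z.im ≠ 0 := by rw [hzim]; exact neg_ne_zero.2 (mul_ne_zero hl0 hε.ne')
  have hm := measurableSet_interval a b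
  have hint := (hS.integrable_resolvent_smul hz0)
  have hint2 : IntegrableOn (fun t : ℝ => inner ℂ u ((((t : ℂ) - z)⁻¹ • K t) u)) (interval a b) :=
    (hint.apply_continuousLinearMap u).const_inner u
  -- Since ⟨u, K(t)u⟩ is real, the imaginary part of the Cauchy kernel appears as the Poisson
  -- kernel; l² = 1 makes the sign independent of the sheet.
  have hpt : ∀ t ∈ interval a b, -(((l : ℤ) : ℝ) * (inner ℂ u ((((t : ℂ) - z)⁻¹ • K t) u)).im)
      = ε / ((t - x) ^ 2 + ε ^ 2) * (inner ℂ u (K t u)).re := by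
    intro t ht
    rw [smul_apply, inner_smul_right, Complex.mul_im, hS.inner_im u ht, Complex.inv_im,
      Complex.normSq_apply]
    simp only [Complex.sub_re, Complex.sub_im, Complex.ofReal_re, Complex.ofReal_im, hzre, hzim]
    have : (t - x) * (t - x) + (0 - -(((l : ℤ) : ℝ) * ε)) * (0 - -(((l : ℤ) : ℝ) * ε))
      = (t - x) ^ 2 + ε ^ 2 := by linear_combination ε ^ 2 * hl
    rw [this]
    linear_combination ε * (inner ℂ u (K t u)).re / ((t - x) ^ 2 + ε ^ 2) * hl
  have hint3 : IntegrableOn (fun t : ℝ => ε / ((t - x) ^ 2 + ε ^ 2) * (inner ℂ u (K t u)).re)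
      (interval a b) :=
    ((hint2.im.const_mul ((l : ℤ) : ℝ)).neg).congr ((ae_restrict_iff' hm).2
      (Eventually.of_forall hpt))
  have e1 : ((l : ℤ) : ℝ) * (inner ℂ u ((∫ t : ℝ in interval a b, ((t : ℂ) - z)⁻¹ • K t) u)).im
      = -∫ t in interval a b, ε / ((t - x) ^ 2 + ε ^ 2) * (inner ℂ u (K t u)).re := by
    rw [ContinuousLinearMap.integral_apply hint, ← integral_inner (hint.apply_continuousLinearMap u),
      ← setIntegral_congr_fun hm hpt, integral_neg, neg_neg, integral_const_mul]
    congr 1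
    exact (Complex.imCLM.integral_comp_comm hint2).symm
  rw [e1, neg_le_neg_iff]
  -- For |t - x| < ε the Poisson kernel is at least 1/(2ε), and the window has length 2ε, so exactly
  -- κ remains.
  have hlow : ∀ t ∈ Ioo (x - ε) (x + ε),
      κ / (2 * ε) ≤ ε / ((t - x) ^ 2 + ε ^ 2) * (inner ℂ u (K t u)).re := by
    intro t ht
    have h1 : (t - x) ^ 2 ≤ ε ^ 2 := sq_le_sq' (by linarith [ht.1]) (by linarith [ht.2])
    have h2 : 1 / (2 * ε) ≤ ε / ((t - x) ^ 2 + ε ^ 2) := by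
      rw [div_le_div_iff₀ (by positivity) (by positivity)]
      nlinarith
    calc κ / (2 * ε) = 1 / (2 * ε) * κ := by ring
      _ ≤ _ := mul_le_mul h2 (hκ t ht) hκ0 (by positivity)
  calc κ = κ / (2 * ε) * volume.real (Ioo (x - ε) (x + ε)) := by
        rw [Real.volume_real_Ioo_of_le (by linarith)]
        field_simp
        ring
    _ ≤ ∫ t in Ioo (x - ε) (x + ε), ε / ((t - x) ^ 2 + ε ^ 2) * (inner ℂ u (K t u)).re :=
        setIntegral_ge_of_const_le_real measurableSet_Ioo (by simp) hlow (hint3.mono_set hsub)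
    _ ≤ _ := setIntegral_mono_set hint3 ((ae_restrict_iff' hm).2 (Eventually.of_forall fun t ht =>
        mul_nonneg (by positivity) (hS.inner_nonneg u ht))) hsub.eventuallyLE

/-- Approach x from the half plane opposite to Γ, where the transform is the Cauchy integral of the
density. The bound -κ is uniform in the height ε, so it survives the limit by continuity. -/
theorem Setting.im_inner_cauchyTransform_neg (hS : Setting A₀ A₁ B E a b D K)
    (hγ : IsAdmissibleContour K a b (sheet D l) γ) {x : ℝ} (hxI : x ∈ interval a b)
    (hx : Metric.infDist (x : ℂ) (spectrum ℂ A₁) < contourDist a b γ (spectrum ℂ A₁)) {u : H₁}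
    (hu : 0 < (inner ℂ u (K x u)).re) :
    ((l : ℤ) : ℝ) * (inner ℂ u (cauchyTransform K a b γ x u)).im < 0 := by
  set κ := (inner ℂ u (K x u)).re / 2
  have hκ : 0 < κ := by positivity
  have hl := units_cast_sq l
  obtain ⟨r, hr1, hr2⟩ := exists_between hx
  have hcont := hS.continuousOn_cauchyTransform hγ hr2
  have hnhds : {z | Metric.infDist z (spectrum ℂ A₁) ≤ r} ∈ 𝓝 (x : ℂ) :=
    Filter.mem_of_superset ((isOpen_lt (Metric.continuous_infDist_pt _) continuous_const).mem_nhds hr1)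
      fun z hz => le_of_lt (b := r) hz
  have hat : ContinuousAt (cauchyTransform K a b γ) (x : ℂ) := hcont.continuousAt hnhds
  have hev : ∀ᶠ t in 𝓝 x, t ∈ interval a b ∧ κ < (inner ℂ u (K t u)).re := by
    refine Eventually.and ((isOpen_interval a b).mem_nhds hxI) ?_
    have h1 : ContinuousAt (fun t : ℝ => (inner ℂ u (K t u)).re) x :=
      (Complex.continuous_re.comp_continuousOn (hS.continuousOn_inner u u)).continuousAt
        ((isOpen_interval a b).mem_nhds hxI)
    exact h1.eventually (lt_mem_nhds (half_lt_self hu))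
  obtain ⟨δ, hδ, hball⟩ := Metric.eventually_nhds_iff_ball.1 hev
  have hlim : Tendsto (fun ε : ℝ => ((l : ℤ) : ℝ) * (inner ℂ u (cauchyTransform K a b γ
      (x - (((l : ℤ) : ℝ) * ε : ℝ) * Complex.I) u)).im) (𝓝[>] 0)
      (𝓝 (((l : ℤ) : ℝ) * (inner ℂ u (cauchyTransform K a b γ x u)).im)) := by
    have h1 : Tendsto (fun ε : ℝ => (x : ℂ) - (((l : ℤ) : ℝ) * ε : ℝ) * Complex.I) (𝓝[>] 0)
        (𝓝 (x : ℂ)) := by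
      have : Continuous fun ε : ℝ => (x : ℂ) - (((l : ℤ) : ℝ) * ε : ℝ) * Complex.I := by fun_prop
      simpa using (this.tendsto 0).mono_left nhdsWithin_le_nhds
    have h2 := hat.tendsto.comp h1
    have h3 : Continuous fun T : H₁ →L[ℂ] H₁ => ((l : ℤ) : ℝ) * (inner ℂ u (T u)).im := by
      fun_prop
    exact (h3.tendsto _).comp h2
  refine (le_of_tendsto hlim ?_).trans_lt (neg_lt_zero.2 hκ)
  filter_upwards [Ioo_mem_nhdsGT hδ] with ε hε
  have hz : ((l : ℤ) : ℝ) * ((x : ℂ) - (((l : ℤ) : ℝ) * ε : ℝ) * Complex.I).im < 0 := by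
    simp only [Complex.sub_im, Complex.ofReal_im, Complex.mul_I_im, Complex.ofReal_re]
    nlinarith [hε.1]
  rw [hS.cauchyTransform_eq hγ hz]
  have hsub : Ioo (x - ε) (x + ε) ⊆ Metric.ball x δ := by
    rw [Real.ball_eq_Ioo]
    exact Ioo_subset_Ioo (by linarith [hε.2]) (by linarith [hε.2])
  exact hS.im_inner_cauchy_le u hε.1 (fun t ht => (hball t (hsub ht)).1)
    (fun t ht => (hball t (hsub ht)).2.le) hκ.le

theorem isCompact_setOf_infDist_le {X : Type*} [PseudoMetricSpace X] [ProperSpace X] {σ : Set X}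
    (hσ : Bornology.IsBounded σ) (hne : σ.Nonempty) (r : ℝ) :
    IsCompact {z | Metric.infDist z σ ≤ r} := by
  refine Metric.isCompact_of_isClosed_isBounded
    (isClosed_le (Metric.continuous_infDist_pt _) continuous_const) ?_
  obtain ⟨x, hx⟩ := hne
  obtain ⟨R, hR⟩ := hσ.subset_closedBall x
  refine (Metric.isBounded_closedBall (x := x) (r := R + (r + 1))).subset fun z hz => ?_
  obtain ⟨y, hy, hzy⟩ := (Metric.infDist_lt_iff ⟨x, hx⟩).1 (lt_of_le_of_lt hz (lt_add_one r))
  have h1 := hR hy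
  rw [Metric.mem_closedBall] at h1 ⊢
  linarith [dist_triangle z y x]

/-- The imaginary part stays negative in a strip around the real axis. -/
theorem Setting.exists_strip (hS : Setting A₀ A₁ B E a b D K)
    (hγ : IsAdmissibleContour K a b (sheet D l) γ) {r : ℝ}
    (hr : r < contourDist a b γ (spectrum ℂ A₁)) (hne : (spectrum ℂ A₁).Nonempty)
    (hpos : ∀ x ∈ interval a b, Metric.infDist (x : ℂ) (spectrum ℂ A₁) ≤ r →
      ∀ u : H₁, ‖u‖ = 1 → 0 < (inner ℂ u (K x u)).re) :
    ∃ δ > 0, ∀ z, Metric.infDist z (spectrum ℂ A₁) ≤ r → |z.im| < δ → ∀ u : H₁, ‖u‖ = 1 →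
      ((l : ℤ) : ℝ) * (inner ℂ u (cauchyTransform K a b γ z u)).im < 0 := by
  let N := {z | Metric.infDist z (spectrum ℂ A₁) ≤ r}
  have hN : IsCompact N := isCompact_setOf_infDist_le (spectrum.isCompact A₁).isBounded hne r
  have hP : IsCompact (N ×ˢ Metric.sphere (0 : H₁) 1) := hN.prod (isCompact_sphere _ _)
  have hφ : ContinuousOn (fun p : ℂ × H₁ =>
      ((l : ℤ) : ℝ) * (inner ℂ p.2 (cauchyTransform K a b γ p.1 p.2)).im)
      (N ×ˢ Metric.sphere (0 : H₁) 1) := by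
    have h1 : ContinuousOn (fun p : ℂ × H₁ => cauchyTransform K a b γ p.1)
        (N ×ˢ Metric.sphere (0 : H₁) 1) :=
      (hS.continuousOn_cauchyTransform hγ hr).comp continuousOn_fst fun p hp => hp.1
    have h2 := h1.clm_apply (continuousOn_snd (s := N ×ˢ Metric.sphere (0 : H₁) 1))
    exact continuousOn_const.mul (Complex.continuous_im.comp_continuousOn (continuousOn_snd.inner h2))
  -- The pairs (z, u) violating the sign form a compact set without real z, so |Im z| has a positive
  -- lower bound on it.
  have hC : IsCompact ((N ×ˢ Metric.sphere (0 : H₁) 1) ∩ (fun p : ℂ × H₁ =>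
      ((l : ℤ) : ℝ) * (inner ℂ p.2 (cauchyTransform K a b γ p.1 p.2)).im) ⁻¹' Ici 0) :=
    hP.of_isClosed_subset (hφ.preimage_isClosed_of_isClosed hP.isClosed isClosed_Ici) inter_subset_left
  have himpos : ∀ p ∈ ((N ×ˢ Metric.sphere (0 : H₁) 1) ∩ (fun p : ℂ × H₁ =>
      ((l : ℤ) : ℝ) * (inner ℂ p.2 (cauchyTransform K a b γ p.1 p.2)).im) ⁻¹' Ici 0),
      0 < |p.1.im| := by
    rintro ⟨z, u⟩ ⟨⟨hz, hu⟩, hge⟩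
    refine abs_pos.2 fun h => ?_
    obtain ⟨x, rfl⟩ : ∃ x : ℝ, (x : ℂ) = z := ⟨z.re, Complex.ext rfl (by simpa using h.symm)⟩
    have hlt := (show Metric.infDist (x : ℂ) (spectrum ℂ A₁) ≤ r from hz).trans_lt hr
    have hI := hγ.mem_interval hS.lt hS.spectrum₁ hne hlt
    exact absurd (hS.im_inner_cauchyTransform_neg hγ hI hlt (hpos _ hI hz u (by simpa using hu))) (not_lt.2 hge)
  obtain ⟨δ, hδ, hδC⟩ : ∃ δ > 0, ∀ p ∈ ((N ×ˢ Metric.sphere (0 : H₁) 1) ∩ (fun p : ℂ × H₁ =>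
      ((l : ℤ) : ℝ) * (inner ℂ p.2 (cauchyTransform K a b γ p.1 p.2)).im) ⁻¹' Ici 0),
      δ ≤ |p.1.im| :=
    hC.exists_forall_le' (f := fun p => |p.1.im|)
      (continuous_abs.comp (Complex.continuous_im.comp continuous_fst)).continuousOn himpos
  refine ⟨δ, hδ, fun z hz hzδ u hu => ?_⟩
  by_contra! h
  exact absurd (hδC (z, u) ⟨⟨hz, by simpa using hu⟩, h⟩) (not_le.2 hzδ)

end

/-! ### Location of the spectrum of the solution -/

section

variable {H : Type*} [NormedAddCommGroup H] [InnerProductSpace ℂ H] [FiniteDimensional ℂ H]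
  {A₁ : H →L[ℂ] H} {K : ℂ → H →L[ℂ] H} {a b : EReal} {γ : ℝ → ℂ} {d : ℝ} {X : H →L[ℂ] H}

namespace IsGoodContour

variable (h : IsGoodContour A₁ K a b γ d)

include h

omit [FiniteDimensional ℂ H] in
theorem spectrum_nonempty (hd : d = contourDist a b γ (spectrum ℂ A₁)) :
    (spectrum ℂ A₁).Nonempty := by
  by_contra! he
  have := h.pos
  simp [hd, he, contourDist] at this

omit [FiniteDimensional ℂ H] in
theorem integrable_cauchy {c : ℝ} (hc : 0 < c) {z : ℂ} (hz : ∀ t ∈ interval a b, c ≤ ‖γ t - z‖) :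
    IntegrableOn (fun t => (deriv γ t * (γ t - z)⁻¹) • K (γ t)) (interval a b) := by
  have hm := measurableSet_interval a b
  refine (h.integrable.const_mul c⁻¹).mono'
    (AEStronglyMeasurable.smul ((aestronglyMeasurable_deriv γ _).mul ?_)
      (h.continuousOn_comp.aestronglyMeasurable hm))
    ((ae_restrict_iff' hm).2 (Eventually.of_forall fun t ht => ?_))
  · exact ((h.continuousOn.sub continuousOn_const).inv₀ fun t ht =>
      norm_pos_iff.1 (hc.trans_le (hz t ht))).aestronglyMeasurable hm
  · rw [norm_smul, norm_mul, norm_inv]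
    calc _ = ‖γ t - z‖⁻¹ * (‖K (γ t)‖ * ‖deriv γ t‖) := by ring
      _ ≤ _ := mul_le_mul_of_nonneg_right (inv_anti₀ hc (hz t ht)) (by positivity)

/-- On an eigenvector the resolvent acts as (z - μ)⁻¹; the sign in the transformator turns this into
the Cauchy kernel (μ - z)⁻¹. The lower bound for A₁ + X - μ keeps z off the contour. -/
theorem transformator_apply_eigenvector (hX : ‖X‖ < d) {z : ℂ} {u : H} (hu : u ≠ 0)
    (hzu : (A₁ + X) u = z • u) :
    transformator K a b γ (A₁ + X) u = cauchyTransform K a b γ z u := by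
  have hu0 := norm_pos_iff.2 hu
  have happ : ∀ w : ℂ, (A₁ + X - w • (1 : H →L[ℂ] H)) u = (z - w) • u := fun w => by
    rw [sub_apply, hzu, sub_smul]
    rfl
  have hz : ∀ t ∈ interval a b, d - ‖X‖ ≤ ‖γ t - z‖ := fun t ht => by
    have h1 := h.bounded_below ht X u
    rw [happ, norm_smul, norm_sub_rev] at h1
    exact le_of_mul_le_mul_right h1 hu0
  have hc := sub_pos.2 hX
  rw [transformator, cauchyTransform, neg_apply,
    ContinuousLinearMap.integral_apply (h.integrable_transformator hX),
    ContinuousLinearMap.integral_apply (h.integrable_cauchy hc hz), ← integral_neg]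
  refine setIntegral_congr_fun (measurableSet_interval a b) fun t ht => ?_
  have hzt : z - γ t ≠ 0 := by
    rw [← norm_pos_iff, norm_sub_rev]
    exact hc.trans_le (hz t ht)
  have hR : Ring.inverse (A₁ + X - γ t • (1 : H →L[ℂ] H)) u = (z - γ t)⁻¹ • u := by
    have h1 : Ring.inverse (A₁ + X - γ t • (1 : H →L[ℂ] H))
        ((A₁ + X - γ t • (1 : H →L[ℂ] H)) u) = u :=
      congrArg (fun S : H →L[ℂ] H => S u) (Ring.inverse_mul_cancel _ (h.isUnit ht hX))
    rw [happ, map_smul] at h1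
    nth_rw 2 [← h1]
    rw [smul_smul, inv_mul_cancel₀ hzt, one_smul]
  change -(deriv γ t • K (γ t) (Ring.inverse (A₁ + X - γ t • (1 : H →L[ℂ] H)) u))
    = (deriv γ t * (γ t - z)⁻¹) • K (γ t) u
  rw [hR, map_smul, smul_smul, ← neg_smul, ← neg_sub z (γ t), inv_neg, mul_neg]

end IsGoodContour

end

/-! ### Location of the spectrum and independence of the contour -/

section

variable {H₀ H₁ : Type*}
  [NormedAddCommGroup H₀] [InnerProductSpace ℂ H₀] [CompleteSpace H₀]
  [NormedAddCommGroup H₁] [InnerProductSpace ℂ H₁] [CompleteSpace H₁] [FiniteDimensional ℂ H₁]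
  {A₀ : H₀ →ₗ.[ℂ] H₀} {A₁ : H₁ →L[ℂ] H₁} {B : H₁ →L[ℂ] H₀} {E : ProjMeasure H₀}
  {a b : EReal} {D : Set ℂ} {K : ℂ → H₁ →L[ℂ] H₁} {l : ℤˣ} {γ : ℝ → ℂ}

theorem abs_units_cast (l : ℤˣ) : |((l : ℤ) : ℝ)| = 1 := by
  rcases Int.units_eq_one_or l with rfl | rfl <;> simp

omit [FiniteDimensional ℂ H₁] in
theorem Setting.spectrum₁_im (hS : Setting A₀ A₁ B E a b D K) {z : ℂ} (hz : z ∈ spectrum ℂ A₁) :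
    z.im = 0 := by
  obtain ⟨x, -, rfl⟩ := hS.spectrum₁ hz
  simp

/-- If the density is positive near `σ(A₁)`, then the spectrum of `A₁ + X` lies in the half plane
opposite to the contour. -/
theorem Setting.exists_solution_spectrum_im_neg (hS : Setting A₀ A₁ B E a b D K)
    (hγ : IsAdmissibleContour K a b (sheet D l) γ)
    (hlt : variation K a b γ < 1 / 4 * contourDist a b γ (spectrum ℂ A₁) ^ 2)
    (hpos : ∀ x ∈ interval a b, Metric.infDist (x : ℂ) (spectrum ℂ A₁)
        ≤ rMin K a b (spectrum ℂ A₁) γ → ∀ u : H₁, ‖u‖ = 1 → 0 < (inner ℂ u (K x u)).re) :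
    ∃ X : H₁ →L[ℂ] H₁, ‖X‖ ≤ rMin K a b (spectrum ℂ A₁) γ ∧
      X = transformator K a b γ (A₁ + X) ∧
      ∀ z ∈ spectrum ℂ (A₁ + X), ((l : ℤ) : ℝ) * z.im < 0 := by
  have hg := hS.isGoodContour hγ hlt
  obtain ⟨hr0, hrd, hr⟩ := small_root hg.pos variation_nonneg hlt
  change 0 ≤ rMin K a b (spectrum ℂ A₁) γ at hr0
  change rMin K a b (spectrum ℂ A₁) γ < _ at hrd
  change rMin K a b (spectrum ℂ A₁) γ * (_ - rMin K a b (spectrum ℂ A₁) γ) = _ at hr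
  set r := rMin K a b (spectrum ℂ A₁) γ
  set d := contourDist a b γ (spectrum ℂ A₁)
  have hrd' : r < d := by linarith [hg.pos]
  choose! X hX hXe using fun s hs => hg.exists_fixedPoint hr0 hrd hr (s := s) hs
  obtain ⟨δ, hδ, hstrip⟩ := hS.exists_strip hγ hrd' (hg.spectrum_nonempty rfl) hpos
  have h1 : (1 : ℝ) ∈ Icc (0 : ℝ) 1 := ⟨zero_le_one, le_rfl⟩
  have h0 : (0 : ℝ) ∈ Icc (0 : ℝ) 1 := ⟨le_rfl, zero_le_one⟩
  have hcont : ContinuousOn (fun s => A₁ + X s) (Icc 0 1) := by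
    refine continuousOn_const.add (LipschitzOnWith.continuousOn
      (K := Real.toNNReal (r * (d - r) / (d - 2 * r))) (LipschitzOnWith.of_dist_le_mul ?_))
    intro s hs s' hs'
    rw [dist_eq_norm, Real.dist_eq]
    refine (hg.norm_fixedPoint_sub_le hr0 hrd hr hs (hX s hs) (hXe s hs) (hX s' hs')
      (hXe s' hs')).trans ?_
    gcongr
    exact Real.le_coe_toNNReal _
  refine ⟨X 1, hX 1 h1, by simpa using hXe 1 h1, ?_⟩
  refine spectrum_im_neg_of_path hcont hδ (fun z hz => ?_) (fun s hs z hz hz0 => ?_)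
    (abs_units_cast l)
  · have hX0 : X 0 = 0 := by simpa using hXe 0 h0
    rw [hX0, add_zero] at hz
    rw [hS.spectrum₁_im hz, mul_zero]
  · by_contra! hzδ
    have hsI : s ∈ Icc (0 : ℝ) 1 := ⟨hs.1.le, hs.2⟩
    have habs : |z.im| < δ := by
      rw [← one_mul |z.im|, ← abs_units_cast l, ← abs_mul, abs_of_nonneg hz0]
      exact hzδ
    have hzr := (infDist_le_norm_of_mem_spectrum_add hS.selfAdjoint₁ hz).trans (hX s hsI)
    obtain ⟨u, hu, hzu⟩ := exists_eigenvector_of_mem_spectrum hz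
    have hneg := hstrip z hzr habs u hu
    have hu0 : u ≠ 0 := fun h => by simp [h] at hu
    have hT := hg.transformator_apply_eigenvector ((hX s hsI).trans_lt hrd') hu0 hzu
    have hXu : X s u = (s : ℂ) • cauchyTransform K a b γ z u := by
      rw [← hT]
      conv_lhs => rw [hXe s hsI]
      rw [smul_apply, Complex.coe_smul]
    -- Pairing the eigenvalue equation with u: the A₁ term is real, so l Im z = s l Im ⟨u, C(z)u⟩ <
    -- 0, against l Im z ≥ 0.
    have hin : z = inner ℂ u (A₁ u) + (s : ℂ) * inner ℂ u (cauchyTransform K a b γ z u) := by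
      have h2 := congrArg (fun v => inner ℂ u v) hzu
      simp only [add_apply, inner_add_right, hXu, inner_smul_right] at h2
      rw [inner_self_eq_norm_sq_to_K, hu] at h2
      simpa using h2.symm
    have him : (inner ℂ u (A₁ u)).im = 0 := by
      have := (hS.selfAdjoint₁.isSymmetric).im_inner_self_apply u
      simpa using this
    have hzim : z.im = s * (inner ℂ u (cauchyTransform K a b γ z u)).im := by
      have := congrArg Complex.im hin
      rwa [Complex.add_im, him, zero_add, Complex.im_ofReal_mul] at this
    rw [hzim] at hz0
    nlinarith [hs.1]

omit [FiniteDimensional ℂ H₁] in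
theorem analyticAt_inverse_sub_smul {Z : H₁ →L[ℂ] H₁} {w : ℂ} (hw : w ∉ spectrum ℂ Z) :
    AnalyticAt ℂ (fun w => Ring.inverse (Z - w • (1 : H₁ →L[ℂ] H₁))) w := by
  have hu : IsUnit (Z - w • (1 : H₁ →L[ℂ] H₁)) := by
    have := spectrum.notMem_iff.1 hw
    rw [Algebra.algebraMap_eq_smul_one] at this
    rw [← neg_sub]
    exact this.neg
  obtain ⟨U, hU⟩ := hu
  have h1 : AnalyticAt ℂ (Ring.inverse : (H₁ →L[ℂ] H₁) → _) (Z - w • (1 : H₁ →L[ℂ] H₁)) :=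
    hU ▸ analyticAt_inverse U
  have h2 : AnalyticAt ℂ (fun w : ℂ => Z - w • (1 : H₁ →L[ℂ] H₁)) w :=
    analyticAt_const.sub (analyticAt_id.smul analyticAt_const)
  exact AnalyticAt.comp (f := fun w : ℂ => Z - w • (1 : H₁ →L[ℂ] H₁)) h1 h2

/-- The transformator does not depend on the contour as long as the spectrum of its argument lies in
the opposite half plane. -/
theorem Setting.transformator_eq (hS : Setting A₀ A₁ B E a b D K)
    (hγ : IsAdmissibleContour K a b (sheet D l) γ) {Z : H₁ →L[ℂ] H₁}
    (hZ : ∀ z ∈ spectrum ℂ Z, ((l : ℤ) : ℝ) * z.im < 0) :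
    transformator K a b γ Z
      = -∫ t : ℝ in interval a b, K t * Ring.inverse (Z - (t : ℂ) • (1 : H₁ →L[ℂ] H₁)) := by
  let R : ℂ → H₁ →L[ℂ] H₁ := fun w => Ring.inverse (Z - w • (1 : H₁ →L[ℂ] H₁))
  have hR : ∀ w : ℂ, 0 ≤ ((l : ℤ) : ℝ) * w.im → AnalyticAt ℂ R w := fun w hw =>
    analyticAt_inverse_sub_smul fun h => absurd (hZ w h) (not_lt.2 hw)
  -- The resolvent is bounded on a compact half disc by continuity, and by one outside radius ‖Z‖ +
  -- 1.
  obtain ⟨C, hC⟩ := IsCompact.exists_bound_of_continuousOn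
    ((isCompact_closedBall (0 : ℂ) (‖Z‖ + 1)).inter_right (isClosed_le continuous_const
      (continuous_const.mul Complex.continuous_im) : IsClosed {w : ℂ | 0 ≤ ((l : ℤ) : ℝ) * w.im}))
    (f := R) fun w hw => (hR w hw.2).continuousAt.continuousWithinAt
  refine congrArg Neg.neg (hS.contour_integral_eq hγ hR (M := max C 1) fun w hw => ?_)
  by_cases hwZ : ‖w‖ ≤ ‖Z‖ + 1
  · exact (hC w ⟨by simpa using hwZ, hw⟩).trans (le_max_left _ _)
  · refine (norm_inverse_le_of_bounded_below one_pos fun x => ?_).trans (by simp)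
    have h1 : ‖w • x‖ - ‖Z x‖ ≤ ‖Z x - w • x‖ := by
      rw [norm_sub_rev]
      exact norm_sub_norm_le _ _
    have h2 := Z.le_opNorm x
    rw [norm_smul] at h1
    change _ ≤ ‖Z x - w • x‖
    nlinarith [norm_nonneg x]

/-- A contour with smaller `r_min` for which the density is positive on the relevant neighbourhood
of `σ(A₁)`. -/
theorem Setting.exists_contour (hS : Setting A₀ A₁ B E a b D K)
    (hγ : IsAdmissibleContour K a b (sheet D l) γ)
    (hlt : variation K a b γ < 1 / 4 * contourDist a b γ (spectrum ℂ A₁) ^ 2)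
    (hpos : ∀ x ∈ interval a b, Metric.infDist (x : ℂ) (spectrum ℂ A₁)
        ≤ rZero K a b (sheet D l) (spectrum ℂ A₁) → ∀ u : H₁, ‖u‖ = 1 →
        0 < (inner ℂ u (K x u)).re) :
    ∃ γ', IsAdmissibleContour K a b (sheet D l) γ' ∧
      variation K a b γ' < 1 / 4 * contourDist a b γ' (spectrum ℂ A₁) ^ 2 ∧
      rMin K a b (spectrum ℂ A₁) γ' ≤ rMin K a b (spectrum ℂ A₁) γ ∧
      ∀ x ∈ interval a b, Metric.infDist (x : ℂ) (spectrum ℂ A₁)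
        ≤ rMin K a b (spectrum ℂ A₁) γ' → ∀ u : H₁, ‖u‖ = 1 → 0 < (inner ℂ u (K x u)).re := by
  have hg := hS.isGoodContour hγ hlt
  have hne := hg.spectrum_nonempty rfl
  rcases le_or_gt (rMin K a b (spectrum ℂ A₁) γ) (rZero K a b (sheet D l) (spectrum ℂ A₁))
    with hle | hgt
  · exact ⟨γ, hγ, hlt, le_rfl, fun x hx hxr => hpos x hx (hxr.trans hle)⟩
  have hrd : rMin K a b (spectrum ℂ A₁) γ < contourDist a b γ (spectrum ℂ A₁) :=
    (small_root hg.pos variation_nonneg hlt).2.1.trans (by linarith [hg.pos])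
  set r := rMin K a b (spectrum ℂ A₁) γ
  let N : Set ℝ := {x | Metric.infDist (x : ℂ) (spectrum ℂ A₁) ≤ r}
  have hN : IsCompact N := Complex.isometry_ofReal.isClosedEmbedding.isCompact_preimage
    (isCompact_setOf_infDist_le (spectrum.isCompact A₁).isBounded hne r)
  have hNI : N ⊆ interval a b := fun x hx =>
    hγ.mem_interval hS.lt hS.spectrum₁ hne (lt_of_le_of_lt hx hrd)
  have hP : IsCompact (N ×ˢ Metric.sphere (0 : H₁) 1) := hN.prod (isCompact_sphere _ _)
  have hφ : ContinuousOn (fun p : ℝ × H₁ => (inner ℂ p.2 (K p.1 p.2)).re)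
      (N ×ˢ Metric.sphere (0 : H₁) 1) := by
    have h1 : ContinuousOn (fun p : ℝ × H₁ => K p.1) (N ×ˢ Metric.sphere (0 : H₁) 1) :=
      hS.continuousOn_interval.comp continuousOn_fst fun p hp => hNI hp.1
    have h2 := h1.clm_apply (continuousOn_snd (s := N ×ˢ Metric.sphere (0 : H₁) 1))
    exact Complex.continuous_re.comp_continuousOn (continuousOn_snd.inner h2)
  -- Positivity fails on a compact set of pairs (x, u), all strictly farther than r₀ from σ(A₁),
  -- hence at distance at least some r₁ > r₀. The infimum defining r₀ then supplies a contour with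
  -- r_min below r₁ and below that of γ.
  let W : Set (ℝ × H₁) := (N ×ˢ Metric.sphere (0 : H₁) 1) ∩
    (fun p : ℝ × H₁ => (inner ℂ p.2 (K p.1 p.2)).re) ⁻¹' Iic 0
  have hW : IsCompact W :=
    hP.of_isClosed_subset (hφ.preimage_isClosed_of_isClosed hP.isClosed isClosed_Iic)
      inter_subset_left
  have hcont : Continuous fun p : ℝ × H₁ => Metric.infDist (p.1 : ℂ) (spectrum ℂ A₁) :=
    (Metric.continuous_infDist_pt _).comp (Complex.continuous_ofReal.comp continuous_fst)
  have hWr : ∀ p ∈ W, rZero K a b (sheet D l) (spectrum ℂ A₁)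
      < Metric.infDist (p.1 : ℂ) (spectrum ℂ A₁) := by
    rintro ⟨x, u⟩ ⟨⟨hx, hu⟩, hle⟩
    by_contra! h
    exact absurd (hpos x (hNI hx) h u (by simpa using hu)) (not_lt.2 hle)
  obtain ⟨r₁, hr₁, hC₁⟩ := hW.exists_forall_le' hcont.continuousOn hWr
  obtain ⟨_, ⟨γ', hγ', hlt', rfl⟩, hr'⟩ := exists_lt_of_csInf_lt
    (s := {r | ∃ γ, IsAdmissibleContour K a b (sheet D l) γ ∧
      0 < contourDist a b γ (spectrum ℂ A₁) ^ 2 - 4 * variation K a b γ ∧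
      r = rMin K a b (spectrum ℂ A₁) γ}) ⟨_, γ, hγ, by linarith, rfl⟩ (lt_min hr₁ hgt)
  have hr'r := hr'.le.trans (min_le_right _ _)
  refine ⟨γ', hγ', by linarith, hr'r, fun x hx hxr u hu => ?_⟩
  by_contra! h
  exact absurd (hC₁ (x, u) ⟨⟨hxr.trans hr'r, by simpa using hu⟩, h⟩)
    (not_le.2 (hxr.trans_lt (hr'.trans_le (min_le_left _ _))))

end

/-! ### The Schur complement and the block operator -/

section

variable {H₀ H₁ : Type*}
  [NormedAddCommGroup H₀] [InnerProductSpace ℂ H₀] [CompleteSpace H₀]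
  [NormedAddCommGroup H₁] [InnerProductSpace ℂ H₁] [CompleteSpace H₁]
  {A₀ : H₀ →ₗ.[ℂ] H₀} {A₁ : H₁ →L[ℂ] H₁} {B : H₁ →L[ℂ] H₀} {E : ProjMeasure H₀}
  {a b : EReal} {D : Set ℂ} {K : ℂ → H₁ →L[ℂ] H₁} {l : ℤˣ} {γ : ℝ → ℂ}

omit [CompleteSpace H₀] in
theorem isResolventAt_unboundedResolvent {z : ℂ} (hz : z ∉ unboundedSpectrum A₀) :
    IsResolventAt A₀ z (unboundedResolvent A₀ z) := by
  have h : ∃ R, IsResolventAt A₀ z R := not_not.1 hz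
  rw [unboundedResolvent, dif_pos h]
  exact h.choose_spec

theorem Setting.notMem_unboundedSpectrum (hS : Setting A₀ A₁ B E a b D K) {z : ℂ}
    (hz : z.im ≠ 0) : z ∉ unboundedSpectrum A₀ := by
  rw [hS.spectrum₀]
  rintro ⟨x, -, rfl⟩
  exact hz (Complex.ofReal_im x)

/-- A zero of the Schur complement gives an eigenvalue of the block operator. -/
theorem isEigenvalue_blockOperator {z : ℂ} (hz : z ∉ unboundedSpectrum A₀) {u : H₁} (hu : u ≠ 0)
    (h : schurComplement A₀ A₁ B z u = 0) : IsEigenvalue (blockOperator A₀ A₁ B) z := by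
  have hR := isResolventAt_unboundedResolvent hz
  set R := unboundedResolvent A₀ z with hRdef
  obtain ⟨hd, he⟩ := hR.1 (B u)
  have hd' : -R (B u) ∈ A₀.domain := A₀.domain.neg_mem hd
  have he' : A₀ ⟨-R (B u), hd'⟩ + B u = z • -R (B u) := by
    have h1 : A₀ ⟨-R (B u), hd'⟩ = -A₀ ⟨R (B u), hd⟩ := by
      rw [← LinearPMap.map_neg]
      rfl
    rw [h1, smul_neg]
    nth_rw 2 [← he]
    abel
  have hs : A₁ u - z • u + ContinuousLinearMap.adjoint B (R (B u)) = 0 := h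
  refine ⟨⟨WithLp.toLp 2 (-R (B u), u), hd'⟩, fun h0 => hu ?_, ?_⟩
  · have h1 := congrArg (fun x : (blockOperator A₀ A₁ B).domain =>
      (x : WithLp 2 (H₀ × H₁)).snd) h0
    exact h1
  · change WithLp.toLp 2 (A₀ ⟨-R (B u), hd'⟩ + B u,
      -(ContinuousLinearMap.adjoint B (-R (B u))) + A₁ u) = z • WithLp.toLp 2 (-R (B u), u)
    rw [he', ← WithLp.toLp_smul, Prod.smul_mk, map_neg, neg_neg]
    congr 2
    rw [← sub_eq_zero, ← hs]
    abel

variable [FiniteDimensional ℂ H₁]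

/-- On the eigenvector X acts as the Cauchy transform, which in the opposite half plane equals B*(A₀
- z)⁻¹B. The eigenvalue equation is then M₁(z)u = 0. -/
theorem Setting.schurComplement_apply_eq_zero (hS : Setting A₀ A₁ B E a b D K)
    (hγ : IsAdmissibleContour K a b (sheet D l) γ) {d : ℝ} (hg : IsGoodContour A₁ K a b γ d)
    {X : H₁ →L[ℂ] H₁} (hX : ‖X‖ < d) (hXe : X = transformator K a b γ (A₁ + X)) {z : ℂ}
    (hz : ((l : ℤ) : ℝ) * z.im < 0) {u : H₁} (hu : u ≠ 0) (hzu : (A₁ + X) u = z • u) :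
    schurComplement A₀ A₁ B z u = 0 := by
  have hz0 : z.im ≠ 0 := fun h => by simp [h] at hz
  have hR := isResolventAt_unboundedResolvent (hS.notMem_unboundedSpectrum hz0)
  have h1 : X u = cauchyTransform K a b γ z u := by
    rw [← hg.transformator_apply_eigenvector hX hu hzu, ← hXe]
  rw [schurComplement, hS.adjoint_comp_resolvent_comp hz0 hR, ← hS.cauchyTransform_eq hγ hz,
    add_apply, ← h1, sub_apply]
  change A₁ u - z • u + X u = 0
  rw [← hzu, add_apply]
  abel

end

end BlockOp

theorem lemma5p4 {H₀ H₁ : Type*}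
    [NormedAddCommGroup H₀] [InnerProductSpace ℂ H₀] [CompleteSpace H₀]
    [NormedAddCommGroup H₁] [InnerProductSpace ℂ H₁] [CompleteSpace H₁] [FiniteDimensional ℂ H₁]
    (A₀ : H₀ →ₗ.[ℂ] H₀) (A₁ : H₁ →L[ℂ] H₁) (B : H₁ →L[ℂ] H₀) (E : BlockOp.ProjMeasure H₀)
    (a b : EReal) (D : Set ℂ) (K : ℂ → H₁ →L[ℂ] H₁)
    (hS : BlockOp.Setting A₀ A₁ B E a b D K)
    (l : ℤˣ) (γ : ℝ → ℂ)
    (hγ : BlockOp.IsAdmissibleContour K a b (BlockOp.sheet D l) γ)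
    (hbest : BlockOp.variation K a b γ
      < 1 / 4 * BlockOp.contourDist a b γ (spectrum ℂ A₁) ^ 2)
    (hpos : ∃ c₀ : ℝ, 0 < c₀ ∧ ∀ μ ∈ BlockOp.interval a b,
      Metric.infDist (μ : ℂ) (spectrum ℂ A₁)
        ≤ BlockOp.rZero K a b (BlockOp.sheet D l) (spectrum ℂ A₁) →
      ∀ x : H₁, c₀ * ‖x‖ ^ 2 ≤ (inner ℂ (K (μ : ℂ) x) x).re) :
    ∃ X : H₁ →L[ℂ] H₁,
      -- `X` is the unique solution of the basic equation, so that `Z^(l) = A₁ + X`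
      (‖X‖ ≤ BlockOp.rMin K a b (spectrum ℂ A₁) γ ∧ X = BlockOp.transformator K a b γ (A₁ + X)) ∧
      (∀ Y : H₁ →L[ℂ] H₁, ‖Y‖ < BlockOp.rMax K a b (spectrum ℂ A₁) γ →
        Y = BlockOp.transformator K a b γ (A₁ + Y) → Y = X) ∧
      -- no spectrum in `D^l`
      Disjoint (spectrum ℂ (A₁ + X)) (BlockOp.sheet D l) ∧
      -- every eigenvalue of `Z^(l)` is a non-real eigenvalue of `M₁(·)` and of `L`
      ∀ z : ℂ, Module.End.HasEigenvalue ((A₁ + X : H₁ →L[ℂ] H₁) : Module.End ℂ H₁) z →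
        z.im ≠ 0 ∧ z ∉ BlockOp.unboundedSpectrum A₀ ∧
        (∃ u : H₁, u ≠ 0 ∧ BlockOp.schurComplement A₀ A₁ B z u = 0) ∧
        BlockOp.IsEigenvalue (BlockOp.blockOperator A₀ A₁ B) z := by
  obtain ⟨c₀, hc₀, hpos⟩ := hpos
  have hg := hS.isGoodContour hγ hbest
  obtain ⟨hr0, hrd, hr⟩ := BlockOp.small_root hg.pos BlockOp.variation_nonneg hbest
  obtain ⟨γ', hγ', hlt', hr', hpos'⟩ := hS.exists_contour hγ hbest fun x hx hxr u hu => by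
    have h1 := hpos x hx hxr u
    rw [hu, one_pow, mul_one, ← inner_conj_symm, Complex.conj_re] at h1
    exact hc₀.trans_le h1
  obtain ⟨X, hX, hXe, hspec⟩ := hS.exists_solution_spectrum_im_neg hγ' hlt' hpos'
  -- The transformator is carried from γ' to Δ₀ and back out to γ; both moves use only the location
  -- of the spectrum of A₁ + X.
  rw [hS.transformator_eq hγ' hspec, ← hS.transformator_eq hγ hspec] at hXe
  have hXr := hX.trans hr'
  have hXd : ‖X‖ < BlockOp.contourDist a b γ (spectrum ℂ A₁) :=
    hXr.trans_lt (hrd.trans (by linarith [hg.pos]))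
  refine ⟨X, ⟨hXr, hXe⟩, fun Y hY hYe => hg.eq_of_fixedPoint hr0 hrd hr hXr hXe hY hYe, ?_, ?_⟩
  · refine Set.disjoint_left.2 fun z hz hzD => ?_
    exact absurd (hspec z hz) (not_lt.2 (BlockOp.sheet_im_pos hS.lowerHalfPlane hzD).le)
  · intro z hz
    have hzl := hspec z (BlockOp.mem_spectrum_iff_hasEigenvalue.2 hz)
    have hz0 : z.im ≠ 0 := fun h => by simp [h] at hzl
    obtain ⟨u, hu⟩ := hz.exists_hasEigenvector
    have hs := hS.schurComplement_apply_eq_zero hγ hg hXd hXe hzl hu.2 hu.apply_eq_smul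
    have hzA := hS.notMem_unboundedSpectrum hz0
    exact ⟨hz0, hzA, ⟨u, hu.2, hs⟩, BlockOp.isEigenvalue_blockOperator hzA hu.2 hs⟩
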